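/- **Proposition (Integration).** For points of $\mathbb{R}^2$ put $d(x,y)=|x_1-y_1|+\sqrt{|x_2-y_2|}$ and $B_L(x)=\{y: d(y,x)<L\}$. For $T>0$ let $\psi_T$ be the function on $\mathbb{R}^2$ with Fourier transform $\hat\psi_T(k)=\exp(-T(k_1^4+k_2^2))$, i.e. $\psi_T(x)=(2\pi)^{-2}\int_{\mathbb{R}^2}e^{ik\cdot x}e^{-T(k_1^4+k_2^2)}\,dk$. For a function $U(x,y)$ let $U_T(x,y)=\int_{\mathbb{R}^2}U(x,z)\psi_T(y-z)\,dz$ be the convolution in the second variable. $\|\cdot\|_S$ denotes the supremum norm on $S$, and $\|\cdot\|$ the one on $\mathbb{R}^2$; $\partial_1,\partial_2$ act on the $y$-variable. Let $\lambda\in(0,1)$, $\kappa\in(1,2)$, and let $\mathsf{A}\subset[0,\kappa)$ be finite. There is a constant $C<\infty$ depending only on $\lambda$, $\kappa$ and $\mathsf{A}$ such that the following holds. Let $U$ be a bounded function of $(x,y)\in\mathbb{R}^2\times\mathbb{R}^2$ that for every $x$ is continuous and $[0,1)^2$-periodic in $y$. Assume that there are a function $a:\mathbb{R}^2\to[\lambda,\lambda^{-1}]$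 and a constant $\overline M\ge 0$ such that for all $x\in\mathbb{R}^2$, all $0<L\le1$ and all $T>0$ with $T^{1/4}\le1$ $$(T^{1/4})^2\inf_{c\in\mathbb{R}}\big\|(\partial_2-a(x)\partial_1^2)U_T(x,\cdot)-c\big\|_{B_L(x)}\le\overline M\sum_{\beta\in\mathsf{A}}(T^{1/4})^{\beta}L^{\kappa-\beta}.$$ Assume also that there are a continuous function $\gamma:\mathbb{R}^2\times\mathbb{R}^2\to\mathbb{R}$ and a constant $\overline{\overline M}\ge0$ such that for all $x,y,z\in\mathbb{R}^2$ $$\big|U(x,z)-U(x,y)-U(y,z)+U(y,y)-\gamma(x,y)(z-y)_1\big|\le\overline{\overline M}\sum_{\beta\in\mathsf{A}}d^{\beta}(y,x)\,d^{\kappa-\beta}(z,y)$$ (with $0^0=1$). Then there is a function $\nu:\mathbb{R}^2\to\mathbb{R}$ such that $$M_U:=\sup_{x\neq y}d^{-\kappa}(y,x)\big|U(x,y)-U(x,x)-\nu(x)(y-x)_1\big|\le C(\overline M+\overline{\overline M}),$$ $$\|\nu\|\le M_U\le C(\overline M+\overline{\overline M}),$$ $$\sup_{x\neq y}d^{-(\kappa-1)}(y,x)\big|\nu(y)-\nu(x)+\gamma(x,y)\big|\le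 C\,(M_U+\overline{\overline M}),$$ and the left-hand side of the last estimate is also at most $C(\overline M+\overline{\overline M})$. -/

import Mathlib

open MeasureTheory
open scoped ENNReal NNReal

namespace Parabolic

/-- The parabolic (Carnot-Carathéodory) metric on the plane,
`d(x,y) = |x₁ - y₁| + √|x₂ - y₂|`. -/
noncomputable def d (x y : ℝ × ℝ) : ℝ := |x.1 - y.1| + √|x.2 - y.2|

/-- The ball `B_L(x)` with respect to the metric `d`. -/
def ball (x : ℝ × ℝ) (L : ℝ) : Set (ℝ × ℝ) := {y | d y x < L}

/-- The convolution kernel `ψ_T` of the semigroup `exp(-T(∂₁⁴ - ∂₂²))`, that is, the inverse Fourier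
transform `(2π)⁻² ∫ exp(-T(k₁⁴ + k₂²)) exp(i k·x) dk` of `k ↦ exp(-T(k₁⁴ + k₂²))`; since that
function is even in `k`, only the cosine contributes. -/
noncomputable def psi (T : ℝ) (x : ℝ × ℝ) : ℝ :=
  (2 * Real.pi) ^ (-2 : ℤ) *
    ∫ k : ℝ × ℝ, Real.exp (-T * (k.1 ^ 4 + k.2 ^ 2)) * Real.cos (k.1 * x.1 + k.2 * x.2)

/-- The mollification `f_T = ψ_T * f`. -/
noncomputable def mollify (T : ℝ) (f : ℝ × ℝ → ℝ) (y : ℝ × ℝ) : ℝ :=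
  ∫ z : ℝ × ℝ, f z * psi T (y - z)

/-- The parabolic operator `∂₂ - a₀ ∂₁²` with constant coefficient `a₀`, through classical partial
derivatives (it is only applied to mollified functions, which are smooth). -/
noncomputable def heatOp (a₀ : ℝ) (f : ℝ × ℝ → ℝ) (y : ℝ × ℝ) : ℝ :=
  deriv (fun s : ℝ => f (y.1, s)) y.2 - a₀ * iteratedDeriv 2 (fun s : ℝ => f (s, y.2)) y.1

/-- The supremum norm `‖f‖_S` of `f` on the set `S`, with values in `[0,∞]`. -/
noncomputable def supNormOn (S : Set (ℝ × ℝ)) (f : ℝ × ℝ → ℝ) : ℝ≥0∞ :=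
  ⨆ y ∈ S, ENNReal.ofReal |f y|

/-- `f` is periodic with periodic cell `[0,1)²`. -/
def IsPeriodic (f : ℝ × ℝ → ℝ) : Prop :=
  ∀ y : ℝ × ℝ, f (y + (1, 0)) = f y ∧ f (y + (0, 1)) = f y

/-- `M_U = sup_{x ≠ y} d^{-κ}(y,x) |U(x,y) - U(x,x) - ν(x) (y-x)₁|`, with values in `[0,∞]`. -/
noncomputable def modelConst (κ : ℝ) (U : ℝ × ℝ → ℝ × ℝ → ℝ) (ν : ℝ × ℝ → ℝ) : ℝ≥0∞ :=
  ⨆ (x : ℝ × ℝ) (y : ℝ × ℝ) (_ : x ≠ y),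
    ENNReal.ofReal (d y x ^ (-κ) * |U x y - U x x - ν x * (y - x).1|)

/-- `sup_{x ≠ y} d^{-(κ-1)}(y,x) |ν(y) - ν(x) + γ(x,y)|`, with values in `[0,∞]`. -/
noncomputable def nuConst (κ : ℝ) (ν : ℝ × ℝ → ℝ) (γ : ℝ × ℝ → ℝ × ℝ → ℝ) : ℝ≥0∞ :=
  ⨆ (x : ℝ × ℝ) (y : ℝ × ℝ) (_ : x ≠ y),
    ENNReal.ofReal (d y x ^ (-(κ - 1)) * |ν y - ν x + γ x y|)

end Parabolic

/-!
The slope `ν` and the model bound come from estimates at a single base point `x`, for the one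
function `u = U x` and the one coefficient `a = a x`, which are then tied together by three-point
continuity.

*Single base point.* Mollify with the semigroup `exp(-t(a²∂₁⁴ - ∂₂²))` instead of the given one.
Its generator factorizes, `∂₂² - a²∂₁⁴ = (∂₂ + a∂₁²)(∂₂ - a∂₁²)`. Spending part of the smoothing
on the second factor, local splitting shows that `(∂₂ - a∂₁²)u_T` is a constant up to a small
error, and the first factor annihilates the constant (`exists_adapted_deriv_le`). Integrating in
`t` shows that derivatives of `u_T` of parabolic order at least two behave as for a function of
Hölder class `κ` at `x` (`exists_abs_moll_le`), that `u_T(x)` converges to `u(x)` at rate `κ`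
(`exists_abs_moll_sub_le`), and that `∂₁u_T(x)` converges, at rate `κ - 1`, to some `ν(x)` for
which `u_T` has the right Taylor expansion on the scale `T^{1/4}` (`exists_slope`). No a priori
regularity is needed; the only non-local input is a bound on the oscillation of `u`, which makes
kernel tails harmless.

*Model bound.* With `T^{1/4} = d(y,x)`, what is missing is `U(x,·)_T(y) - U(x,y)`, that is, the
mollification error of `U(x,·)` away from its base point. By three-point continuity it agrees with
that of `U(y,·)` at its own base point `y` up to an admissible error, as the linear term
integrates to zero against the even kernel (`exists_mollification_error_le`).

*Oscillation.* At a fixed scale, `w = U(x₀,·)_T` is such that `(∂₂ - a(x)∂₁²)w` is nearly constant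
on the unit ball around every `x` near `x₀`, with a coefficient that depends on `x` without any
regularity. A maximum principle for `w(y + he₁) - w(y)`, where both points see the same
coefficient, bounds the increments in the first variable (`fst_increment_le`), and averaging over
one period in that variable removes `a∂₁²w` and leaves an ordinary differential inequality in the
second (`abs_sub_le_of_heat_osc`). Since the mollification error is a small multiple of the
oscillation plus the data, absorption bounds the oscillation (`exists_osc_le`).

The remaining claims are evaluations at special points: a period in the first variable for `ν`,
and `z = y + (d(y,x), 0)` in three-point continuity for the increments of `ν`.
-/

namespace Parabolic

/-! ### One-dimensional kernels -/

/-- The oscillatory moment `∫ kⁿ exp(-s k^{2q}) cos(k x + φ) dk`. The free phase `φ` makes this family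
closed under differentiation and under integration by parts, so that no complex numbers are needed. -/
noncomputable def osc (q n : ℕ) (φ s x : ℝ) : ℝ :=
  ∫ k : ℝ, k ^ n * Real.exp (-s * k ^ (2 * q)) * Real.cos (k * x + φ)

/-- The `n`-th derivative of the inverse Fourier transform of `k ↦ exp(-s k^{2q})`. The cases in use
are `q = 2` for the first variable and `q = 1` (Gaussians) for the second. -/
noncomputable def ker (q n : ℕ) (s x : ℝ) : ℝ :=
  (2 * Real.pi)⁻¹ * osc q n (n * (Real.pi / 2)) s x

theorem integrable_pow_mul_exp {q : ℕ} (hq : 0 < q) (n : ℕ) {s : ℝ} (hs : 0 < s) :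
    Integrable fun k : ℝ => k ^ n * Real.exp (-s * k ^ (2 * q)) := by
  have h := (integrable_rpow_mul_exp_neg_mul_sq hs (s := n)
    (by have : (0 : ℝ) ≤ n := n.cast_nonneg
        linarith)).norm.const_mul (Real.exp s)
  refine h.mono' (by fun_prop) (Filter.Eventually.of_forall fun k => ?_)
  rw [Real.rpow_natCast, norm_mul, norm_mul, mul_left_comm]
  gcongr
  rw [Real.norm_eq_abs, Real.norm_eq_abs, Real.abs_exp, Real.abs_exp, ← Real.exp_add]
  refine Real.exp_le_exp.2 ?_
  have : k ^ 2 ≤ 1 + k ^ (2 * q) := by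
    rw [pow_mul]
    rcases le_total (k ^ 2) 1 with h1 | h1
    · have := pow_nonneg (sq_nonneg k) q
      linarith
    · have := le_self_pow₀ h1 hq.ne'
      linarith
  nlinarith

theorem integrable_osc {q : ℕ} (hq : 0 < q) (n : ℕ) {s : ℝ} (hs : 0 < s) (φ x : ℝ) :
    Integrable fun k : ℝ => k ^ n * Real.exp (-s * k ^ (2 * q)) * Real.cos (k * x + φ) := by
  refine (integrable_pow_mul_exp hq n hs).mul_bdd (c := 1) (by fun_prop)
    (Filter.Eventually.of_forall fun k => ?_)
  simpa using Real.abs_cos_le_one _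

/-- Differentiation in `x` raises the power of `k` and turns the phase by a right angle. -/
theorem hasDerivAt_osc {q : ℕ} (hq : 0 < q) (n : ℕ) {s : ℝ} (hs : 0 < s) (φ x : ℝ) :
    HasDerivAt (osc q n φ s) (osc q (n + 1) (φ + Real.pi / 2) s x) x := by
  refine (hasDerivAt_integral_of_dominated_loc_of_deriv_le (μ := volume) (s := Set.univ)
    (F := fun x k : ℝ => k ^ n * Real.exp (-s * k ^ (2 * q)) * Real.cos (k * x + φ))
    (F' := fun x k : ℝ =>
      k ^ (n + 1) * Real.exp (-s * k ^ (2 * q)) * Real.cos (k * x + (φ + Real.pi / 2)))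
    (bound := fun k => ‖k ^ (n + 1) * Real.exp (-s * k ^ (2 * q))‖)
    Filter.univ_mem (Filter.Eventually.of_forall fun y => by fun_prop)
    (integrable_osc hq n hs φ x) (by fun_prop)
    (Filter.Eventually.of_forall fun k y _ => ?_) (integrable_pow_mul_exp hq _ hs).norm
    (Filter.Eventually.of_forall fun k y _ => ?_)).2
  · rw [norm_mul]
    refine mul_le_of_le_one_right (norm_nonneg _) ?_
    simpa using Real.abs_cos_le_one _
  · have h1 : HasDerivAt (fun y : ℝ => k * y + φ) k y := by
      simpa using ((hasDerivAt_id y).const_mul k).add_const φ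
    refine (h1.cos.const_mul (k ^ n * Real.exp (-s * k ^ (2 * q)))).congr_deriv ?_
    rw [← add_assoc, Real.cos_add_pi_div_two]
    ring

/-- The heat-type equation in `s` satisfied by the oscillatory moments. -/
theorem hasDerivAt_osc_time {q : ℕ} (hq : 0 < q) (n : ℕ) {s : ℝ} (hs : 0 < s) (φ x : ℝ) :
    HasDerivAt (fun s => osc q n φ s x) (-osc q (n + 2 * q) φ s x) s := by
  have h := (hasDerivAt_integral_of_dominated_loc_of_deriv_le (μ := volume) (s := Set.Ioi (s / 2))
    (F := fun s k : ℝ => k ^ n * Real.exp (-s * k ^ (2 * q)) * Real.cos (k * x + φ))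
    (F' := fun s k : ℝ =>
      -(k ^ (n + 2 * q) * Real.exp (-s * k ^ (2 * q)) * Real.cos (k * x + φ)))
    (bound := fun k => ‖k ^ (n + 2 * q) * Real.exp (-(s / 2) * k ^ (2 * q))‖) (x₀ := s)
    (Ioi_mem_nhds (by linarith)) (Filter.Eventually.of_forall fun y => by fun_prop)
    (integrable_osc hq n hs φ x) (by fun_prop)
    (Filter.Eventually.of_forall fun k y hy => ?_)
    (integrable_pow_mul_exp hq _ (half_pos hs)).norm
    (Filter.Eventually.of_forall fun k y _ => ?_)).2
  · rwa [integral_neg] at h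
  · rw [norm_neg, norm_mul, norm_mul, norm_mul]
    refine (mul_le_of_le_one_right (by positivity) ?_).trans ?_
    · simpa using Real.abs_cos_le_one _
    · gcongr
      rw [Real.norm_eq_abs, Real.norm_eq_abs, Real.abs_exp, Real.abs_exp]
      refine Real.exp_le_exp.2 ?_
      have : 0 ≤ k ^ (2 * q) := by rw [pow_mul]; positivity
      have hy' : s / 2 < y := hy
      nlinarith
  · have h1 : HasDerivAt (fun y : ℝ => -y * k ^ (2 * q)) (-k ^ (2 * q)) y := by
      simpa using ((hasDerivAt_id y).neg.mul_const (k ^ (2 * q)))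
    refine ((h1.exp.const_mul (k ^ n)).mul_const (Real.cos (k * x + φ))).congr_deriv ?_
    ring

/-- Integration by parts in the frequency variable. -/
theorem mul_osc {q : ℕ} (hq : 0 < q) (n : ℕ) {s : ℝ} (hs : 0 < s) (φ x : ℝ) :
    x * osc q n φ s x = 2 * q * s * osc q (n + 2 * q - 1) (φ - Real.pi / 2) s x
      - n * osc q (n - 1) (φ - Real.pi / 2) s x := by
  have hd : ∀ k : ℝ, HasDerivAt
      (fun k : ℝ => k ^ n * Real.exp (-s * k ^ (2 * q)) * Real.sin (k * x + φ))
      (x * (k ^ n * Real.exp (-s * k ^ (2 * q)) * Real.cos (k * x + φ))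
        - 2 * q * s * (k ^ (n + 2 * q - 1) * Real.exp (-s * k ^ (2 * q))
            * Real.cos (k * x + (φ - Real.pi / 2)))
        + n * (k ^ (n - 1) * Real.exp (-s * k ^ (2 * q))
            * Real.cos (k * x + (φ - Real.pi / 2)))) k := by
    intro k
    have h1 : HasDerivAt (fun y : ℝ => y * x + φ) x k := by
      simpa using ((hasDerivAt_id k).mul_const x).add_const φ
    have h2 := ((hasDerivAt_pow (2 * q) k).const_mul (-s)).exp
    refine (((hasDerivAt_pow n k).mul h2).mul h1.sin).congr_deriv ?_
    have h3 : n + 2 * q - 1 = n + (2 * q - 1) := by omega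
    rw [← add_sub_assoc, Real.cos_sub_pi_div_two, h3, pow_add]
    push_cast
    simp only [Pi.mul_apply]
    ring
  have i1 := (integrable_osc hq n hs φ x).const_mul x
  have i2 := (integrable_osc hq (n + 2 * q - 1) hs (φ - Real.pi / 2) x).const_mul (2 * q * s)
  have i3 := (integrable_osc hq (n - 1) hs (φ - Real.pi / 2) x).const_mul (n : ℝ)
  have i0 : Integrable fun k : ℝ => k ^ n * Real.exp (-s * k ^ (2 * q)) * Real.sin (k * x + φ) := by
    refine (integrable_osc hq n hs (φ - Real.pi / 2) x).congr
      (Filter.Eventually.of_forall fun k => ?_)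
    simp only [← add_sub_assoc, Real.cos_sub_pi_div_two]
  have h := integral_eq_zero_of_hasDerivAt_of_integrable hd ((i1.sub i2).add i3) i0
  have e1 := integral_add (i1.sub i2) i3
  simp only [Pi.sub_apply] at e1
  rw [e1, integral_sub i1 i2, integral_const_mul, integral_const_mul,
    integral_const_mul] at h
  unfold osc
  linarith

theorem abs_osc_le {q : ℕ} (hq : 0 < q) (n : ℕ) {s₀ s : ℝ} (hs₀ : 0 < s₀) (hs : s₀ ≤ s) (φ x : ℝ) :
    |osc q n φ s x| ≤ ∫ k : ℝ, |k ^ n * Real.exp (-s₀ * k ^ (2 * q))| := by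
  rw [← Real.norm_eq_abs, osc]
  refine norm_integral_le_of_norm_le (integrable_pow_mul_exp hq n hs₀).norm
    (Filter.Eventually.of_forall fun k => ?_)
  rw [← Real.norm_eq_abs, norm_mul, norm_mul, norm_mul]
  refine (mul_le_of_le_one_right (by positivity) ?_).trans ?_
  · simpa using Real.abs_cos_le_one _
  · gcongr
    rw [Real.norm_eq_abs, Real.norm_eq_abs, Real.abs_exp, Real.abs_exp]
    refine Real.exp_le_exp.2 ?_
    have : 0 ≤ k ^ (2 * q) := by rw [pow_mul]; positivity
    nlinarith

/-- Decay of the oscillatory moments to any polynomial order, by repeated integration by parts. -/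
theorem exists_pow_mul_osc_le {q : ℕ} (hq : 0 < q) {s₀ s₁ : ℝ} (hs₀ : 0 < s₀) (j : ℕ) :
    ∀ n : ℕ, ∃ C : ℝ, 0 ≤ C ∧ ∀ φ x s : ℝ, s₀ ≤ s → s ≤ s₁ → |x| ^ j * |osc q n φ s x| ≤ C := by
  induction j with
  | zero =>
    intro n
    refine ⟨∫ k : ℝ, |k ^ n * Real.exp (-s₀ * k ^ (2 * q))|, integral_nonneg fun _ => abs_nonneg _,
      fun φ x s h0 _ => ?_⟩
    simpa using abs_osc_le hq n hs₀ h0 φ x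
  | succ j ih =>
    intro n
    obtain ⟨C₁, hC₁, h₁⟩ := ih (n + 2 * q - 1)
    obtain ⟨C₂, hC₂, h₂⟩ := ih (n - 1)
    refine ⟨2 * q * |s₁| * C₁ + n * C₂, by positivity, fun φ x s h0 h1 => ?_⟩
    have hs : 0 < s := hs₀.trans_le h0
    have e : |x| ^ (j + 1) * |osc q n φ s x| = |x| ^ j * |x * osc q n φ s x| := by
      rw [abs_mul]; ring
    rw [e, mul_osc hq n hs]
    have hh := h₁ (φ - Real.pi / 2) x s h0 h1
    have hh2 := h₂ (φ - Real.pi / 2) x s h0 h1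
    calc |x| ^ j * |2 * q * s * osc q (n + 2 * q - 1) (φ - Real.pi / 2) s x
            - n * osc q (n - 1) (φ - Real.pi / 2) s x|
        ≤ |x| ^ j * (2 * q * s * |osc q (n + 2 * q - 1) (φ - Real.pi / 2) s x|
            + n * |osc q (n - 1) (φ - Real.pi / 2) s x|) := by
          gcongr
          refine (abs_sub _ _).trans ?_
          rw [abs_mul (2 * q * s), abs_mul (n : ℝ),
            abs_of_nonneg (by positivity : (0 : ℝ) ≤ 2 * q * s), Nat.abs_cast]
      _ = 2 * q * s * (|x| ^ j * |osc q (n + 2 * q - 1) (φ - Real.pi / 2) s x|)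
            + n * (|x| ^ j * |osc q (n - 1) (φ - Real.pi / 2) s x|) := by ring
      _ ≤ 2 * q * |s₁| * C₁ + n * C₂ := by
          have : s ≤ |s₁| := h1.trans (le_abs_self _)
          gcongr

/-- Scaling, for the exponent `r^{2q}` of the parameter belonging to a dilation by `r`. -/
theorem osc_scale (q n : ℕ) {r : ℝ} (hr : 0 < r) (φ s x : ℝ) :
    osc q n φ (r ^ (2 * q) * s) (r * x) = (r ^ (n + 1))⁻¹ * osc q n φ s x := by
  unfold osc
  have h := Measure.integral_comp_mul_left
    (fun k : ℝ => k ^ n * Real.exp (-s * k ^ (2 * q)) * Real.cos (k * x + φ)) r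
  have e : ∀ k : ℝ, k ^ n * Real.exp (-(r ^ (2 * q) * s) * k ^ (2 * q)) * Real.cos (k * (r * x) + φ)
      = (r ^ n)⁻¹ * ((r * k) ^ n * Real.exp (-s * (r * k) ^ (2 * q))
        * Real.cos ((r * k) * x + φ)) := by
    intro k
    have h1 : -(r ^ (2 * q) * s) * k ^ (2 * q) = -s * (r * k) ^ (2 * q) := by rw [mul_pow]; ring
    have h2 : k * (r * x) = (r * k) * x := by ring
    rw [h1, h2, mul_pow r k n]
    field_simp
  simp_rw [e]
  rw [integral_const_mul, h, abs_of_pos (inv_pos.2 hr), smul_eq_mul, ← mul_assoc, pow_succ, mul_inv]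

theorem ker_scale (q n : ℕ) {r : ℝ} (hr : 0 < r) (s x : ℝ) :
    ker q n (r ^ (2 * q) * s) (r * x) = (r ^ (n + 1))⁻¹ * ker q n s x := by
  unfold ker
  rw [osc_scale q n hr]
  ring

theorem hasDerivAt_ker {q : ℕ} (hq : 0 < q) (n : ℕ) {s : ℝ} (hs : 0 < s) (x : ℝ) :
    HasDerivAt (ker q n s) (ker q (n + 1) s x) x := by
  refine ((hasDerivAt_osc hq n hs _ x).const_mul _).congr_deriv ?_
  unfold ker
  congr 2
  push_cast
  ring

/-- `∂ₛ ker = (-1)^(q+1) ∂ₓ^(2q) ker`; the sign is what makes the mollification flow the one of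
`∂ₛ + ∂₁⁴ - ∂₂²`. -/
theorem hasDerivAt_ker_time {q : ℕ} (hq : 0 < q) (n : ℕ) {s : ℝ} (hs : 0 < s) (x : ℝ) :
    HasDerivAt (fun s => ker q n s x) ((-1) ^ (q + 1) * ker q (n + 2 * q) s x) s := by
  refine ((hasDerivAt_osc_time hq n hs _ x).const_mul _).congr_deriv ?_
  unfold ker
  have h : osc q (n + 2 * q) (((n + 2 * q : ℕ) : ℝ) * (Real.pi / 2)) s x
      = (-1) ^ q * osc q (n + 2 * q) (n * (Real.pi / 2)) s x := by
    unfold osc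
    rw [← integral_const_mul]
    congr 1 with k
    have : k * x + ((n + 2 * q : ℕ) : ℝ) * (Real.pi / 2)
        = (k * x + n * (Real.pi / 2)) + q * Real.pi := by push_cast; ring
    rw [this, Real.cos_add_nat_mul_pi]
    ring
  rw [h, pow_succ]
  have : ((-1 : ℝ) ^ q) * (-1) ^ q = 1 := by rw [← mul_pow]; simp
  linear_combination (2 * Real.pi)⁻¹ * osc q (n + 2 * q) (n * (Real.pi / 2)) s x * this

theorem continuous_ker {q : ℕ} (hq : 0 < q) (n : ℕ) {s : ℝ} (hs : 0 < s) : Continuous (ker q n s) :=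
  continuous_iff_continuousAt.2 fun x => (hasDerivAt_ker hq n hs x).continuousAt

/-- Decay of the kernels, uniform for parameters in a compact interval and for unit shifts. -/
theorem exists_ker_le {q : ℕ} (hq : 0 < q) (n : ℕ) {s₀ s₁ : ℝ} (hs₀ : 0 < s₀) :
    ∃ C : ℝ, 0 ≤ C ∧ ∀ s, s₀ ≤ s → s ≤ s₁ → ∀ x h : ℝ, |h| ≤ 1 →
      |ker q n s (x + h)| ≤ C * (1 + x ^ 4)⁻¹ := by
  obtain ⟨C₀, hC₀, h₀⟩ := exists_pow_mul_osc_le hq (s₁ := s₁) hs₀ 0 n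
  obtain ⟨C₄, hC₄, h₄⟩ := exists_pow_mul_osc_le hq (s₁ := s₁) hs₀ 4 n
  refine ⟨9 * ((2 * Real.pi)⁻¹ * (C₀ + C₄)), by positivity, fun s h0 h1 x h hh => ?_⟩
  have e0 := h₀ (n * (Real.pi / 2)) (x + h) s h0 h1
  have e4 := h₄ (n * (Real.pi / 2)) (x + h) s h0 h1
  rw [← div_eq_mul_inv, le_div_iff₀ (by positivity)]
  have hw : 1 + x ^ 4 ≤ 9 * (1 + |x + h| ^ 4) := by
    have e : |x + h| ^ 4 = (x + h) ^ 4 := by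
      rw [show (4 : ℕ) = 2 * 2 from rfl, pow_mul, sq_abs, ← pow_mul]
    rw [e]
    have hh2 : h ^ 2 ≤ 1 := by rw [← sq_abs]; nlinarith [abs_nonneg h]
    have h2 : x ^ 2 ≤ 2 * (x + h) ^ 2 + 2 * h ^ 2 := by nlinarith [sq_nonneg (x + 2 * h)]
    have h3 : (x ^ 2) ^ 2 ≤ (2 * (x + h) ^ 2 + 2) ^ 2 := by
      gcongr
      linarith
    nlinarith [sq_nonneg ((x + h) ^ 2 - 1)]
  have hk : |ker q n s (x + h)| = (2 * Real.pi)⁻¹ * |osc q n (n * (Real.pi / 2)) s (x + h)| := by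
    unfold ker
    rw [abs_mul, abs_of_nonneg (by positivity : (0 : ℝ) ≤ (2 * Real.pi)⁻¹)]
  rw [hk]
  calc (2 * Real.pi)⁻¹ * |osc q n (n * (Real.pi / 2)) s (x + h)| * (1 + x ^ 4)
      ≤ (2 * Real.pi)⁻¹ * |osc q n (n * (Real.pi / 2)) s (x + h)| * (9 * (1 + |x + h| ^ 4)) := by
        gcongr
    _ = 9 * ((2 * Real.pi)⁻¹ * (|x + h| ^ 0 * |osc q n (n * (Real.pi / 2)) s (x + h)|
          + |x + h| ^ 4 * |osc q n (n * (Real.pi / 2)) s (x + h)|)) := by ring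
    _ ≤ 9 * ((2 * Real.pi)⁻¹ * (C₀ + C₄)) := by gcongr

theorem integrable_weight : Integrable fun x : ℝ => (1 + x ^ 2) * (1 + x ^ 4)⁻¹ := by
  refine (integrable_inv_one_add_sq.const_mul 2).mono' (Continuous.aestronglyMeasurable ?_)
    (Filter.Eventually.of_forall fun x => ?_)
  · refine (by fun_prop : Continuous fun x : ℝ => 1 + x ^ 2).mul
      (Continuous.inv₀ (by fun_prop) fun x => by positivity)
  · rw [Real.norm_eq_abs, abs_of_nonneg (by positivity), ← div_eq_mul_inv, ← div_eq_mul_inv,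
      div_le_div_iff₀ (by positivity) (by positivity)]
    nlinarith [sq_nonneg (x ^ 2 - 1)]

theorem integrable_one_add_pow_four_inv : Integrable fun x : ℝ => (1 + x ^ 4)⁻¹ := by
  refine integrable_weight.mono' (Continuous.aestronglyMeasurable
    (Continuous.inv₀ (by fun_prop) fun x => by positivity)) (Filter.Eventually.of_forall fun x => ?_)
  rw [Real.norm_eq_abs, abs_of_nonneg (by positivity)]
  exact le_mul_of_one_le_left (by positivity) (by nlinarith [sq_nonneg x])

theorem integrable_ker_weight {q : ℕ} (hq : 0 < q) (n : ℕ) {s : ℝ} (hs : 0 < s) (r : ℝ) :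
    Integrable fun x => |ker q n s x| * (1 + (x / r) ^ 2) := by
  obtain ⟨C, hC, h⟩ := exists_ker_le hq n (s₁ := s) hs
  refine (integrable_weight.const_mul (C * (1 + (r⁻¹) ^ 2))).mono' ?_
    (Filter.Eventually.of_forall fun x => ?_)
  · have := continuous_ker hq n hs
    exact Continuous.aestronglyMeasurable (by fun_prop)
  · have h1 := h s le_rfl le_rfl x 0 (by simp)
    rw [add_zero] at h1
    rw [Real.norm_eq_abs, abs_of_nonneg (by positivity)]
    calc |ker q n s x| * (1 + (x / r) ^ 2)
        ≤ (C * (1 + x ^ 4)⁻¹) * ((1 + (r⁻¹) ^ 2) * (1 + x ^ 2)) := by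
          gcongr
          rw [div_eq_mul_inv]
          nlinarith [sq_nonneg x, sq_nonneg r⁻¹]
      _ = _ := by ring

theorem integrable_ker {q : ℕ} (hq : 0 < q) (n : ℕ) {s : ℝ} (hs : 0 < s) :
    Integrable (ker q n s) := by
  refine (integrable_ker_weight hq n hs 1).mono' (continuous_ker hq n hs).aestronglyMeasurable
    (Filter.Eventually.of_forall fun x => ?_)
  exact le_mul_of_one_le_right (abs_nonneg _) (by nlinarith [sq_nonneg (x / 1)])

/-- Weighted `L¹` bound for the kernels at parabolic scale `r`. -/
theorem exists_integral_ker_le {q : ℕ} (hq : 0 < q) (n : ℕ) {c₁ c₂ : ℝ} (hc₁ : 0 < c₁) :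
    ∃ C : ℝ, 0 ≤ C ∧ ∀ r s : ℝ, 0 < r → c₁ * r ^ (2 * q) ≤ s → s ≤ c₂ * r ^ (2 * q) →
      ∫ x, |ker q n s x| * (1 + (x / r) ^ 2) ≤ C * (r ^ n)⁻¹ := by
  obtain ⟨C, hC, h⟩ := exists_ker_le hq n (s₁ := c₂) hc₁
  refine ⟨∫ x : ℝ, C * ((1 + x ^ 2) * (1 + x ^ 4)⁻¹),
    integral_nonneg fun x => by positivity, fun r s hr h1 h2 => ?_⟩
  have hrp : 0 < r ^ (2 * q) := by positivity
  have hsub := Measure.integral_comp_mul_left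
    (fun x : ℝ => |ker q n s x| * (1 + (x / r) ^ 2)) r
  have hs : s = r ^ (2 * q) * (s / r ^ (2 * q)) := by field_simp
  have hlo : c₁ ≤ s / r ^ (2 * q) := by rwa [le_div_iff₀ hrp]
  have hhi : s / r ^ (2 * q) ≤ c₂ := by rwa [div_le_iff₀ hrp]
  have hpt : ∀ x : ℝ, |ker q n s (r * x)| * (1 + (r * x / r) ^ 2)
      = (r ^ (n + 1))⁻¹ * (|ker q n (s / r ^ (2 * q)) x| * (1 + (x / 1) ^ 2)) := by
    intro x
    conv_lhs => rw [hs]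
    rw [ker_scale q n hr, abs_mul, abs_of_nonneg (by positivity : 0 ≤ (r ^ (n + 1))⁻¹),
      mul_div_cancel_left₀ _ hr.ne', div_one, mul_assoc]
  simp_rw [hpt] at hsub
  rw [integral_const_mul, abs_of_pos (inv_pos.2 hr), smul_eq_mul] at hsub
  have h3 : ∫ x, |ker q n s x| * (1 + (x / r) ^ 2)
      = (r ^ n)⁻¹ * ∫ x, |ker q n (s / r ^ (2 * q)) x| * (1 + (x / 1) ^ 2) := by
    rw [pow_succ] at hsub
    field_simp at hsub ⊢
    linarith
  rw [h3, mul_comm]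
  refine mul_le_mul_of_nonneg_right ?_ (by positivity)
  refine integral_mono (integrable_ker_weight hq n (hc₁.trans_le hlo) 1)
    (integrable_weight.const_mul C) fun x => ?_
  have := h _ hlo hhi x 0 (by simp)
  rw [add_zero] at this
  calc |ker q n (s / r ^ (2 * q)) x| * (1 + (x / 1) ^ 2)
      ≤ (C * (1 + x ^ 4)⁻¹) * (1 + x ^ 2) := by rw [div_one]; gcongr
    _ = _ := by ring

/-! ### Fourier inversion and the semigroup property -/

theorem osc_sin_eq_zero (q : ℕ) (s x : ℝ) :
    ∫ k : ℝ, Real.exp (-s * k ^ (2 * q)) * Real.sin (k * x) = 0 := by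
  have h := integral_neg_eq_self (fun k : ℝ => Real.exp (-s * k ^ (2 * q)) * Real.sin (k * x)) volume
  simp only [even_two.mul_right q |>.neg_pow, neg_mul, Real.sin_neg, mul_neg, integral_neg] at h
  simp only [neg_mul]
  linarith

open FourierTransform in
theorem fourier_exp {q : ℕ} (hq : 0 < q) {s : ℝ} (hs : 0 < s) (w : ℝ) :
    𝓕 (fun k : ℝ => ((Real.exp (-s * k ^ (2 * q)) : ℝ) : ℂ)) w
      = ((osc q 0 0 s (2 * Real.pi * w) : ℝ) : ℂ) := by
  rw [Real.fourier_real_eq_integral_exp_smul]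
  have e : ∀ v : ℝ, Complex.exp (↑(-2 * Real.pi * v * w) * Complex.I)
        • ((Real.exp (-s * v ^ (2 * q)) : ℝ) : ℂ)
      = ((v ^ 0 * Real.exp (-s * v ^ (2 * q)) * Real.cos (v * (2 * Real.pi * w) + 0) : ℝ) : ℂ)
        - Complex.I * ((Real.exp (-s * v ^ (2 * q)) * Real.sin (v * (2 * Real.pi * w)) : ℝ) : ℂ) := by
    intro v
    rw [Complex.exp_mul_I, ← Complex.ofReal_cos, ← Complex.ofReal_sin, smul_eq_mul,
      show -2 * Real.pi * v * w = -(v * (2 * Real.pi * w)) by ring, Real.cos_neg, Real.sin_neg]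
    push_cast
    simp only [pow_zero, add_zero]
    ring
  simp_rw [e]
  have i1 := (integrable_osc hq 0 hs 0 (2 * Real.pi * w)).ofReal (𝕜 := ℂ)
  have i2 : Integrable fun v : ℝ => Real.exp (-s * v ^ (2 * q)) * Real.sin (v * (2 * Real.pi * w)) := by
    refine (integrable_osc hq 0 hs (-(Real.pi / 2)) (2 * Real.pi * w)).congr
      (Filter.Eventually.of_forall fun k => ?_)
    simp only [← sub_eq_add_neg, Real.cos_sub_pi_div_two, pow_zero, one_mul]
  have i3 := (i2.ofReal (𝕜 := ℂ)).const_mul Complex.I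
  have h := integral_sub i1 i3
  refine h.trans ?_
  rw [integral_const_mul]
  have h1 := integral_ofReal (𝕜 := ℂ) (μ := volume) (f := fun v : ℝ => v ^ 0 * Real.exp (-s * v ^ (2 * q))
    * Real.cos (v * (2 * Real.pi * w) + 0))
  have h2 := integral_ofReal (𝕜 := ℂ) (μ := volume) (f := fun v : ℝ => Real.exp (-s * v ^ (2 * q))
    * Real.sin (v * (2 * Real.pi * w)))
  rw [osc_sin_eq_zero] at h2
  refine (congrArg₂ (fun a b => a - Complex.I * b) h1 h2).trans ?_
  simp [osc]

open FourierTransform in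
/-- Fourier inversion, in the normalization of `ker`. -/
theorem integral_exp_mul_ker {q : ℕ} (hq : 0 < q) {s : ℝ} (hs : 0 < s) (k : ℝ) :
    ∫ z : ℝ, Complex.exp (↑(k * z) * Complex.I) * ((ker q 0 s z : ℝ) : ℂ)
      = ((Real.exp (-s * k ^ (2 * q)) : ℝ) : ℂ) := by
  set f : ℝ → ℂ := fun k => ((Real.exp (-s * k ^ (2 * q)) : ℝ) : ℂ) with hf
  have hpi : (2 * Real.pi) ≠ 0 := by positivity
  have hker : ∀ z, ker q 0 s z = (2 * Real.pi)⁻¹ * osc q 0 0 s z := fun z => by simp [ker]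
  have hc : Continuous f := by fun_prop
  have hi : Integrable f := by
    have := (integrable_pow_mul_exp hq 0 hs).ofReal (𝕜 := ℂ)
    simpa only [pow_zero, one_mul] using! this
  have hF : 𝓕 f = fun w => ((osc q 0 0 s (2 * Real.pi * w) : ℝ) : ℂ) :=
    funext fun w => fourier_exp hq hs w
  have hFi : Integrable (𝓕 f) := by
    rw [hF]
    refine Integrable.ofReal ?_
    refine Integrable.comp_mul_left' (R := 2 * Real.pi) (g := osc q 0 0 s) ?_ hpi
    refine ((integrable_ker hq 0 hs).const_mul (2 * Real.pi)).congr
      (Filter.Eventually.of_forall fun z => ?_)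
    simp only [hker]
    field_simp
  have h := congrFun (hc.fourierInv_fourier_eq hi hFi) k
  rw [Real.fourierInv_eq', hF] at h
  refine Eq.trans ?_ h
  have hsub := Measure.integral_comp_mul_left
    (fun z : ℝ => Complex.exp (↑(k * z) * Complex.I) * ((osc q 0 0 s z : ℝ) : ℂ)) (2 * Real.pi)
  rw [abs_of_pos (by positivity)] at hsub
  have e1 : ∀ z : ℝ, Complex.exp (↑(k * z) * Complex.I) * ((ker q 0 s z : ℝ) : ℂ)
      = (((2 * Real.pi)⁻¹ : ℝ) : ℂ)
        * (Complex.exp (↑(k * z) * Complex.I) * ((osc q 0 0 s z : ℝ) : ℂ)) := by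
    intro z
    rw [hker]
    push_cast
    ring
  simp_rw [e1]
  rw [integral_const_mul]
  rw [Complex.real_smul] at hsub
  rw [← hsub]
  congr 1 with v
  simp only [smul_eq_mul]
  congr 4
  simp
  ring

theorem integrable_cos_mul_ker {q : ℕ} (hq : 0 < q) (m : ℕ) {s : ℝ} (hs : 0 < s) (θ k : ℝ) :
    Integrable fun z => Real.cos (θ - k * z) * ker q m s z := by
  refine (integrable_ker hq m hs).bdd_mul (c := 1) (by fun_prop)
    (Filter.Eventually.of_forall fun z => ?_)
  simpa using Real.abs_cos_le_one _

/-- The Fourier transform of `ker q m s`, in real form; derivatives are integrated by parts. -/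
theorem integral_cos_mul_ker {q : ℕ} (hq : 0 < q) (m : ℕ) {s : ℝ} (hs : 0 < s) (θ k : ℝ) :
    ∫ z, Real.cos (θ - k * z) * ker q m s z
      = k ^ m * Real.exp (-s * k ^ (2 * q)) * Real.cos (θ + m * (Real.pi / 2)) := by
  induction m generalizing θ with
  | zero =>
    have h := integral_exp_mul_ker hq hs k
    have i : Integrable fun z : ℝ => Complex.exp (↑(k * z) * Complex.I) * ((ker q 0 s z : ℝ) : ℂ) := by
      refine (integrable_ker hq 0 hs).ofReal.bdd_mul (c := 1) (by fun_prop)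
        (Filter.Eventually.of_forall fun z => ?_)
      rw [Complex.norm_exp_ofReal_mul_I]
    have h2 : ∫ z : ℝ, (Complex.exp (↑(θ - k * z) * Complex.I) * ((ker q 0 s z : ℝ) : ℂ)).re
        = Real.exp (-s * k ^ (2 * q)) * Real.cos θ := by
      have hconj := integral_conj (μ := volume)
        (f := fun z : ℝ => Complex.exp (↑(k * z) * Complex.I) * ((ker q 0 s z : ℝ) : ℂ))
      rw [h, Complex.conj_ofReal] at hconj
      have e : ∀ z : ℝ, Complex.exp (↑(θ - k * z) * Complex.I) * ((ker q 0 s z : ℝ) : ℂ)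
          = Complex.exp (θ * Complex.I) * (starRingEnd ℂ) (Complex.exp (↑(k * z) * Complex.I)
            * ((ker q 0 s z : ℝ) : ℂ)) := by
        intro z
        rw [map_mul, Complex.conj_ofReal, ← Complex.exp_conj, ← mul_assoc, ← Complex.exp_add]
        congr 2
        simp only [map_mul, Complex.conj_ofReal, Complex.conj_I]
        push_cast
        ring
      have i' : Integrable fun z : ℝ => Complex.exp (↑(θ - k * z) * Complex.I)
          * ((ker q 0 s z : ℝ) : ℂ) := by
        refine (integrable_ker hq 0 hs).ofReal.bdd_mul (c := 1) (by fun_prop)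
          (Filter.Eventually.of_forall fun z => ?_)
        rw [Complex.norm_exp_ofReal_mul_I]
      have h3 := integral_re i'
      simp only [RCLike.re_eq_complex_re] at h3
      rw [h3]
      simp_rw [e]
      rw [integral_const_mul, hconj, Complex.re_mul_ofReal, Complex.exp_ofReal_mul_I_re]
      ring
    simp only [Complex.re_mul_ofReal, Complex.exp_ofReal_mul_I_re] at h2
    simpa using h2
  | succ m ih =>
    have hd : ∀ z : ℝ, HasDerivAt (fun z => Real.cos (θ - k * z) * ker q m s z)
        (Real.cos (θ - k * z) * ker q (m + 1) s z
          - k * (Real.cos (θ + Real.pi / 2 - k * z) * ker q m s z)) z := by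
      intro z
      have h1 : HasDerivAt (fun z : ℝ => θ - k * z) (-k) z := by
        simpa using ((hasDerivAt_id z).const_mul k).const_sub θ
      refine (h1.cos.mul (hasDerivAt_ker hq m hs z)).congr_deriv ?_
      rw [show θ + Real.pi / 2 - k * z = (θ - k * z) + Real.pi / 2 by ring,
        Real.cos_add_pi_div_two]
      ring
    have i1 := integrable_cos_mul_ker hq (m + 1) hs θ k
    have i2 := (integrable_cos_mul_ker hq m hs (θ + Real.pi / 2) k).const_mul k
    have h := integral_eq_zero_of_hasDerivAt_of_integrable hd (i1.sub i2)
      (integrable_cos_mul_ker hq m hs θ k)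
    rw [integral_sub i1 i2, integral_const_mul, ih] at h
    rw [sub_eq_zero.1 h, pow_succ]
    have : θ + Real.pi / 2 + m * (Real.pi / 2) = θ + ((m + 1 : ℕ) : ℝ) * (Real.pi / 2) := by
      push_cast; ring
    rw [this]
    ring

theorem integral_ker_zero {q : ℕ} (hq : 0 < q) {s : ℝ} (hs : 0 < s) : ∫ z, ker q 0 s z = 1 := by
  simpa [hq.ne'] using integral_cos_mul_ker hq 0 hs 0 0

theorem integral_ker_succ {q : ℕ} (hq : 0 < q) (m : ℕ) {s : ℝ} (hs : 0 < s) :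
    ∫ z, ker q (m + 1) s z = 0 := by
  simpa using integral_cos_mul_ker hq (m + 1) hs 0 0

theorem ker_zero_neg (q : ℕ) (s x : ℝ) : ker q 0 s (-x) = ker q 0 s x := by
  simp [ker, osc]

/-- The convolution semigroup property, including derivatives. -/
theorem integral_ker_mul_ker {q : ℕ} (hq : 0 < q) (n m : ℕ) {s t : ℝ} (hs : 0 < s) (ht : 0 < t)
    (x : ℝ) : ∫ z, ker q n s (x - z) * ker q m t z = ker q (n + m) (s + t) x := by
  have hint : Integrable (Function.uncurry fun z k : ℝ =>
      (k ^ n * Real.exp (-s * k ^ (2 * q)) * Real.cos (k * (x - z) + n * (Real.pi / 2)))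
        * ker q m t z) (volume.prod volume) := by
    have i := (integrable_ker hq m ht).mul_prod (integrable_pow_mul_exp hq n hs)
    refine (i.bdd_mul (c := 1) (f := fun p : ℝ × ℝ =>
      Real.cos (p.2 * (x - p.1) + n * (Real.pi / 2))) (by fun_prop)
      (Filter.Eventually.of_forall fun z => ?_)).congr (Filter.Eventually.of_forall fun p => ?_)
    · simpa using Real.abs_cos_le_one _
    · simp only [Function.uncurry]
      ring
  have hsw := integral_integral_swap hint
  have e1 : ∀ z : ℝ, ∫ k : ℝ,
      (k ^ n * Real.exp (-s * k ^ (2 * q)) * Real.cos (k * (x - z) + n * (Real.pi / 2)))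
        * ker q m t z = osc q n (n * (Real.pi / 2)) s (x - z) * ker q m t z := fun z => by
    rw [integral_mul_const, osc]
  have e2 : ∀ k : ℝ, ∫ z : ℝ,
      (k ^ n * Real.exp (-s * k ^ (2 * q)) * Real.cos (k * (x - z) + n * (Real.pi / 2)))
        * ker q m t z = k ^ (n + m) * Real.exp (-(s + t) * k ^ (2 * q))
          * Real.cos (k * x + ((n + m : ℕ) : ℝ) * (Real.pi / 2)) := fun k => by
    have h := integral_cos_mul_ker hq m ht (k * x + n * (Real.pi / 2)) k
    have e : ∀ z : ℝ, (k ^ n * Real.exp (-s * k ^ (2 * q))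
        * Real.cos (k * (x - z) + n * (Real.pi / 2))) * ker q m t z
        = (k ^ n * Real.exp (-s * k ^ (2 * q)))
          * (Real.cos (k * x + n * (Real.pi / 2) - k * z) * ker q m t z) := fun z => by
      rw [show k * (x - z) + n * (Real.pi / 2) = k * x + n * (Real.pi / 2) - k * z by ring]
      ring
    simp_rw [e]
    rw [integral_const_mul, h, show -(s + t) * k ^ (2 * q) = -s * k ^ (2 * q) + -t * k ^ (2 * q) by
      ring, Real.exp_add, show k * x + n * (Real.pi / 2) + m * (Real.pi / 2)
        = k * x + ((n + m : ℕ) : ℝ) * (Real.pi / 2) by push_cast; ring]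
    ring
  simp_rw [e1, e2] at hsw
  have e3 : ∀ z : ℝ, ker q n s (x - z) * ker q m t z = (2 * Real.pi)⁻¹
      * (osc q n (n * (Real.pi / 2)) s (x - z) * ker q m t z) := fun z => by
    rw [ker, mul_assoc]
  simp_rw [e3]
  rw [integral_const_mul, hsw, ker, osc]

/-! ### The parabolic distance -/

theorem d_comm (x y : ℝ × ℝ) : d x y = d y x := by
  simp only [d, abs_sub_comm]

theorem d_nonneg (x y : ℝ × ℝ) : 0 ≤ d x y := by unfold d; positivity

theorem d_self (x : ℝ × ℝ) : d x x = 0 := by simp [d]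

theorem d_pos {x y : ℝ × ℝ} (h : x ≠ y) : 0 < d x y := by
  refine lt_of_le_of_ne (d_nonneg _ _) fun h0 => h ?_
  have h1 := abs_nonneg (x.1 - y.1)
  have h2 := Real.sqrt_nonneg |x.2 - y.2|
  have h3 : |x.1 - y.1| = 0 := by unfold d at h0; linarith
  have h4 : √|x.2 - y.2| = 0 := by unfold d at h0; linarith
  rw [Real.sqrt_eq_zero (abs_nonneg _)] at h4
  exact Prod.ext (sub_eq_zero.1 (abs_eq_zero.1 h3)) (sub_eq_zero.1 (abs_eq_zero.1 h4))

theorem d_triangle (x y z : ℝ × ℝ) : d x z ≤ d x y + d y z := by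
  have h1 := abs_sub_le x.1 y.1 z.1
  have h2 : √|x.2 - z.2| ≤ √|x.2 - y.2| + √|y.2 - z.2| := by
    refine (Real.sqrt_le_sqrt (abs_sub_le x.2 y.2 z.2)).trans ?_
    rw [Real.sqrt_le_left (by positivity)]
    nlinarith [Real.sq_sqrt (abs_nonneg (x.2 - y.2)), Real.sq_sqrt (abs_nonneg (y.2 - z.2)),
      mul_nonneg (Real.sqrt_nonneg |x.2 - y.2|) (Real.sqrt_nonneg |y.2 - z.2|)]
  unfold d
  linarith

theorem abs_fst_le_d (x y : ℝ × ℝ) : |x.1 - y.1| ≤ d x y := by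
  unfold d; linarith [Real.sqrt_nonneg |x.2 - y.2|]

theorem abs_snd_le_d_sq (x y : ℝ × ℝ) : |x.2 - y.2| ≤ d x y ^ 2 := by
  have h := Real.sq_sqrt (abs_nonneg (x.2 - y.2))
  rw [← h]
  unfold d
  have := abs_nonneg (x.1 - y.1)
  gcongr
  linarith

theorem d_sq_le (x y : ℝ × ℝ) : d x y ^ 2 ≤ 2 * (x.1 - y.1) ^ 2 + 2 * |x.2 - y.2| := by
  have h := Real.sq_sqrt (abs_nonneg (x.2 - y.2))
  unfold d
  nlinarith [sq_abs (x.1 - y.1), sq_nonneg (|x.1 - y.1| - √|x.2 - y.2|)]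

theorem continuous_d (x : ℝ × ℝ) : Continuous fun z => d z x := by
  unfold d
  fun_prop

/-! ### Anisotropic kernels and mollification -/

/-- The kernel with Fourier symbol `(ik₁)ⁿ (ik₂)ᵐ exp(-s k₁⁴ - t k₂²)`. Separate parameters `s` and
`t` are needed since the semigroup adapted to the operator `∂₂ - a ∂₁²` has `s = a² t`. -/
noncomputable def kern (n m : ℕ) (s t : ℝ) (z : ℝ × ℝ) : ℝ := ker 2 n s z.1 * ker 1 m t z.2

/-- The convolution of `u` with `kern n m s t`, that is, the derivative `∂₁ⁿ ∂₂ᵐ` of the mollification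
of `u`. -/
noncomputable def moll (n m : ℕ) (s t : ℝ) (u : ℝ × ℝ → ℝ) (y : ℝ × ℝ) : ℝ :=
  ∫ z : ℝ × ℝ, u z * kern n m s t (y - z)

/-- The two-dimensional kernel factorizes: in the addition theorem for the cosine the product of sines
integrates to zero. -/
theorem psi_eq {T : ℝ} (hT : 0 < T) : psi T = kern 0 0 T T := by
  funext x
  have e : ∀ k : ℝ × ℝ, Real.exp (-T * (k.1 ^ 4 + k.2 ^ 2)) * Real.cos (k.1 * x.1 + k.2 * x.2)
      = (k.1 ^ 0 * Real.exp (-T * k.1 ^ (2 * 2)) * Real.cos (k.1 * x.1 + 0))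
          * (k.2 ^ 0 * Real.exp (-T * k.2 ^ (2 * 1)) * Real.cos (k.2 * x.2 + 0))
        - (Real.exp (-T * k.1 ^ (2 * 2)) * Real.sin (k.1 * x.1))
          * (Real.exp (-T * k.2 ^ (2 * 1)) * Real.sin (k.2 * x.2)) := by
    intro k
    rw [Real.cos_add, mul_add, Real.exp_add]
    simp only [add_zero, pow_zero, one_mul, mul_one, Nat.reduceMul]
    ring
  have i2 : ∀ q : ℕ, 0 < q → ∀ y : ℝ,
      Integrable fun k : ℝ => Real.exp (-T * k ^ (2 * q)) * Real.sin (k * y) := by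
    intro q hq y
    refine (integrable_osc hq 0 hT (-(Real.pi / 2)) y).congr
      (Filter.Eventually.of_forall fun k => ?_)
    simp only [← sub_eq_add_neg, Real.cos_sub_pi_div_two, pow_zero, one_mul]
  unfold psi
  simp_rw [e]
  rw [Measure.volume_eq_prod,
    integral_sub ((integrable_osc two_pos 0 hT 0 x.1).mul_prod (integrable_osc one_pos 0 hT 0 x.2))
      ((i2 2 two_pos x.1).mul_prod (i2 1 one_pos x.2)),
    integral_prod_mul (fun k : ℝ => k ^ 0 * Real.exp (-T * k ^ (2 * 2)) * Real.cos (k * x.1 + 0))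
      (fun k : ℝ => k ^ 0 * Real.exp (-T * k ^ (2 * 1)) * Real.cos (k * x.2 + 0)),
    integral_prod_mul (fun k : ℝ => Real.exp (-T * k ^ (2 * 2)) * Real.sin (k * x.1))
      (fun k : ℝ => Real.exp (-T * k ^ (2 * 1)) * Real.sin (k * x.2)), osc_sin_eq_zero, zero_mul,
    sub_zero]
  simp only [kern, ker, osc, Nat.cast_zero, zero_mul]
  rw [zpow_neg]
  norm_cast
  ring

theorem continuous_kern (n m : ℕ) {s t : ℝ} (hs : 0 < s) (ht : 0 < t) :
    Continuous (kern n m s t) :=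
  ((continuous_ker two_pos n hs).comp continuous_fst).mul
    ((continuous_ker one_pos m ht).comp continuous_snd)

theorem integrable_kern (n m : ℕ) {s t : ℝ} (hs : 0 < s) (ht : 0 < t) :
    Integrable (kern n m s t) :=
  (integrable_ker two_pos n hs).mul_prod (integrable_ker one_pos m ht)

theorem integral_kern (n m : ℕ) (s t : ℝ) :
    ∫ z, kern n m s t z = (∫ z, ker 2 n s z) * ∫ z, ker 1 m t z := by
  unfold kern
  exact integral_prod_mul (ker 2 n s) (ker 1 m t)

theorem integral_kern_zero {s t : ℝ} (hs : 0 < s) (ht : 0 < t) : ∫ z, kern 0 0 s t z = 1 := by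
  rw [integral_kern, integral_ker_zero two_pos hs, integral_ker_zero one_pos ht, one_mul]

theorem integral_kern_pos {n m : ℕ} (h : 0 < n + m) {s t : ℝ} (hs : 0 < s) (ht : 0 < t) :
    ∫ z, kern n m s t z = 0 := by
  rw [integral_kern]
  rcases n with _ | n
  · rcases m with _ | m
    · simp at h
    · rw [integral_ker_succ one_pos m ht, mul_zero]
  · rw [integral_ker_succ two_pos n hs, zero_mul]

section weighted

/-- The parabolic weight centred at `x` is dominated by a product of one-dimensional weights centred
at a nearby point `y`, so that moments of product kernels factorize. -/
theorem weight_le {ρ : ℝ} (hρ : 0 < ρ) {x y : ℝ × ℝ} (hy : d y x ≤ ρ) (z : ℝ × ℝ) :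
    1 + (d z x / ρ) ^ 2
      ≤ 5 * ((1 + ((y - z).1 / ρ) ^ 2) * (1 + ((y - z).2 / ρ ^ 2) ^ 2)) := by
  have h1 : d z x ≤ d y z + ρ := by
    rw [d_comm y z]
    linarith [d_triangle z y x]
  have h2 := d_sq_le y z
  have h3 : (d z x / ρ) ^ 2 ≤ 2 + 4 * ((y - z).1 / ρ) ^ 2 + 4 * |(y - z).2 / ρ ^ 2| := by
    rw [abs_div, abs_of_pos (by positivity : 0 < ρ ^ 2), div_pow, div_pow, div_le_iff₀ (by positivity)]
    have : (2 + 4 * ((y - z).1 ^ 2 / ρ ^ 2) + 4 * (|(y - z).2| / ρ ^ 2)) * ρ ^ 2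
        = 2 * ρ ^ 2 + 4 * (y - z).1 ^ 2 + 4 * |(y - z).2| := by
      field_simp
    rw [this]
    have h4 : d z x ^ 2 ≤ (d y z + ρ) ^ 2 := by
      have := d_nonneg z x
      gcongr
    simp only [Prod.fst_sub, Prod.snd_sub]
    nlinarith [sq_nonneg (d y z - ρ)]
  set p := ((y - z).1 / ρ) ^ 2 with hp
  have hp0 : 0 ≤ p := sq_nonneg _
  set q := |(y - z).2 / ρ ^ 2| with hq
  have hq0 : 0 ≤ q := abs_nonneg _
  rw [← sq_abs ((y - z).2 / ρ ^ 2), ← hq]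
  nlinarith [sq_nonneg (q - 1), mul_nonneg hp0 (sq_nonneg q)]

theorem integrable_kern_weight (n m : ℕ) {s t : ℝ} (hs : 0 < s) (ht : 0 < t) {ρ : ℝ} (hρ : 0 < ρ)
    {x y : ℝ × ℝ} (hy : d y x ≤ ρ) :
    Integrable fun z => |kern n m s t (y - z)| * (1 + (d z x / ρ) ^ 2) := by
  have i := (integrable_ker_weight two_pos n hs ρ).mul_prod (integrable_ker_weight one_pos m ht (ρ ^ 2))
  have i' := (Integrable.comp_sub_left (μ := volume) i y).const_mul 5
  refine i'.mono' (Continuous.aestronglyMeasurable ?_) (Filter.Eventually.of_forall fun z => ?_)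
  · have h1 := continuous_kern n m hs ht
    have h2 := continuous_d x
    fun_prop
  · rw [Real.norm_eq_abs, abs_of_nonneg (by positivity)]
    refine (mul_le_mul_of_nonneg_left (weight_le hρ hy z) (abs_nonneg _)).trans (le_of_eq ?_)
    rw [kern, abs_mul]
    ring

/-- Parabolic scaling of the weighted `L¹` norms of the kernels. -/
theorem exists_integral_kern_le (n m : ℕ) {c₁ c₂ : ℝ} (hc₁ : 0 < c₁) :
    ∃ C : ℝ, 0 ≤ C ∧ ∀ ρ s t : ℝ, 0 < ρ → c₁ * ρ ^ 4 ≤ s → s ≤ c₂ * ρ ^ 4 → c₁ * ρ ^ 4 ≤ t →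
      t ≤ c₂ * ρ ^ 4 → ∀ x y : ℝ × ℝ, d y x ≤ ρ →
      ∫ z, |kern n m s t (y - z)| * (1 + (d z x / ρ) ^ 2) ≤ C * (ρ ^ (n + 2 * m))⁻¹ := by
  obtain ⟨C₁, hC₁, h₁⟩ := exists_integral_ker_le two_pos n (c₂ := c₂) hc₁
  obtain ⟨C₂, hC₂, h₂⟩ := exists_integral_ker_le one_pos m (c₂ := c₂) hc₁
  refine ⟨5 * (C₁ * C₂), by positivity, fun ρ s t hρ hs1 hs2 ht1 ht2 x y hy => ?_⟩
  have hs : 0 < s := lt_of_lt_of_le (by positivity) hs1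
  have ht : 0 < t := lt_of_lt_of_le (by positivity) ht1
  have i := (integrable_ker_weight two_pos n hs ρ).mul_prod (integrable_ker_weight one_pos m ht (ρ ^ 2))
  have i' := (Integrable.comp_sub_left (μ := volume) i y).const_mul 5
  refine (integral_mono (integrable_kern_weight n m hs ht hρ hy) i' fun z => ?_).trans ?_
  · refine (mul_le_mul_of_nonneg_left (weight_le hρ hy z) (abs_nonneg _)).trans (le_of_eq ?_)
    rw [kern, abs_mul]
    ring
  · rw [integral_const_mul, integral_sub_left_eq_self (fun z : ℝ × ℝ =>
      |ker 2 n s z.1| * (1 + (z.1 / ρ) ^ 2) * (|ker 1 m t z.2| * (1 + (z.2 / ρ ^ 2) ^ 2)))]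
    have e := integral_prod_mul (μ := volume) (ν := volume)
      (fun z : ℝ => |ker 2 n s z| * (1 + (z / ρ) ^ 2))
      (fun z : ℝ => |ker 1 m t z| * (1 + (z / ρ ^ 2) ^ 2))
    rw [Measure.volume_eq_prod, e]
    have hpow : (ρ ^ 2) ^ (2 * 1) = ρ ^ 4 := by ring
    have b₁ := h₁ ρ s hρ hs1 hs2
    have b₂ := h₂ (ρ ^ 2) t (by positivity) (by rwa [hpow]) (by rwa [hpow])
    calc 5 * ((∫ z : ℝ, |ker 2 n s z| * (1 + (z / ρ) ^ 2))
          * ∫ z : ℝ, |ker 1 m t z| * (1 + (z / ρ ^ 2) ^ 2))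
        ≤ 5 * ((C₁ * (ρ ^ n)⁻¹) * (C₂ * ((ρ ^ 2) ^ m)⁻¹)) := by
          have : 0 ≤ ∫ z : ℝ, |ker 1 m t z| * (1 + (z / ρ ^ 2) ^ 2) :=
            integral_nonneg fun z => by positivity
          gcongr
      _ = 5 * (C₁ * C₂) * (ρ ^ (n + 2 * m))⁻¹ := by
          rw [pow_add, pow_mul, mul_inv]; ring

end weighted

section moll

variable {u : ℝ × ℝ → ℝ} {B : ℝ}

theorem integrable_mul_kern (hu : Continuous u) (hb : ∀ z, |u z| ≤ B) (n m : ℕ) {s t : ℝ}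
    (hs : 0 < s) (ht : 0 < t) (y : ℝ × ℝ) : Integrable fun z => u z * kern n m s t (y - z) :=
  ((integrable_kern n m hs ht).comp_sub_left y).bdd_mul (c := B) hu.aestronglyMeasurable
    (Filter.Eventually.of_forall hb)

theorem moll_eq (n m : ℕ) (s t : ℝ) (u : ℝ × ℝ → ℝ) (y : ℝ × ℝ) :
    moll n m s t u y = ∫ z, u (y - z) * kern n m s t z := by
  unfold moll
  rw [← integral_sub_left_eq_self _ _ y]
  simp

theorem mollify_eq {T : ℝ} (hT : 0 < T) (u : ℝ × ℝ → ℝ) : mollify T u = moll 0 0 T T u := by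
  funext y
  rw [mollify, psi_eq hT, moll]

theorem abs_moll_le (hb : ∀ z, |u z| ≤ B) (n m : ℕ) {s t : ℝ} (hs : 0 < s) (ht : 0 < t)
    (y : ℝ × ℝ) : |moll n m s t u y| ≤ B * ∫ z, |kern n m s t z| := by
  rw [moll_eq, ← integral_const_mul, ← Real.norm_eq_abs]
  refine norm_integral_le_of_norm_le ((integrable_kern n m hs ht).abs.const_mul B)
    (Filter.Eventually.of_forall fun z => ?_)
  rw [norm_mul]
  exact mul_le_mul_of_nonneg_right (hb _) (norm_nonneg _)

theorem continuous_moll (hu : Continuous u) (hb : ∀ z, |u z| ≤ B) (n m : ℕ) {s t : ℝ}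
    (hs : 0 < s) (ht : 0 < t) : Continuous (moll n m s t u) := by
  have e : moll n m s t u = fun y => ∫ z, u (y - z) * kern n m s t z :=
    funext fun y => moll_eq n m s t u y
  rw [e]
  have hk := continuous_kern n m hs ht
  refine continuous_of_dominated (bound := fun z => B * |kern n m s t z|)
    (fun y => Continuous.aestronglyMeasurable (by fun_prop))
    (fun y => Filter.Eventually.of_forall fun z => ?_)
    ((integrable_kern n m hs ht).abs.const_mul B)
    (Filter.Eventually.of_forall fun z => by fun_prop)
  rw [norm_mul]
  exact mul_le_mul_of_nonneg_right (hb _) (norm_nonneg _)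

theorem moll_periodic (hp : IsPeriodic u) (n m : ℕ) (s t : ℝ) : IsPeriodic (moll n m s t u) := by
  intro y
  simp only [moll_eq]
  constructor <;> congr 1 <;> ext z
  · rw [add_sub_right_comm, (hp (y - z)).1]
  · rw [add_sub_right_comm, (hp (y - z)).2]

/-- Subtraction of constants does not change derivatives of the mollification. -/
theorem moll_eq_sub (hu : Continuous u) (hb : ∀ z, |u z| ≤ B) {n m : ℕ} (h : 0 < n + m) {s t : ℝ}
    (hs : 0 < s) (ht : 0 < t) (c : ℝ) (y : ℝ × ℝ) :
    moll n m s t u y = ∫ z, (u z - c) * kern n m s t (y - z) := by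
  simp_rw [sub_mul]
  rw [integral_sub (integrable_mul_kern hu hb n m hs ht y)
    (((integrable_kern n m hs ht).comp_sub_left y).const_mul c), integral_const_mul,
    integral_sub_left_eq_self (kern n m s t), integral_kern_pos h hs ht, mul_zero, sub_zero, moll]

theorem moll_zero_sub (hu : Continuous u) (hb : ∀ z, |u z| ≤ B) {s t : ℝ}
    (hs : 0 < s) (ht : 0 < t) (c : ℝ) (y : ℝ × ℝ) :
    moll 0 0 s t u y - c = ∫ z, (u z - c) * kern 0 0 s t (y - z) := by
  simp_rw [sub_mul]
  rw [integral_sub (integrable_mul_kern hu hb 0 0 hs ht y)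
    (((integrable_kern 0 0 hs ht).comp_sub_left y).const_mul c), integral_const_mul,
    integral_sub_left_eq_self (kern 0 0 s t), integral_kern_zero hs ht, mul_one, moll]

/-- The semigroup property of mollification, including derivatives. -/
theorem moll_moll (hu : Continuous u) (hb : ∀ z, |u z| ≤ B) (n m n' m' : ℕ) {s t s' t' : ℝ}
    (hs : 0 < s) (ht : 0 < t) (hs' : 0 < s') (ht' : 0 < t') (y : ℝ × ℝ) :
    moll n m s t (moll n' m' s' t' u) y = moll (n + n') (m + m') (s + s') (t + t') u y := by
  have hint : Integrable (Function.uncurry fun z w : ℝ × ℝ =>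
      u w * kern n' m' s' t' (z - w) * kern n m s t (y - z)) (volume.prod volume) := by
    have i := Integrable.convolution_integrand (ContinuousLinearMap.mul ℝ ℝ)
      (μ := (volume : Measure (ℝ × ℝ))) (ν := (volume : Measure (ℝ × ℝ)))
      (((integrable_kern n m hs ht)).comp_sub_left y)
      ((integrable_kern n' m' hs' ht').comp_neg)
    have i2 := i.swap
    refine (i2.bdd_mul (c := B) (f := fun p : (ℝ × ℝ) × (ℝ × ℝ) => u p.2) (by fun_prop)
      (Filter.Eventually.of_forall fun p => hb _)).congr (Filter.Eventually.of_forall fun p => ?_)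
    simp only [Function.uncurry, Function.comp, Prod.swap, ContinuousLinearMap.mul_apply', neg_sub]
    ring
  have hsw := integral_integral_swap hint
  unfold moll
  simp_rw [integral_mul_const] at hsw
  rw [hsw]
  congr 1 with w
  have e : ∀ z : ℝ × ℝ, u w * kern n' m' s' t' (z - w) * kern n m s t (y - z)
      = u w * ((fun z : ℝ × ℝ => kern n m s t ((y - w) - z) * kern n' m' s' t' z) (z - w)) := by
    intro z
    simp only [sub_sub_sub_cancel_right]
    ring
  simp_rw [e]
  rw [integral_const_mul, integral_sub_right_eq_self
    (fun z : ℝ × ℝ => kern n m s t ((y - w) - z) * kern n' m' s' t' z) w]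
  congr 1
  have e2 : ∀ z : ℝ × ℝ, kern n m s t ((y - w) - z) * kern n' m' s' t' z
      = (ker 2 n s ((y - w).1 - z.1) * ker 2 n' s' z.1)
        * (ker 1 m t ((y - w).2 - z.2) * ker 1 m' t' z.2) := by
    intro z
    simp only [kern, Prod.fst_sub, Prod.snd_sub]
    ring
  simp_rw [e2]
  rw [Measure.volume_eq_prod, integral_prod_mul (fun z => ker 2 n s ((y - w).1 - z) * ker 2 n' s' z)
    (fun z => ker 1 m t ((y - w).2 - z) * ker 1 m' t' z),
    integral_ker_mul_ker two_pos n n' hs hs', integral_ker_mul_ker one_pos m m' ht ht', kern]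

/-- Differentiation under the integral for product kernels depending on a parameter. -/
theorem hasDerivAt_integral_mul_prod (hu : Continuous u) (hb : ∀ z, |u z| ≤ B)
    {k₁ k₂ k₁' k₂' : ℝ → ℝ → ℝ} {g₁ g₂ : ℝ → ℝ} {S : Set ℝ} {r : ℝ} (hS : S ∈ nhds r)
    (c₁ : ∀ p ∈ S, Continuous (k₁ p)) (c₂ : ∀ p ∈ S, Continuous (k₂ p))
    (c₁' : ∀ p ∈ S, Continuous (k₁' p)) (c₂' : ∀ p ∈ S, Continuous (k₂' p))
    (b₁ : ∀ p ∈ S, ∀ x, |k₁ p x| ≤ g₁ x) (b₂ : ∀ p ∈ S, ∀ x, |k₂ p x| ≤ g₂ x)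
    (b₁' : ∀ p ∈ S, ∀ x, |k₁' p x| ≤ g₁ x) (b₂' : ∀ p ∈ S, ∀ x, |k₂' p x| ≤ g₂ x)
    (i₁ : Integrable g₁) (i₂ : Integrable g₂)
    (d₁ : ∀ p ∈ S, ∀ x, HasDerivAt (fun p => k₁ p x) (k₁' p x) p)
    (d₂ : ∀ p ∈ S, ∀ x, HasDerivAt (fun p => k₂ p x) (k₂' p x) p) :
    HasDerivAt (fun p => ∫ z : ℝ × ℝ, u z * (k₁ p z.1 * k₂ p z.2))
      ((∫ z : ℝ × ℝ, u z * (k₁' r z.1 * k₂ r z.2)) + ∫ z : ℝ × ℝ, u z * (k₁ r z.1 * k₂' r z.2)) r := by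
  have hr : r ∈ S := mem_of_mem_nhds hS
  have hB : 0 ≤ B := (abs_nonneg _).trans (hb 0)
  have hg₁ : ∀ x, 0 ≤ g₁ x := fun x => (abs_nonneg _).trans (b₁ r hr x)
  have hg₂ : ∀ x, 0 ≤ g₂ x := fun x => (abs_nonneg _).trans (b₂ r hr x)
  have ig : Integrable fun z : ℝ × ℝ => B * (g₁ z.1 * g₂ z.2) := (i₁.mul_prod i₂).const_mul B
  have cont : ∀ {f g : ℝ → ℝ}, Continuous f → Continuous g →
      Continuous fun z : ℝ × ℝ => u z * (f z.1 * g z.2) := fun hf hg => by fun_prop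
  have bound : ∀ {f g : ℝ → ℝ}, (∀ x, |f x| ≤ g₁ x) → (∀ x, |g x| ≤ g₂ x) →
      ∀ z : ℝ × ℝ, ‖u z * (f z.1 * g z.2)‖ ≤ B * (g₁ z.1 * g₂ z.2) := fun hf hg z => by
    rw [Real.norm_eq_abs, abs_mul, abs_mul]
    exact mul_le_mul (hb z) (mul_le_mul (hf _) (hg _) (abs_nonneg _) (hg₁ _)) (by positivity) hB
  have integ : ∀ {f g : ℝ → ℝ}, Continuous f → Continuous g → (∀ x, |f x| ≤ g₁ x) →
      (∀ x, |g x| ≤ g₂ x) → Integrable fun z : ℝ × ℝ => u z * (f z.1 * g z.2) :=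
    fun hf hg hf' hg' => ig.mono' (cont hf hg).aestronglyMeasurable
      (Filter.Eventually.of_forall (bound hf' hg'))
  have h := (hasDerivAt_integral_of_dominated_loc_of_deriv_le (μ := (volume : Measure (ℝ × ℝ)))
    (F := fun p z => u z * (k₁ p z.1 * k₂ p z.2))
    (F' := fun p z => u z * (k₁' p z.1 * k₂ p z.2) + u z * (k₁ p z.1 * k₂' p z.2))
    (bound := fun z => B * (g₁ z.1 * g₂ z.2) + B * (g₁ z.1 * g₂ z.2)) hS
    (Filter.eventually_of_mem hS fun p hp => (cont (c₁ p hp) (c₂ p hp)).aestronglyMeasurable)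
    (integ (c₁ r hr) (c₂ r hr) (b₁ r hr) (b₂ r hr))
    ((cont (c₁' r hr) (c₂ r hr)).add (cont (c₁ r hr) (c₂' r hr))).aestronglyMeasurable
    (Filter.Eventually.of_forall fun z p hp => (norm_add_le _ _).trans
      (add_le_add (bound (b₁' p hp) (b₂ p hp) z) (bound (b₁ p hp) (b₂' p hp) z)))
    (ig.add ig)
    (Filter.Eventually.of_forall fun z p hp => ?_)).2
  · rwa [integral_add (integ (c₁' r hr) (c₂ r hr) (b₁' r hr) (b₂ r hr))
      (integ (c₁ r hr) (c₂' r hr) (b₁ r hr) (b₂' r hr))] at h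
  · refine (((d₁ p hp z.1).mul (d₂ p hp z.2)).const_mul (u z)).congr_deriv ?_
    ring

theorem hasDerivAt_moll_line (hu : Continuous u) (hb : ∀ z, |u z| ≤ B) (n m : ℕ) {s t : ℝ}
    (hs : 0 < s) (ht : 0 < t) (y v : ℝ × ℝ) (r : ℝ) :
    HasDerivAt (fun r : ℝ => moll n m s t u (y + r • v))
      (v.1 * moll (n + 1) m s t u (y + r • v) + v.2 * moll n (m + 1) s t u (y + r • v)) r := by
  obtain ⟨C₁, hC₁, h₁⟩ := exists_ker_le two_pos n (s₁ := s) hs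
  obtain ⟨C₁', hC₁', h₁'⟩ := exists_ker_le two_pos (n + 1) (s₁ := s) hs
  obtain ⟨C₂, hC₂, h₂⟩ := exists_ker_le one_pos m (s₁ := t) ht
  obtain ⟨C₂', hC₂', h₂'⟩ := exists_ker_le one_pos (m + 1) (s₁ := t) ht
  have key : ∀ {q j : ℕ} {s C C' : ℝ} (v : ℝ) {p y x : ℝ}, 0 ≤ C' →
      (∀ τ, s ≤ τ → τ ≤ s → ∀ x h : ℝ, |h| ≤ 1 → |ker q j τ (x + h)| ≤ C * (1 + x ^ 4)⁻¹) →
      |(p - r) * v| < 1 →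
      |ker q j s (y + p * v - x)| ≤ (C + C') * (1 + (y + r * v - x) ^ 4)⁻¹ := by
    intro q j s C C' v p y x hC' h hp
    have := h s le_rfl le_rfl (y + r * v - x) ((p - r) * v) hp.le
    rw [show y + r * v - x + (p - r) * v = y + p * v - x by ring] at this
    refine this.trans ?_
    gcongr
    linarith
  have ck := fun j => continuous_ker two_pos j hs
  have ck' := fun j => continuous_ker one_pos j ht
  have hder : ∀ {q j : ℕ} {s : ℝ}, 0 < q → 0 < s → ∀ v y x p : ℝ,
      HasDerivAt (fun p => ker q j s (y + p * v - x)) (v * ker q (j + 1) s (y + p * v - x)) p := by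
    intro q j s hq hs v y x p
    have h1 : HasDerivAt (fun p : ℝ => y + p * v - x) v p := by
      simpa using (((hasDerivAt_id p).mul_const v).const_add y).sub_const x
    refine ((hasDerivAt_ker hq j hs (y + p * v - x)).comp p h1).congr_deriv ?_
    ring
  have key' : ∀ {q j : ℕ} {s C C' : ℝ} (v : ℝ) {p y x : ℝ}, 0 ≤ C → 0 ≤ C' →
      (∀ τ, s ≤ τ → τ ≤ s → ∀ x h : ℝ, |h| ≤ 1 → |ker q j τ (x + h)| ≤ C * (1 + x ^ 4)⁻¹) →
      |(p - r) * v| < 1 →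
      |v * ker q j s (y + p * v - x)| ≤ (C' + |v| * C) * (1 + (y + r * v - x) ^ 4)⁻¹ := by
    intro q j s C C' v p y x hC hC' h hp
    rw [abs_mul]
    calc |v| * |ker q j s (y + p * v - x)|
        ≤ |v| * ((C + 0) * (1 + (y + r * v - x) ^ 4)⁻¹) := by
          gcongr
          exact key v le_rfl h hp
      _ ≤ (C' + |v| * C) * (1 + (y + r * v - x) ^ 4)⁻¹ := by
          rw [add_zero, ← mul_assoc]
          gcongr
          linarith
  have h := hasDerivAt_integral_mul_prod hu hb (r := r)
    (S := {p | |(p - r) * v.1| < 1 ∧ |(p - r) * v.2| < 1})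
    (k₁ := fun p x => ker 2 n s (y.1 + p * v.1 - x))
    (k₂ := fun p x => ker 1 m t (y.2 + p * v.2 - x))
    (k₁' := fun p x => v.1 * ker 2 (n + 1) s (y.1 + p * v.1 - x))
    (k₂' := fun p x => v.2 * ker 1 (m + 1) t (y.2 + p * v.2 - x))
    (g₁ := fun x => (C₁ + |v.1| * C₁') * (1 + (y.1 + r * v.1 - x) ^ 4)⁻¹)
    (g₂ := fun x => (C₂ + |v.2| * C₂') * (1 + (y.2 + r * v.2 - x) ^ 4)⁻¹)
    (by
      refine IsOpen.mem_nhds ?_ (by simp)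
      exact (isOpen_lt (f := fun p : ℝ => |(p - r) * v.1|) (by fun_prop) continuous_const).inter
        (isOpen_lt (f := fun p : ℝ => |(p - r) * v.2|) (by fun_prop) continuous_const))
    (fun p _ => by have := ck n; fun_prop) (fun p _ => by have := ck' m; fun_prop)
    (fun p _ => by have := ck (n + 1); fun_prop) (fun p _ => by have := ck' (m + 1); fun_prop)
    (fun p hp x => key _ (by positivity) h₁ hp.1) (fun p hp x => key _ (by positivity) h₂ hp.2)
    (fun p hp x => key' _ hC₁' hC₁ h₁' hp.1) (fun p hp x => key' _ hC₂' hC₂ h₂' hp.2)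
    ((integrable_one_add_pow_four_inv.comp_sub_left _).const_mul _)
    ((integrable_one_add_pow_four_inv.comp_sub_left _).const_mul _)
    (fun p _ x => hder two_pos hs _ _ _ _) (fun p _ x => hder one_pos ht _ _ _ _)
  refine h.congr_deriv ?_
  unfold moll
  rw [← integral_const_mul, ← integral_const_mul]
  congr 1 <;> congr 1 with z <;> simp only [kern, Prod.fst_sub, Prod.snd_sub, Prod.fst_add,
    Prod.snd_add, Prod.smul_fst, Prod.smul_snd, smul_eq_mul] <;> ring

/-- Derivative of the mollification when both smoothing parameters move at constant speeds `α`, `β`;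
`α = a²`, `β = 1` is the semigroup adapted to `∂₂ - a ∂₁²`. -/
theorem hasDerivAt_moll_time (hu : Continuous u) (hb : ∀ z, |u z| ≤ B) (n m : ℕ) (s t α β : ℝ)
    {r : ℝ} (hs : 0 < s + α * r) (ht : 0 < t + β * r) (y : ℝ × ℝ) :
    HasDerivAt (fun r : ℝ => moll n m (s + α * r) (t + β * r) u y)
      (-α * moll (n + 4) m (s + α * r) (t + β * r) u y
        + β * moll n (m + 2) (s + α * r) (t + β * r) u y) r := by
  obtain ⟨C₁, hC₁, h₁⟩ := exists_ker_le two_pos n (s₁ := 2 * (s + α * r)) (half_pos hs)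
  obtain ⟨C₁', hC₁', h₁'⟩ := exists_ker_le two_pos (n + 4) (s₁ := 2 * (s + α * r)) (half_pos hs)
  obtain ⟨C₂, hC₂, h₂⟩ := exists_ker_le one_pos m (s₁ := 2 * (t + β * r)) (half_pos ht)
  obtain ⟨C₂', hC₂', h₂'⟩ := exists_ker_le one_pos (m + 2) (s₁ := 2 * (t + β * r)) (half_pos ht)
  have key : ∀ {q j : ℕ} {s C C' σ : ℝ} {x : ℝ}, 0 ≤ C' →
      (∀ τ, s / 2 ≤ τ → τ ≤ 2 * s → ∀ x h : ℝ, |h| ≤ 1 → |ker q j τ (x + h)| ≤ C * (1 + x ^ 4)⁻¹) →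
      s / 2 < σ → σ < 2 * s → |ker q j σ x| ≤ (C + C') * (1 + x ^ 4)⁻¹ := by
    intro q j s C C' σ x hC' h h1 h2
    have := h σ h1.le h2.le x 0 (by simp)
    rw [add_zero] at this
    refine this.trans ?_
    gcongr
    linarith
  have key' : ∀ {q j : ℕ} {s C C' σ : ℝ} {x : ℝ} (v : ℝ), 0 ≤ C → 0 ≤ C' →
      (∀ τ, s / 2 ≤ τ → τ ≤ 2 * s → ∀ x h : ℝ, |h| ≤ 1 → |ker q j τ (x + h)| ≤ C * (1 + x ^ 4)⁻¹) →
      s / 2 < σ → σ < 2 * s → |v * ker q j σ x| ≤ (C' + |v| * C) * (1 + x ^ 4)⁻¹ := by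
    intro q j s C C' σ x v hC hC' h h1 h2
    have := key (C' := 0) (x := x) le_rfl h h1 h2
    rw [add_zero] at this
    rw [abs_mul]
    calc |v| * |ker q j σ x| ≤ |v| * (C * (1 + x ^ 4)⁻¹) := by gcongr
      _ ≤ (C' + |v| * C) * (1 + x ^ 4)⁻¹ := by
          rw [← mul_assoc]
          gcongr
          linarith
  have pos : ∀ {s σ : ℝ}, 0 < s → s / 2 < σ → 0 < σ := fun h h' => (half_pos h).trans h'
  have hder : ∀ {q j : ℕ} {s α p : ℝ} (x : ℝ), 0 < q → 0 < s + α * p →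
      HasDerivAt (fun p => ker q j (s + α * p) x)
        ((-1) ^ (q + 1) * α * ker q (j + 2 * q) (s + α * p) x) p := by
    intro q j s α p x hq hs
    have h1 : HasDerivAt (fun p : ℝ => s + α * p) α p := by
      simpa using ((hasDerivAt_id p).const_mul α).const_add s
    refine ((hasDerivAt_ker_time hq j hs x).comp p h1).congr_deriv ?_
    ring
  have h := hasDerivAt_integral_mul_prod hu hb (r := r)
    (S := {p | ((s + α * r) / 2 < s + α * p ∧ s + α * p < 2 * (s + α * r))
      ∧ ((t + β * r) / 2 < t + β * p ∧ t + β * p < 2 * (t + β * r))})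
    (k₁ := fun p x => ker 2 n (s + α * p) (y.1 - x))
    (k₂ := fun p x => ker 1 m (t + β * p) (y.2 - x))
    (k₁' := fun p x => -α * ker 2 (n + 4) (s + α * p) (y.1 - x))
    (k₂' := fun p x => β * ker 1 (m + 2) (t + β * p) (y.2 - x))
    (g₁ := fun x => (C₁ + |-α| * C₁') * (1 + (y.1 - x) ^ 4)⁻¹)
    (g₂ := fun x => (C₂ + |β| * C₂') * (1 + (y.2 - x) ^ 4)⁻¹)
    (by
      refine IsOpen.mem_nhds ?_ ⟨⟨by linarith, by linarith⟩, ⟨by linarith, by linarith⟩⟩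
      have c₁ : Continuous fun p : ℝ => s + α * p := by fun_prop
      have c₂ : Continuous fun p : ℝ => t + β * p := by fun_prop
      exact ((isOpen_lt continuous_const c₁).inter (isOpen_lt c₁ continuous_const)).inter
        ((isOpen_lt continuous_const c₂).inter (isOpen_lt c₂ continuous_const)))
    (fun p hp => by have := continuous_ker two_pos n (pos hs hp.1.1); fun_prop)
    (fun p hp => by have := continuous_ker one_pos m (pos ht hp.2.1); fun_prop)
    (fun p hp => by have := continuous_ker two_pos (n + 4) (pos hs hp.1.1); fun_prop)
    (fun p hp => by have := continuous_ker one_pos (m + 2) (pos ht hp.2.1); fun_prop)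
    (fun p hp x => key (by positivity) h₁ hp.1.1 hp.1.2)
    (fun p hp x => key (by positivity) h₂ hp.2.1 hp.2.2)
    (fun p hp x => key' _ hC₁' hC₁ h₁' hp.1.1 hp.1.2)
    (fun p hp x => key' _ hC₂' hC₂ h₂' hp.2.1 hp.2.2)
    ((integrable_one_add_pow_four_inv.comp_sub_left _).const_mul _)
    ((integrable_one_add_pow_four_inv.comp_sub_left _).const_mul _)
    (fun p hp x => (hder (y.1 - x) two_pos (pos hs hp.1.1)).congr_deriv (by norm_num))
    (fun p hp x => (hder (y.2 - x) one_pos (pos ht hp.2.1)).congr_deriv (by norm_num))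
  refine h.congr_deriv ?_
  unfold moll
  rw [← integral_const_mul, ← integral_const_mul]
  congr 1 <;> congr 1 with z <;> simp only [kern, Prod.fst_sub, Prod.snd_sub] <;> ring

end moll

/-! ### Interior estimates from local splitting -/

/-- The mollification at scale `σ` of `(∂₂ - a ∂₁²) u`. -/
noncomputable def heatMoll (a σ : ℝ) (u : ℝ × ℝ → ℝ) (y : ℝ × ℝ) : ℝ :=
  moll 0 1 σ σ u y - a * moll 2 0 σ σ u y

/-- The hypotheses on a function `u` near a base point `x` from which all single-point estimates are
derived: `N` bounds the oscillation of `u`, and `(∂₂ - a ∂₁²) u`, mollified at any scale `τ ≤ 1`, is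
close to its value at `x`. Both are in force on the whole plane, so that kernel tails need no
separate treatment. -/
structure LocalSplitting (κ a N : ℝ) (x : ℝ × ℝ) (u : ℝ × ℝ → ℝ) : Prop where
  continuous : Continuous u
  osc_le : ∀ z z', |u z - u z'| ≤ N
  heat_le : ∀ τ, 0 < τ → τ ≤ 1 → ∀ z, |heatMoll a (τ ^ 4) u z - heatMoll a (τ ^ 4) u x|
    ≤ N * τ ^ (κ - 2) * (1 + (d z x / τ) ^ 2)

theorem LocalSplitting.nonneg {κ a N : ℝ} {x : ℝ × ℝ} {u : ℝ × ℝ → ℝ}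
    (h : LocalSplitting κ a N x u) : 0 ≤ N := (abs_nonneg _).trans (h.osc_le 0 0)

theorem LocalSplitting.bounded {κ a N : ℝ} {x : ℝ × ℝ} {u : ℝ × ℝ → ℝ}
    (h : LocalSplitting κ a N x u) (z : ℝ × ℝ) : |u z| ≤ |u x| + N := by
  have h1 := h.osc_le z x
  have h2 := abs_add_le (u z - u x) (u x)
  rw [sub_add_cancel] at h2
  linarith

theorem continuous_heatMoll {u : ℝ × ℝ → ℝ} {B : ℝ} (hu : Continuous u) (hb : ∀ z, |u z| ≤ B)
    (a : ℝ) {σ : ℝ} (hσ : 0 < σ) : Continuous (heatMoll a σ u) :=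
  (continuous_moll hu hb 0 1 hσ hσ).sub ((continuous_moll hu hb 2 0 hσ hσ).const_mul a)

theorem exists_abs_heatMoll_le {u : ℝ × ℝ → ℝ} {B : ℝ} (hb : ∀ z, |u z| ≤ B)
    (a : ℝ) {σ : ℝ} (hσ : 0 < σ) : ∃ K, ∀ z, |heatMoll a σ u z| ≤ K := by
  refine ⟨B * (∫ z, |kern 0 1 σ σ z|) + |a| * (B * ∫ z, |kern 2 0 σ σ z|), fun z =>
    (abs_sub _ _).trans (add_le_add (abs_moll_le hb 0 1 hσ hσ z) ?_)⟩
  rw [abs_mul]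
  exact mul_le_mul_of_nonneg_left (abs_moll_le hb 2 0 hσ hσ z) (abs_nonneg _)

theorem moll_heatMoll {u : ℝ × ℝ → ℝ} {B : ℝ} (hu : Continuous u) (hb : ∀ z, |u z| ≤ B)
    (n m : ℕ) {s t : ℝ} (hs : 0 < s) (ht : 0 < t) (a : ℝ) {σ : ℝ} (hσ : 0 < σ) (y : ℝ × ℝ) :
    moll n m s t (heatMoll a σ u) y
      = moll n (m + 1) (s + σ) (t + σ) u y - a * moll (n + 2) m (s + σ) (t + σ) u y := by
  have h1 := moll_moll hu hb n m 0 1 hs ht hσ hσ y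
  have h2 := moll_moll hu hb n m 2 0 hs ht hσ hσ y
  rw [add_zero] at h1 h2
  rw [← h1, ← h2]
  unfold heatMoll
  conv_lhs => unfold moll
  have e : ∀ z, (moll 0 1 σ σ u z - a * moll 2 0 σ σ u z) * kern n m s t (y - z)
      = moll 0 1 σ σ u z * kern n m s t (y - z)
        - a * (moll 2 0 σ σ u z * kern n m s t (y - z)) := fun z => by ring
  have i1 := integrable_mul_kern (continuous_moll hu hb 0 1 hσ hσ)
    (fun z => abs_moll_le hb 0 1 hσ hσ z) n m hs ht y
  have i2 := (integrable_mul_kern (continuous_moll hu hb 2 0 hσ hσ)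
    (fun z => abs_moll_le hb 2 0 hσ hσ z) n m hs ht y).const_mul a
  have h := integral_sub i1 i2
  rw [integral_const_mul] at h
  refine Eq.trans ?_ h
  congr 1 with z
  exact e z

theorem heatOp_mollify {u : ℝ × ℝ → ℝ} {B : ℝ} (hu : Continuous u) (hb : ∀ z, |u z| ≤ B)
    (a : ℝ) {T : ℝ} (hT : 0 < T) : heatOp a (mollify T u) = heatMoll a T u := by
  funext y
  have h1 : ∀ (n m : ℕ) (w c : ℝ), HasDerivAt (fun r => moll n m T T u (r, c))
      (moll (n + 1) m T T u (w, c)) w := fun n m w c => by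
    simpa using hasDerivAt_moll_line hu hb n m hT hT (0, c) (1, 0) w
  have h2 : ∀ (n m : ℕ) (w c : ℝ), HasDerivAt (fun r => moll n m T T u (c, r))
      (moll n (m + 1) T T u (c, w)) w := fun n m w c => by
    simpa using hasDerivAt_moll_line hu hb n m hT hT (c, 0) (0, 1) w
  rw [heatOp, mollify_eq hT, heatMoll, (h2 0 0 y.2 y.1).deriv, iteratedDeriv_succ,
    iteratedDeriv_one]
  have : deriv (fun s => moll 0 0 T T u (s, y.2)) = fun s => moll 1 0 T T u (s, y.2) :=
    funext fun w => (h1 0 0 w y.2).deriv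
  rw [this, (h1 1 0 y.1 y.2).deriv]

/-- Mean value inequality with a majorant of the derivative. -/
theorem abs_sub_le_of_deriv_le {g g' b b' : ℝ → ℝ} {p q : ℝ} (hpq : p ≤ q)
    (hg : ∀ r ∈ Set.Icc p q, HasDerivAt g (g' r) r) (hb : ∀ r ∈ Set.Icc p q, HasDerivAt b (b' r) r)
    (hle : ∀ r ∈ Set.Icc p q, |g' r| ≤ b' r) : |g q - g p| ≤ b q - b p := by
  have mono : ∀ {f f' : ℝ → ℝ}, (∀ r ∈ Set.Icc p q, HasDerivAt f (f' r) r) →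
      (∀ r ∈ Set.Icc p q, 0 ≤ f' r) → f p ≤ f q := by
    intro f f' hf hf'
    refine monotoneOn_of_deriv_nonneg (convex_Icc p q)
      (fun r hr => (hf r hr).continuousAt.continuousWithinAt)
      (fun r hr => (hf r (interior_subset hr)).differentiableAt.differentiableWithinAt)
      (fun r hr => ?_) (Set.left_mem_Icc.2 hpq) (Set.right_mem_Icc.2 hpq) hpq
    rw [(hf r (interior_subset hr)).deriv]
    exact hf' r (interior_subset hr)
  have h1 := mono (f := fun r => b r - g r) (fun r hr => (hb r hr).sub (hg r hr))
    fun r hr => sub_nonneg.2 ((le_abs_self _).trans (hle r hr))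
  have h2 := mono (f := fun r => b r + g r) (fun r hr => (hb r hr).add (hg r hr))
    fun r hr => by linarith [(neg_le_abs (g' r)).trans (hle r hr)]
  rw [abs_le]
  constructor <;> linarith

/-- A function with the parabolic weight around `x` as a majorant has controlled convolutions with the
kernels near `x`. -/
theorem exists_integral_mul_kern_le (n m : ℕ) {c₁ c₂ : ℝ} (hc₁ : 0 < c₁) :
    ∃ C : ℝ, 0 ≤ C ∧ ∀ ρ s t : ℝ, 0 < ρ → c₁ * ρ ^ 4 ≤ s → s ≤ c₂ * ρ ^ 4 → c₁ * ρ ^ 4 ≤ t →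
      t ≤ c₂ * ρ ^ 4 → ∀ x y : ℝ × ℝ, d y x ≤ ρ → ∀ (g : ℝ × ℝ → ℝ) (K : ℝ), 0 ≤ K →
      (∀ z, |g z| ≤ K * (1 + (d z x / ρ) ^ 2)) →
      |∫ z, g z * kern n m s t (y - z)| ≤ C * K * (ρ ^ (n + 2 * m))⁻¹ := by
  obtain ⟨C, hC, h⟩ := exists_integral_kern_le n m (c₂ := c₂) hc₁
  refine ⟨C, hC, fun ρ s t hρ hs1 hs2 ht1 ht2 x y hy g K hK hg => ?_⟩
  have hs : 0 < s := lt_of_lt_of_le (by positivity) hs1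
  have ht : 0 < t := lt_of_lt_of_le (by positivity) ht1
  rw [← Real.norm_eq_abs]
  refine (norm_integral_le_of_norm_le ((integrable_kern_weight n m hs ht hρ hy).const_mul K)
    (Filter.Eventually.of_forall fun z => ?_)).trans ?_
  · rw [norm_mul, Real.norm_eq_abs, Real.norm_eq_abs]
    calc |g z| * |kern n m s t (y - z)|
        ≤ (K * (1 + (d z x / ρ) ^ 2)) * |kern n m s t (y - z)| := by gcongr; exact hg z
      _ = _ := by ring
  · rw [integral_const_mul, mul_comm C, mul_assoc]
    exact mul_le_mul_of_nonneg_left (h ρ s t hρ hs1 hs2 ht1 ht2 x y hy) hK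

section estimates

variable {lam κ : ℝ}

/-- Along the semigroup adapted to `∂₂ - a ∂₁²`, the time derivative factorizes as
`∂₂² - a² ∂₁⁴ = (∂₂ + a ∂₁²)(∂₂ - a ∂₁²)`, and the second factor is controlled by local splitting;
the first one falls on a kernel and hence annihilates constants. -/
theorem exists_adapted_deriv_le (hlam : 0 < lam) (n m : ℕ) {c₁ c₂ : ℝ}
    (hc₁ : 0 < c₁) :
    ∃ C : ℝ, 0 ≤ C ∧ ∀ (a N : ℝ) (x : ℝ × ℝ) (u : ℝ × ℝ → ℝ), a ∈ Set.Icc lam lam⁻¹ →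
      LocalSplitting κ a N x u → ∀ ρ s t : ℝ, 0 < ρ → ρ ^ 4 ≤ 2 → c₁ * ρ ^ 4 ≤ s →
      s ≤ c₂ * ρ ^ 4 → c₁ * ρ ^ 4 ≤ t → t ≤ c₂ * ρ ^ 4 → ∀ y, d y x ≤ ρ →
      |-a ^ 2 * moll (n + 4) m s t u y + moll n (m + 2) s t u y|
        ≤ C * N * ρ ^ (κ - 4 - (n + 2 * m : ℕ)) := by
  obtain ⟨C₁, hC₁, h₁⟩ := exists_integral_mul_kern_le n (m + 1) (c₂ := c₂) (half_pos hc₁)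
  obtain ⟨C₂, hC₂, h₂⟩ := exists_integral_mul_kern_le (n + 2) m (c₂ := c₂) (half_pos hc₁)
  -- the data are mollified at the scale `c * ρ`, leaving half of the smoothing to the kernel
  set c : ℝ := min c₁ 1 / 2 with hc
  have hc0 : 0 < c := by positivity
  have hcc : c ≤ c₁ / 2 := by rw [hc]; gcongr; exact min_le_left _ _
  have hc1 : c ≤ 1 / 2 := by rw [hc]; gcongr; exact min_le_right _ _
  have hc4 : c ^ 4 ≤ c := by
    have := pow_le_pow_of_le_one hc0.le (by linarith) (show 1 ≤ 4 by norm_num)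
    simpa using this
  refine ⟨(C₁ + lam⁻¹ * C₂) * (c ^ (κ - 2) * (c ^ 2)⁻¹), by positivity,
    fun a N x u ha hu ρ s t hρ hρ2 hs1 hs2 ht1 ht2 y hy => ?_⟩
  have hN := hu.nonneg
  have hb := hu.bounded
  have hρ4 : 0 < ρ ^ 4 := by positivity
  set σ : ℝ := (c * ρ) ^ 4 with hσ
  have hσ0 : 0 < σ := by positivity
  have hσc : σ ≤ c₁ / 2 * ρ ^ 4 := by
    rw [hσ, mul_pow]
    gcongr
    linarith
  have hτ1 : c * ρ ≤ 1 := by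
    refine le_of_pow_le_pow_left₀ (n := 4) (by norm_num) zero_le_one ?_
    rw [mul_pow]
    nlinarith
  have hs : 0 < s - σ := by nlinarith
  have ht : 0 < t - σ := by nlinarith
  set f := heatMoll a σ u with hf
  obtain ⟨K, hK⟩ := exists_abs_heatMoll_le hb a hσ0
  have hfc := continuous_heatMoll hu.continuous hb a hσ0
  have e1 := moll_heatMoll hu.continuous hb n (m + 1) hs ht a hσ0 y
  have e2 := moll_heatMoll hu.continuous hb (n + 2) m hs ht a hσ0 y
  rw [sub_add_cancel, sub_add_cancel, ← hf] at e1 e2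
  have hfx : ∀ z, |f z - f x| ≤ (N * (c * ρ) ^ (κ - 2) * (c ^ 2)⁻¹) * (1 + (d z x / ρ) ^ 2) := by
    intro z
    refine (hu.heat_le (c * ρ) (by positivity) hτ1 z).trans ?_
    rw [mul_assoc (N * (c * ρ) ^ (κ - 2))]
    gcongr
    have : (d z x / (c * ρ)) ^ 2 = (c ^ 2)⁻¹ * (d z x / ρ) ^ 2 := by field_simp
    rw [this, mul_add, mul_one]
    gcongr
    exact (one_le_inv₀ (by positivity)).2 (pow_le_one₀ hc0.le (by linarith))
  have hK0 : 0 ≤ N * (c * ρ) ^ (κ - 2) * (c ^ 2)⁻¹ := by positivity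
  have b1 := h₁ ρ (s - σ) (t - σ) hρ (by linarith) (by linarith) (by linarith) (by linarith) x y hy
    (fun z => f z - f x) _ hK0 hfx
  have b2 := h₂ ρ (s - σ) (t - σ) hρ (by linarith) (by linarith) (by linarith) (by linarith) x y hy
    (fun z => f z - f x) _ hK0 hfx
  rw [← moll_eq_sub hfc hK (by omega) hs ht (f x) y] at b1 b2
  have e : -a ^ 2 * moll (n + 4) m s t u y + moll n (m + 2) s t u y
      = moll n (m + 1) (s - σ) (t - σ) f y + a * moll (n + 2) m (s - σ) (t - σ) f y := by
    rw [e1, e2]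
    ring
  have hpow1 : (ρ ^ (n + 2 + 2 * m))⁻¹ = (ρ ^ (n + 2 * m + 2))⁻¹ := by congr 2; ring
  have hpow2 : (ρ ^ (n + 2 * (m + 1)))⁻¹ = (ρ ^ (n + 2 * m + 2))⁻¹ := by congr 2
  rw [hpow2] at b1
  rw [hpow1] at b2
  have ha0 : 0 < a := hlam.trans_le ha.1
  rw [e]
  calc |moll n (m + 1) (s - σ) (t - σ) f y + a * moll (n + 2) m (s - σ) (t - σ) f y|
      ≤ |moll n (m + 1) (s - σ) (t - σ) f y| + a * |moll (n + 2) m (s - σ) (t - σ) f y| := by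
        refine (abs_add_le _ _).trans ?_
        rw [abs_mul a, abs_of_pos ha0]
    _ ≤ C₁ * (N * (c * ρ) ^ (κ - 2) * (c ^ 2)⁻¹) * (ρ ^ (n + 2 * m + 2))⁻¹
        + lam⁻¹ * (C₂ * (N * (c * ρ) ^ (κ - 2) * (c ^ 2)⁻¹) * (ρ ^ (n + 2 * m + 2))⁻¹) := by
        have := ha.2
        gcongr
    _ = (C₁ + lam⁻¹ * C₂) * (c ^ (κ - 2) * (c ^ 2)⁻¹) * N
          * (ρ ^ (κ - 2) * (ρ ^ (n + 2 * m + 2))⁻¹) := by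
        rw [Real.mul_rpow hc0.le hρ.le]
        ring
    _ = _ := by
        congr 1
        rw [← Real.rpow_natCast, ← Real.rpow_neg hρ.le, ← Real.rpow_add hρ]
        congr 1
        push_cast
        ring

/-- Crude bound on derivatives of the mollification through the oscillation of `u`. -/
theorem exists_abs_moll_le_of_pos {n m : ℕ} (h : 0 < n + m) {c₁ c₂ : ℝ} (hc₁ : 0 < c₁) :
    ∃ C : ℝ, 0 ≤ C ∧ ∀ (N : ℝ) (u : ℝ × ℝ → ℝ), Continuous u → (∀ z z', |u z - u z'| ≤ N) →
      ∀ ρ s t : ℝ, 0 < ρ → c₁ * ρ ^ 4 ≤ s → s ≤ c₂ * ρ ^ 4 → c₁ * ρ ^ 4 ≤ t →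
      t ≤ c₂ * ρ ^ 4 → ∀ y, |moll n m s t u y| ≤ C * N * (ρ ^ (n + 2 * m))⁻¹ := by
  obtain ⟨C, hC, hk⟩ := exists_integral_mul_kern_le n m (c₂ := c₂) hc₁
  refine ⟨C, hC, fun N u hu hN ρ s t hρ hs1 hs2 ht1 ht2 y => ?_⟩
  have hs : 0 < s := lt_of_lt_of_le (by positivity) hs1
  have ht : 0 < t := lt_of_lt_of_le (by positivity) ht1
  have hN0 : 0 ≤ N := (abs_nonneg _).trans (hN 0 0)
  have hb : ∀ z, |u z| ≤ |u y| + N := fun z => by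
    have h2 := abs_add_le (u z - u y) (u y)
    rw [sub_add_cancel] at h2
    linarith [hN z y]
  rw [moll_eq_sub hu hb h hs ht (u y) y]
  refine hk ρ s t hρ hs1 hs2 ht1 ht2 y y (by rw [d_self]; exact hρ.le) _ N hN0 fun z => ?_
  exact (hN z y).trans (le_mul_of_one_le_right hN0 (by nlinarith [sq_nonneg (d z y / ρ)]))

theorem rpow_fourth {w : ℝ} (hw : 0 ≤ w) (e : ℝ) : (w ^ (1 / 4 : ℝ)) ^ e = w ^ (e / 4) := by
  rw [← Real.rpow_mul hw]
  congr 1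
  ring

theorem rpow_fourth_pow {w : ℝ} (hw : 0 ≤ w) : (w ^ (1 / 4 : ℝ)) ^ 4 = w := by
  rw [← Real.rpow_natCast, ← Real.rpow_mul hw]
  norm_num

theorem pow_four_rpow {ρ : ℝ} (hρ : 0 ≤ ρ) (e : ℝ) : (ρ ^ 4) ^ (e / 4) = ρ ^ e := by
  rw [← Real.rpow_natCast, ← Real.rpow_mul hρ]
  congr 1
  push_cast
  ring

/-- Derivatives of parabolic order at least two of the mollification of `u` at scale `ρ` behave as if
`u` were of Hölder class `κ` at `x`: the bound on the adapted time derivative is integrated from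
scale `ρ` to scale one, where the oscillation bound takes over. -/
theorem exists_abs_moll_le (hlam : 0 < lam) (hκ : κ < 2) {n m : ℕ}
    (hnm : 2 ≤ n + 2 * m) {c₁ c₂ : ℝ} (hc₁ : 0 < c₁) :
    ∃ C : ℝ, 0 ≤ C ∧ ∀ (a N : ℝ) (x : ℝ × ℝ) (u : ℝ × ℝ → ℝ), a ∈ Set.Icc lam lam⁻¹ →
      LocalSplitting κ a N x u → ∀ ρ s t : ℝ, 0 < ρ → ρ ≤ 1 → c₁ * ρ ^ 4 ≤ s →
      s ≤ c₂ * ρ ^ 4 → c₁ * ρ ^ 4 ≤ t → t ≤ c₂ * ρ ^ 4 → ∀ y, d y x ≤ ρ →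
      |moll n m s t u y| ≤ C * N * ρ ^ (κ - (n + 2 * m : ℕ)) := by
  set b₁ : ℝ := min c₁ (min (lam ^ 2) 1) with hb₁
  have hb₁0 : 0 < b₁ := by positivity
  have hb₁c : b₁ ≤ c₁ := min_le_left _ _
  have hb₁l : b₁ ≤ lam ^ 2 := (min_le_right _ _).trans (min_le_left _ _)
  have hb₁1 : b₁ ≤ 1 := (min_le_right _ _).trans (min_le_right _ _)
  set b₂ : ℝ := |c₂| + (lam⁻¹ ^ 2 + 1) with hb₂
  have hc₂ := le_abs_self c₂
  have hb₂0 : 0 < b₂ := by positivity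
  obtain ⟨C, hC, h⟩ := exists_adapted_deriv_le (κ := κ) hlam n m (c₂ := b₂) hb₁0
  obtain ⟨C', hC', h'⟩ := exists_abs_moll_le_of_pos (n := n) (m := m) (by omega)
    (c₂ := b₂) hb₁0
  set j : ℝ := ((n + 2 * m : ℕ) : ℝ) with hj
  have hj2 : 2 ≤ j := by rw [hj]; exact_mod_cast hnm
  refine ⟨C' + 4 / (j - κ) * C, by have : 0 < j - κ := by linarith
                                   positivity,
    fun a N x u ha hu ρ s t hρ hρ1 hs1 hs2 ht1 ht2 y hy => ?_⟩
  have hN := hu.nonneg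
  have hb := hu.bounded
  have hjκ : 0 < j - κ := by linarith
  have hρ4 : 0 < ρ ^ 4 := by positivity
  have hρ41 : ρ ^ 4 ≤ 1 := pow_le_one₀ hρ.le hρ1
  have ha0 : 0 < a := hlam.trans_le ha.1
  have ha1 : lam ^ 2 ≤ a ^ 2 := by have := ha.1; gcongr
  have ha2 : a ^ 2 ≤ lam⁻¹ ^ 2 := by have := ha.2; gcongr
  have hs : 0 < s := lt_of_lt_of_le (by positivity) hs1
  have ht : 0 < t := lt_of_lt_of_le (by positivity) ht1
  have hlo : ∀ r, 0 ≤ r → b₁ * (ρ ^ 4 + r) ≤ s + a ^ 2 * r ∧ b₁ * (ρ ^ 4 + r) ≤ t + 1 * r := by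
    intro r hr
    rw [mul_add]
    exact ⟨add_le_add ((mul_le_mul_of_nonneg_right hb₁c hρ4.le).trans hs1)
      (mul_le_mul_of_nonneg_right (hb₁l.trans ha1) hr),
      add_le_add ((mul_le_mul_of_nonneg_right hb₁c hρ4.le).trans ht1)
      (mul_le_mul_of_nonneg_right hb₁1 hr)⟩
  have hl2 : 0 ≤ lam⁻¹ ^ 2 := sq_nonneg _
  have hcb : c₂ ≤ b₂ := by linarith
  have hab : a ^ 2 ≤ b₂ := by linarith [abs_nonneg c₂]
  have h1b : 1 ≤ b₂ := by linarith [abs_nonneg c₂]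
  have hcρ : c₂ * ρ ^ 4 ≤ |c₂| :=
    (mul_le_mul_of_nonneg_right hc₂ hρ4.le).trans (mul_le_of_le_one_right (abs_nonneg _) hρ41)
  have hhi : ∀ r, 0 ≤ r → s + a ^ 2 * r ≤ b₂ * (ρ ^ 4 + r) ∧ t + 1 * r ≤ b₂ * (ρ ^ 4 + r) := by
    intro r hr
    rw [mul_add]
    exact ⟨add_le_add (hs2.trans (mul_le_mul_of_nonneg_right hcb hρ4.le))
      (mul_le_mul_of_nonneg_right hab hr),
      add_le_add (ht2.trans (mul_le_mul_of_nonneg_right hcb hρ4.le))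
      (mul_le_mul_of_nonneg_right h1b hr)⟩
  have hmain := abs_sub_le_of_deriv_le (p := 0) (q := 1) zero_le_one
    (g := fun r => moll n m (s + a ^ 2 * r) (t + 1 * r) u y)
    (b := fun r => -(4 / (j - κ)) * (C * N) * (ρ ^ 4 + r) ^ ((κ - j) / 4))
    (b' := fun r => C * N * (ρ ^ 4 + r) ^ ((κ - j) / 4 - 1))
    (fun r hr => hasDerivAt_moll_time hu.continuous hb n m s t (a ^ 2) 1
      (by have := hr.1; positivity) (by have := hr.1; positivity) y)
    (fun r hr => by
      have hpos : 0 < ρ ^ 4 + r := by linarith [hr.1]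
      have h1 : HasDerivAt (fun r : ℝ => ρ ^ 4 + r) 1 r := (hasDerivAt_id r).const_add _
      refine ((h1.rpow_const (p := (κ - j) / 4) (Or.inl hpos.ne')).const_mul
        (-(4 / (j - κ)) * (C * N))).congr_deriv ?_
      field_simp
      ring)
    (fun r hr => by
      have hpos : 0 < ρ ^ 4 + r := by linarith [hr.1]
      have h4 := rpow_fourth_pow hpos.le
      have hR : 0 < (ρ ^ 4 + r) ^ (1 / 4 : ℝ) := by positivity
      have hρR : ρ ≤ (ρ ^ 4 + r) ^ (1 / 4 : ℝ) := by
        refine le_of_pow_le_pow_left₀ (n := 4) (by norm_num) hR.le ?_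
        rw [h4]
        linarith [hr.1]
      have := h a N x u ha hu ((ρ ^ 4 + r) ^ (1 / 4 : ℝ)) (s + a ^ 2 * r) (t + 1 * r) hR
        (by rw [h4]; linarith [hr.2]) (by rw [h4]; exact (hlo r hr.1).1)
        (by rw [h4]; exact (hhi r hr.1).1) (by rw [h4]; exact (hlo r hr.1).2)
        (by rw [h4]; exact (hhi r hr.1).2) y (hy.trans hρR)
      rw [rpow_fourth hpos.le] at this
      rw [show (κ - j) / 4 - 1 = (κ - 4 - j) / 4 by ring]
      simpa only [one_mul] using this)
  have hend := h' N u hu.continuous hu.osc_le 1 (s + a ^ 2 * 1) (t + 1 * 1) one_pos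
    (by linarith) (by linarith) (by linarith) (by linarith) y
  rw [one_pow, inv_one, mul_one (C' * N)] at hend
  simp only [mul_zero, add_zero] at hmain
  rw [pow_four_rpow hρ.le] at hmain
  have e : -(4 / (j - κ)) * (C * N) * (ρ ^ 4 + 1) ^ ((κ - j) / 4)
      - -(4 / (j - κ)) * (C * N) * ρ ^ (κ - j) = 4 / (j - κ) * (C * N) * ρ ^ (κ - j)
      - 4 / (j - κ) * (C * N) * (ρ ^ 4 + 1) ^ ((κ - j) / 4) := by ring
  rw [e] at hmain
  have h1 : 1 ≤ ρ ^ (κ - j) := Real.one_le_rpow_of_pos_of_le_one_of_nonpos hρ hρ1 (by linarith)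
  have h2 : 0 ≤ 4 / (j - κ) * (C * N) * (ρ ^ 4 + 1) ^ ((κ - j) / 4) := by positivity
  have h3 := abs_sub_abs_le_abs_sub (moll n m s t u y)
    (moll n m (s + a ^ 2 * 1) (t + 1 * 1) u y)
  rw [abs_sub_comm] at h3
  have h4 : C' * N ≤ C' * N * ρ ^ (κ - j) := le_mul_of_one_le_right (by positivity) h1
  calc |moll n m s t u y| ≤ C' * N + 4 / (j - κ) * (C * N) * ρ ^ (κ - j) := by
        have h5 := sub_le_iff_le_add.1 (h3.trans (hmain.trans (sub_le_self _ h2)))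
        exact (h5.trans (add_le_add le_rfl hend)).trans_eq (add_comm _ _)
    _ ≤ C' * N * ρ ^ (κ - j) + 4 / (j - κ) * (C * N) * ρ ^ (κ - j) := add_le_add h4 le_rfl
    _ = (C' + 4 / (j - κ) * C) * N * ρ ^ (κ - j) := by ring

end estimates

/-! ### Mollification error and slope at the base point -/

section basepoint

variable {lam κ : ℝ}

/-- Integration of a power-law bound on a derivative in `r = ρ⁴`. -/
theorem abs_sub_le_of_deriv_le_rpow {g g' : ℝ → ℝ} {K e : ℝ} (hK : 0 ≤ K) (he : 0 < e)
    (hg : ∀ r, 0 < r → r ≤ 1 → HasDerivAt g (g' r) r)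
    (hle : ∀ r, 0 < r → r ≤ 1 → |g' r| ≤ K * r ^ (e / 4 - 1)) {R ρ : ℝ} (hR : 0 < R) (hRρ : R ≤ ρ)
    (hρ : ρ ≤ 1) : |g (ρ ^ 4) - g (R ^ 4)| ≤ 4 / e * K * ρ ^ e := by
  have hρ0 : 0 < ρ := hR.trans_le hRρ
  have hR4 : 0 < R ^ 4 := by positivity
  have hρ4 : ρ ^ 4 ≤ 1 := pow_le_one₀ hρ0.le hρ
  have h := abs_sub_le_of_deriv_le (p := R ^ 4) (q := ρ ^ 4) (by gcongr) (g := g) (g' := g')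
    (b := fun r => 4 / e * K * r ^ (e / 4)) (b' := fun r => K * r ^ (e / 4 - 1))
    (fun r hr => hg r (hR4.trans_le hr.1) (hr.2.trans hρ4))
    (fun r hr => by
      have hpos : 0 < r := hR4.trans_le hr.1
      refine ((Real.hasDerivAt_rpow_const (p := e / 4) (Or.inl hpos.ne')).const_mul
        (4 / e * K)).congr_deriv ?_
      field_simp)
    (fun r hr => hle r (hR4.trans_le hr.1) (hr.2.trans hρ4))
  simp only [pow_four_rpow hρ0.le, pow_four_rpow hR.le] at h
  exact h.trans (sub_le_self _ (by positivity))

theorem exists_limit_of_abs_sub_le {h : ℝ → ℝ} {K e : ℝ} (he : 0 < e)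
    (hh : ∀ R ρ, 0 < R → R ≤ ρ → ρ ≤ 1 → |h ρ - h R| ≤ K * ρ ^ e) :
    ∃ ν, ∀ ρ, 0 < ρ → ρ ≤ 1 → |h ρ - ν| ≤ K * ρ ^ e := by
  have hpos : ∀ n : ℕ, (0 : ℝ) < 1 / ((n : ℝ) + 1) := fun n => by positivity
  have hone : ∀ n : ℕ, 1 / ((n : ℝ) + 1) ≤ 1 := fun n => by
    rw [div_le_one (by positivity)]
    linarith [(Nat.cast_nonneg n : (0 : ℝ) ≤ n)]
  have hK : 0 ≤ K := by simpa using hh 1 1 one_pos le_rfl le_rfl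
  have hz := tendsto_one_div_add_atTop_nhds_zero_nat (𝕜 := ℝ)
  have hb : Filter.Tendsto (fun n : ℕ => K * (1 / ((n : ℝ) + 1)) ^ e) Filter.atTop (nhds 0) := by
    simpa [Real.zero_rpow he.ne'] using
      (hz.rpow_const (p := e) (Or.inr he.le)).const_mul K
  have hmono : ∀ {n m : ℕ}, n ≤ m → 1 / ((m : ℝ) + 1) ≤ 1 / ((n : ℝ) + 1) := fun h => by
    gcongr
  have hc : CauchySeq fun n : ℕ => h (1 / ((n : ℝ) + 1)) := by
    have hle : ∀ n m N : ℕ, N ≤ n → n ≤ m →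
        |h (1 / ((n : ℝ) + 1)) - h (1 / ((m : ℝ) + 1))| ≤ K * (1 / ((N : ℝ) + 1)) ^ e := by
      intro n m N hN hnm
      refine (hh _ _ (hpos m) (hmono hnm) (hone n)).trans ?_
      have := hmono hN
      have := hpos n
      gcongr
    refine cauchySeq_of_le_tendsto_0 (fun n : ℕ => K * (1 / ((n : ℝ) + 1)) ^ e)
      (fun n m N hn hm => ?_) hb
    rw [Real.dist_eq]
    rcases le_total n m with hnm | hnm
    · exact hle n m N hn hnm
    · rw [abs_sub_comm]
      exact hle m n N hm hnm
  obtain ⟨ν, hν⟩ := cauchySeq_tendsto_of_complete hc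
  refine ⟨ν, fun ρ hρ hρ1 => le_of_tendsto (hν.const_sub (h ρ)).abs ?_⟩
  filter_upwards [hz.eventually (gt_mem_nhds hρ)] with n hn
  exact hh _ _ (hpos n) hn.le hρ1

/-- The adapted mollifications recover `u` as the scale tends to zero. -/
theorem tendsto_moll_adapted {u : ℝ × ℝ → ℝ} {N : ℝ} (hu : Continuous u)
    (hN : ∀ z z', |u z - u z'| ≤ N) {a : ℝ} (ha : 0 < a) (x : ℝ × ℝ) :
    Filter.Tendsto (fun R : ℝ => moll 0 0 (a ^ 2 * R ^ 4) (R ^ 4) u x) (nhdsWithin 0 (Set.Ioi 0))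
      (nhds (u x)) := by
  have hN0 : 0 ≤ N := (abs_nonneg _).trans (hN 0 0)
  obtain ⟨C, hC, h⟩ := exists_integral_mul_kern_le 0 0 (c₁ := min (a ^ 2) 1) (c₂ := max (a ^ 2) 1)
    (by positivity)
  rw [Metric.tendsto_nhds]
  intro ε hε
  set η := ε / (2 * (C + 1)) with hη
  have hη0 : 0 < η := by positivity
  have hCη : C * η < ε := by
    rw [hη, mul_div_assoc', div_lt_iff₀ (by positivity)]
    nlinarith
  obtain ⟨δ₀, hδ₀, hc⟩ := Metric.continuousAt_iff.1 (hu.continuousAt (x := x)) η hη0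
  set δ := min δ₀ 1 with hδ
  have hδ0 : 0 < δ := by positivity
  have hsmall : ∀ z, d z x < δ → |u z - u x| < η := by
    intro z hz
    rw [← Real.dist_eq]
    refine hc ?_
    have h1 : δ ≤ δ₀ := min_le_left _ _
    have h2 : δ ≤ 1 := min_le_right _ _
    rw [Prod.dist_eq, max_lt_iff, Real.dist_eq, Real.dist_eq]
    constructor
    · linarith [abs_fst_le_d z x]
    · have := abs_snd_le_d_sq z x
      nlinarith [d_nonneg z x]
  have hlim : Filter.Tendsto (fun R : ℝ => C * (η + N / δ ^ 2 * R ^ 2)) (nhdsWithin 0 (Set.Ioi 0))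
      (nhds (C * η)) := by
    have : Continuous fun R : ℝ => C * (η + N / δ ^ 2 * R ^ 2) := by fun_prop
    have := this.tendsto 0
    simp only [ne_eq, OfNat.ofNat_ne_zero, not_false_eq_true, zero_pow, mul_zero, add_zero] at this
    exact this.mono_left nhdsWithin_le_nhds
  filter_upwards [hlim.eventually (gt_mem_nhds hCη), self_mem_nhdsWithin] with R hR hR0
  have hR0 : 0 < R := hR0
  have hR4 : 0 < R ^ 4 := by positivity
  have hb : ∀ z, |u z| ≤ |u x| + N := fun z => by
    have h2 := abs_add_le (u z - u x) (u x)
    rw [sub_add_cancel] at h2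
    linarith [hN z x]
  rw [Real.dist_eq, moll_zero_sub hu hb (by positivity) hR4]
  refine lt_of_le_of_lt ?_ hR
  have := h R (a ^ 2 * R ^ 4) (R ^ 4) hR0
    (mul_le_mul_of_nonneg_right (min_le_left _ _) hR4.le)
    (mul_le_mul_of_nonneg_right (le_max_left _ _) hR4.le)
    (mul_le_of_le_one_left hR4.le (min_le_right _ _))
    (le_mul_of_one_le_left hR4.le (le_max_right _ _))
    x x (by rw [d_self]; exact hR0.le) (fun z => u z - u x) (η + N / δ ^ 2 * R ^ 2) (by positivity)
    (fun z => by
      have e : (η + N / δ ^ 2 * R ^ 2) * (1 + (d z x / R) ^ 2)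
          = η + N / δ ^ 2 * R ^ 2 + η * (d z x / R) ^ 2 + N * (d z x ^ 2 / δ ^ 2) := by
        field_simp
        ring
      rw [e]
      have p1 : 0 ≤ N / δ ^ 2 * R ^ 2 := by positivity
      have p2 : 0 ≤ η * (d z x / R) ^ 2 := by positivity
      rcases lt_or_ge (d z x) δ with hlt | hge
      · have p3 : 0 ≤ N * (d z x ^ 2 / δ ^ 2) := by positivity
        linarith [hsmall z hlt]
      · have h1 : 1 ≤ d z x ^ 2 / δ ^ 2 := by
          rw [one_le_div (by positivity)]
          gcongr
        have := hN z x
        nlinarith)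
  simpa using this

/-- The mollification with the original kernel is `ρ ^ κ`-close to `u` at the base point. -/
theorem exists_abs_moll_sub_le (hlam : 0 < lam) (hκ0 : 0 < κ) (hκ : κ < 2) :
    ∃ C : ℝ, 0 ≤ C ∧ ∀ (a N : ℝ) (x : ℝ × ℝ) (u : ℝ × ℝ → ℝ), a ∈ Set.Icc lam lam⁻¹ →
      LocalSplitting κ a N x u → ∀ ρ : ℝ, 0 < ρ → ρ ≤ 1 →
      |moll 0 0 (ρ ^ 4) (ρ ^ 4) u x - u x| ≤ C * N * ρ ^ κ := by
  set c₁ : ℝ := min (lam ^ 2) 1 with hc₁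
  set c₂ : ℝ := lam⁻¹ ^ 2 + 1 with hc₂
  have hc₁0 : 0 < c₁ := by positivity
  have hl2 : 0 ≤ lam⁻¹ ^ 2 := sq_nonneg _
  have hc₁l : c₁ ≤ lam ^ 2 := min_le_left _ _
  have hc₁1 : c₁ ≤ 1 := min_le_right _ _
  obtain ⟨C₁, hC₁, h₁⟩ := exists_adapted_deriv_le (κ := κ) hlam 0 0 (c₂ := c₂) hc₁0
  obtain ⟨C₂, hC₂, h₂⟩ := exists_abs_moll_le hlam hκ (n := 4) (m := 0) (by norm_num) (c₂ := c₂) hc₁0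
  refine ⟨4 / κ * C₁ + c₂ * C₂, by positivity, fun a N x u ha hu ρ hρ hρ1 => ?_⟩
  have hN := hu.nonneg
  have hb := hu.bounded
  have ha0 : 0 < a := hlam.trans_le ha.1
  have ha1 : lam ^ 2 ≤ a ^ 2 := by have := ha.1; gcongr
  have ha2 : a ^ 2 ≤ lam⁻¹ ^ 2 := by have := ha.2; gcongr
  have hρ4 : 0 < ρ ^ 4 := by positivity
  -- from scale zero to scale `ρ` along the adapted semigroup
  have hA : |moll 0 0 (a ^ 2 * ρ ^ 4) (ρ ^ 4) u x - u x| ≤ 4 / κ * (C₁ * N) * ρ ^ κ := by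
    refine le_of_tendsto ((tendsto_moll_adapted hu.continuous hu.osc_le ha0 x).const_sub _).abs ?_
    filter_upwards [Ioc_mem_nhdsGT hρ] with R hR
    have := abs_sub_le_of_deriv_le_rpow (K := C₁ * N) (e := κ) (R := R) (ρ := ρ) (by positivity) hκ0
      (g := fun r => moll 0 0 (0 + a ^ 2 * r) (0 + 1 * r) u x)
      (fun r hr _ => hasDerivAt_moll_time hu.continuous hb 0 0 0 0 (a ^ 2) 1
        (by positivity) (by positivity) x)
      (fun r hr hr1 => by
        have h4 := rpow_fourth_pow hr.le
        have := h₁ a N x u ha hu (r ^ (1 / 4 : ℝ)) (a ^ 2 * r) r (by positivity)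
          (by rw [h4]; linarith)
          (by rw [h4]; exact mul_le_mul_of_nonneg_right (hc₁l.trans ha1) hr.le)
          (by rw [h4]; exact mul_le_mul_of_nonneg_right (by linarith) hr.le)
          (by rw [h4]; exact mul_le_of_le_one_left hr.le hc₁1)
          (by rw [h4]; exact le_mul_of_one_le_left hr.le (by linarith))
          x (by rw [d_self]; positivity)
        rw [rpow_fourth hr.le] at this
        simp only [zero_add, one_mul]
        rw [show κ / 4 - 1 = (κ - 4 - (0 + 2 * 0 : ℕ)) / 4 by push_cast; ring]
        exact this) hR.1 hR.2 hρ1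
    simpa only [zero_add, one_mul] using this
  -- exchange of the adapted kernel for the given one at fixed scale
  have hB : |moll 0 0 (a ^ 2 * ρ ^ 4) (ρ ^ 4) u x - moll 0 0 (ρ ^ 4) (ρ ^ 4) u x|
      ≤ c₂ * (C₂ * N) * ρ ^ κ := by
    have hs : ∀ r ∈ Set.Icc (0 : ℝ) 1, c₁ * ρ ^ 4 ≤ ρ ^ 4 + (a ^ 2 - 1) * ρ ^ 4 * r
        ∧ ρ ^ 4 + (a ^ 2 - 1) * ρ ^ 4 * r ≤ c₂ * ρ ^ 4 := by
      intro r hr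
      have e : ρ ^ 4 + (a ^ 2 - 1) * ρ ^ 4 * r = ((1 - r) + a ^ 2 * r) * ρ ^ 4 := by ring
      rw [e]
      have h0 := hr.1
      have h1 := hr.2
      constructor
      · refine mul_le_mul_of_nonneg_right ?_ hρ4.le
        nlinarith
      · refine mul_le_mul_of_nonneg_right ?_ hρ4.le
        nlinarith
    have h := abs_sub_le_of_deriv_le (p := 0) (q := 1) zero_le_one
      (g := fun r => moll 0 0 (ρ ^ 4 + (a ^ 2 - 1) * ρ ^ 4 * r) (ρ ^ 4 + 0 * r) u x)
      (b := fun r => c₂ * (C₂ * N) * ρ ^ κ * r) (b' := fun _ => c₂ * (C₂ * N) * ρ ^ κ)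
      (fun r hr => hasDerivAt_moll_time hu.continuous hb 0 0 _ _ _ 0
        (lt_of_lt_of_le (by positivity) (hs r hr).1) (by linarith) x)
      (fun r _ => by simpa using (hasDerivAt_id r).const_mul (c₂ * (C₂ * N) * ρ ^ κ))
      (fun r hr => by
        have := h₂ a N x u ha hu ρ _ (ρ ^ 4) hρ hρ1 (hs r hr).1 (hs r hr).2
          (mul_le_of_le_one_left hρ4.le hc₁1) (le_mul_of_one_le_left hρ4.le (by linarith))
          x (by rw [d_self]; exact hρ.le)
        simp only [zero_mul, add_zero]
        have hac : |-((a ^ 2 - 1) * ρ ^ 4)| ≤ c₂ * ρ ^ 4 := by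
          rw [abs_neg, abs_mul, abs_of_pos hρ4]
          refine mul_le_mul_of_nonneg_right ?_ hρ4.le
          rw [abs_le]
          constructor <;> nlinarith
        rw [abs_mul]
        calc |-((a ^ 2 - 1) * ρ ^ 4)| * |moll 4 0 (ρ ^ 4 + (a ^ 2 - 1) * ρ ^ 4 * r) (ρ ^ 4) u x|
            ≤ (c₂ * ρ ^ 4) * (C₂ * N * ρ ^ (κ - (4 + 2 * 0 : ℕ))) :=
              mul_le_mul hac this (abs_nonneg _) (by positivity)
          _ = c₂ * (C₂ * N) * (ρ ^ κ) := by
              rw [Real.rpow_sub hρ, Real.rpow_natCast]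
              field_simp
              ring)
    simp only [mul_zero, add_zero, mul_one, sub_zero] at h
    rwa [show ρ ^ 4 + (a ^ 2 - 1) * ρ ^ 4 = a ^ 2 * ρ ^ 4 by ring] at h
  rw [abs_sub_comm] at hB
  calc |moll 0 0 (ρ ^ 4) (ρ ^ 4) u x - u x|
      ≤ |moll 0 0 (ρ ^ 4) (ρ ^ 4) u x - moll 0 0 (a ^ 2 * ρ ^ 4) (ρ ^ 4) u x|
        + |moll 0 0 (a ^ 2 * ρ ^ 4) (ρ ^ 4) u x - u x| := abs_sub_le _ _ _
    _ ≤ c₂ * (C₂ * N) * ρ ^ κ + 4 / κ * (C₁ * N) * ρ ^ κ := add_le_add hB hA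
    _ = (4 / κ * C₁ + c₂ * C₂) * N * ρ ^ κ := by ring

theorem d_segment_le (x y : ℝ × ℝ) {r : ℝ} (h0 : 0 ≤ r) (h1 : r ≤ 1) :
    d (x + r • (y - x)) x ≤ d y x := by
  unfold d
  simp only [Prod.fst_add, Prod.snd_add, Prod.smul_fst, Prod.smul_snd, Prod.fst_sub, Prod.snd_sub,
    smul_eq_mul, add_sub_cancel_left, abs_mul, abs_of_nonneg h0]
  gcongr
  · exact mul_le_of_le_one_left (abs_nonneg _) h1
  · exact mul_le_of_le_one_left (abs_nonneg _) h1

/-- First order Taylor expansion of the mollification at scale `ρ` on the ball of radius `ρ`. -/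
theorem exists_taylor_moll (hlam : 0 < lam) (hκ : κ < 2) :
    ∃ C : ℝ, 0 ≤ C ∧ ∀ (a N : ℝ) (x : ℝ × ℝ) (u : ℝ × ℝ → ℝ), a ∈ Set.Icc lam lam⁻¹ →
      LocalSplitting κ a N x u → ∀ ρ : ℝ, 0 < ρ → ρ ≤ 1 → ∀ y, d y x ≤ ρ →
      |moll 0 0 (ρ ^ 4) (ρ ^ 4) u y - moll 0 0 (ρ ^ 4) (ρ ^ 4) u x
        - moll 1 0 (ρ ^ 4) (ρ ^ 4) u x * (y - x).1| ≤ C * N * ρ ^ κ := by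
  obtain ⟨C₁, hC₁, h₁⟩ := exists_abs_moll_le hlam hκ (n := 0) (m := 1) (by norm_num) (c₂ := 1) one_pos
  obtain ⟨C₂, hC₂, h₂⟩ := exists_abs_moll_le hlam hκ (n := 2) (m := 0) (by norm_num) (c₂ := 1) one_pos
  obtain ⟨C₃, hC₃, h₃⟩ := exists_abs_moll_le hlam hκ (n := 1) (m := 1) (by norm_num) (c₂ := 1) one_pos
  refine ⟨C₁ + (C₂ + C₃), by positivity, fun a N x u ha hu ρ hρ hρ1 y hy => ?_⟩
  have hN := hu.nonneg
  have hb := hu.bounded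
  have hρ4 : 0 < ρ ^ 4 := by positivity
  set v := y - x with hv
  have hv1 : |v.1| ≤ ρ := (abs_fst_le_d y x).trans hy
  have hv2 : |v.2| ≤ ρ ^ 2 := (abs_snd_le_d_sq y x).trans (by
    have := d_nonneg y x
    gcongr)
  have hpow : ∀ k : ℕ, ρ ^ k * ρ ^ (κ - (k : ℕ)) = ρ ^ κ := fun k => by
    rw [Real.rpow_sub hρ, Real.rpow_natCast]
    field_simp
  have hseg : ∀ r : ℝ, 0 ≤ r → r ≤ 1 → d (x + r • v) x ≤ ρ := fun r h0 h1 => by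
    rw [hv]
    exact (d_segment_le x y h0 h1).trans hy
  have hlin : ∀ K r : ℝ, HasDerivAt (fun r => K * r) K r := fun K r => by
    simpa using (hasDerivAt_id r).const_mul K
  have hinner : ∀ r ∈ Set.Icc (0 : ℝ) 1,
      |v.1| * |moll 1 0 (ρ ^ 4) (ρ ^ 4) u (x + r • v) - moll 1 0 (ρ ^ 4) (ρ ^ 4) u x|
        ≤ (C₂ + C₃) * N * ρ ^ κ := by
    intro r hr
    have h := abs_sub_le_of_deriv_le (p := 0) (q := r) hr.1
      (g := fun r => v.1 * moll 1 0 (ρ ^ 4) (ρ ^ 4) u (x + r • v))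
      (b := fun r => (C₂ + C₃) * N * ρ ^ κ * r) (b' := fun _ => (C₂ + C₃) * N * ρ ^ κ)
      (fun p _ => (hasDerivAt_moll_line hu.continuous hb 1 0 hρ4 hρ4 x v p).const_mul v.1)
      (fun p _ => hlin _ p)
      (fun p hp => by
        have hd := hseg p hp.1 (hp.2.trans hr.2)
        have e2 := h₂ a N x u ha hu ρ (ρ ^ 4) (ρ ^ 4) hρ hρ1 (by linarith) (by linarith) (by linarith)
          (by linarith) _ hd
        have e3 := h₃ a N x u ha hu ρ (ρ ^ 4) (ρ ^ 4) hρ hρ1 (by linarith) (by linarith) (by linarith)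
          (by linarith) _ hd
        rw [mul_add]
        refine (abs_add_le _ _).trans ?_
        rw [abs_mul, abs_mul, abs_mul, abs_mul]
        calc |v.1| * (|v.1| * |moll (1 + 1) 0 (ρ ^ 4) (ρ ^ 4) u (x + p • v)|)
            + |v.1| * (|v.2| * |moll 1 (0 + 1) (ρ ^ 4) (ρ ^ 4) u (x + p • v)|)
            ≤ ρ * (ρ * (C₂ * N * ρ ^ (κ - (2 + 2 * 0 : ℕ))))
              + ρ * (ρ ^ 2 * (C₃ * N * ρ ^ (κ - (1 + 2 * 1 : ℕ)))) := by gcongr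
          _ = C₂ * N * (ρ ^ 2 * ρ ^ (κ - (2 : ℕ))) + C₃ * N * (ρ ^ 3 * ρ ^ (κ - (3 : ℕ))) := by
              norm_num only
              ring
          _ = (C₂ + C₃) * N * ρ ^ κ := by
              rw [hpow, hpow]
              ring)
    simp only [zero_smul, add_zero, mul_zero, sub_zero] at h
    rw [← mul_sub, abs_mul] at h
    refine h.trans (mul_le_of_le_one_right (by positivity) hr.2)
  have h := abs_sub_le_of_deriv_le (p := 0) (q := 1) zero_le_one
    (g := fun r => moll 0 0 (ρ ^ 4) (ρ ^ 4) u (x + r • v)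
      - moll 1 0 (ρ ^ 4) (ρ ^ 4) u x * v.1 * r)
    (b := fun r => (C₁ + (C₂ + C₃)) * N * ρ ^ κ * r) (b' := fun _ => (C₁ + (C₂ + C₃)) * N * ρ ^ κ)
    (fun p _ => (hasDerivAt_moll_line hu.continuous hb 0 0 hρ4 hρ4 x v p).sub (hlin _ p))
    (fun p _ => hlin _ p)
    (fun p hp => by
      have e1 := h₁ a N x u ha hu ρ (ρ ^ 4) (ρ ^ 4) hρ hρ1 (by linarith) (by linarith) (by linarith)
          (by linarith) _ (hseg p hp.1 hp.2)
      have e : v.1 * moll (0 + 1) 0 (ρ ^ 4) (ρ ^ 4) u (x + p • v)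
          + v.2 * moll 0 (0 + 1) (ρ ^ 4) (ρ ^ 4) u (x + p • v)
          - moll 1 0 (ρ ^ 4) (ρ ^ 4) u x * v.1
          = v.2 * moll 0 1 (ρ ^ 4) (ρ ^ 4) u (x + p • v) + v.1 *
            (moll 1 0 (ρ ^ 4) (ρ ^ 4) u (x + p • v) - moll 1 0 (ρ ^ 4) (ρ ^ 4) u x) := by
        simp only [zero_add]
        ring
      rw [e]
      refine (abs_add_le _ _).trans ?_
      rw [abs_mul, abs_mul]
      have e4 := hinner p hp
      calc |v.2| * |moll 0 1 (ρ ^ 4) (ρ ^ 4) u (x + p • v)| + |v.1| *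
            |moll 1 0 (ρ ^ 4) (ρ ^ 4) u (x + p • v) - moll 1 0 (ρ ^ 4) (ρ ^ 4) u x|
          ≤ ρ ^ 2 * (C₁ * N * ρ ^ (κ - (0 + 2 * 1 : ℕ))) + (C₂ + C₃) * N * ρ ^ κ := by gcongr
        _ = C₁ * N * (ρ ^ 2 * ρ ^ (κ - (2 : ℕ))) + (C₂ + C₃) * N * ρ ^ κ := by
            norm_num only
            ring
        _ = (C₁ + (C₂ + C₃)) * N * ρ ^ κ := by
            rw [hpow]
            ring)
  simp only [zero_smul, one_smul, add_zero, mul_zero, sub_zero, mul_one] at h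
  rw [hv, add_sub_cancel, ← hv] at h
  rwa [sub_right_comm] at h

/-- Existence of the generalized derivative `ν` in direction `x₁`, the limit of the derivatives of the
mollifications at vanishing scale, and the expansion of the mollifications around
the base point with this scale-independent coefficient. -/
theorem exists_slope (hlam : 0 < lam) (hκ1 : 1 < κ) (hκ : κ < 2) :
    ∃ C : ℝ, 0 ≤ C ∧ ∀ (a N : ℝ) (x : ℝ × ℝ) (u : ℝ × ℝ → ℝ), a ∈ Set.Icc lam lam⁻¹ →
      LocalSplitting κ a N x u → ∃ ν : ℝ, |ν| ≤ C * N ∧ ∀ ρ : ℝ, 0 < ρ → ρ ≤ 1 → ∀ y, d y x ≤ ρ →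
      |moll 0 0 (ρ ^ 4) (ρ ^ 4) u y - moll 0 0 (ρ ^ 4) (ρ ^ 4) u x - ν * (y - x).1|
        ≤ C * N * ρ ^ κ := by
  obtain ⟨C₀, hC₀, h₀⟩ := exists_taylor_moll hlam hκ
  obtain ⟨C₁, hC₁, h₁⟩ := exists_abs_moll_le_of_pos (n := 1) (m := 0) (by norm_num) (c₂ := 1) one_pos
  obtain ⟨C₂, hC₂, h₂⟩ := exists_abs_moll_le hlam hκ (n := 5) (m := 0) (by norm_num) (c₂ := 1) one_pos
  obtain ⟨C₃, hC₃, h₃⟩ := exists_abs_moll_le hlam hκ (n := 1) (m := 2) (by norm_num) (c₂ := 1) one_pos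
  have hκ10 : 0 < κ - 1 := by linarith
  refine ⟨C₀ + C₁ + 4 / (κ - 1) * (C₂ + C₃), by positivity, fun a N x u ha hu => ?_⟩
  have hN := hu.nonneg
  have hb := hu.bounded
  obtain ⟨ν, hν⟩ := exists_limit_of_abs_sub_le (h := fun ρ => moll 1 0 (ρ ^ 4) (ρ ^ 4) u x) hκ10
    (K := 4 / (κ - 1) * ((C₂ + C₃) * N)) (fun R ρ hR hRρ hρ1 => by
      have := abs_sub_le_of_deriv_le_rpow (K := (C₂ + C₃) * N) (e := κ - 1) (by positivity) hκ10
        (g := fun r => moll 1 0 (0 + 1 * r) (0 + 1 * r) u x)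
        (fun r hr _ => hasDerivAt_moll_time hu.continuous hb 1 0 0 0 1 1
          (by positivity) (by positivity) x)
        (fun r hr hr1 => by
          have h4 := rpow_fourth_pow hr.le
          have hR1 : r ^ (1 / 4 : ℝ) ≤ 1 := Real.rpow_le_one hr.le hr1 (by norm_num)
          have e2 := h₂ a N x u ha hu (r ^ (1 / 4 : ℝ)) r r (by positivity) hR1
            (by linarith) (by linarith) (by linarith) (by linarith) x (by rw [d_self]; positivity)
          have e3 := h₃ a N x u ha hu (r ^ (1 / 4 : ℝ)) r r (by positivity) hR1
            (by linarith) (by linarith) (by linarith) (by linarith) x (by rw [d_self]; positivity)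
          rw [rpow_fourth hr.le] at e2 e3
          simp only [zero_add, one_mul]
          rw [show (κ - 1) / 4 - 1 = (κ - 5) / 4 by ring]
          refine (abs_add_le _ _).trans ?_
          rw [neg_one_mul, abs_neg, add_mul, add_mul]
          norm_num at e2 e3 ⊢
          exact add_le_add e2 e3) hR hRρ hρ1
      simpa only [zero_add, one_mul] using this)
  refine ⟨ν, ?_, fun ρ hρ hρ1 y hy => ?_⟩
  · have e1 := hν 1 one_pos le_rfl
    have e2 := h₁ N u hu.continuous hu.osc_le 1 1 1 one_pos (by norm_num) (by norm_num)
      (by norm_num) (by norm_num) x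
    simp only [one_pow, Real.one_rpow, mul_one, inv_one] at e1 e2
    have e3 := abs_sub_abs_le_abs_sub ν (moll 1 0 1 1 u x)
    rw [abs_sub_comm] at e3
    have e4 : 0 ≤ C₀ * N := by positivity
    linarith
  · have e1 := hν ρ hρ hρ1
    have e2 := h₀ a N x u ha hu ρ hρ hρ1 y hy
    have e3 : |(y - x).1| ≤ ρ := (abs_fst_le_d y x).trans hy
    have e5 : ρ ^ (κ - 1) * ρ = ρ ^ κ := by
      rw [Real.rpow_sub hρ, Real.rpow_one]
      field_simp
    calc |moll 0 0 (ρ ^ 4) (ρ ^ 4) u y - moll 0 0 (ρ ^ 4) (ρ ^ 4) u x - ν * (y - x).1|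
        = |(moll 0 0 (ρ ^ 4) (ρ ^ 4) u y - moll 0 0 (ρ ^ 4) (ρ ^ 4) u x
            - moll 1 0 (ρ ^ 4) (ρ ^ 4) u x * (y - x).1)
            + (moll 1 0 (ρ ^ 4) (ρ ^ 4) u x - ν) * (y - x).1| := by congr 1; ring
      _ ≤ C₀ * N * ρ ^ κ + (4 / (κ - 1) * ((C₂ + C₃) * N) * ρ ^ (κ - 1)) * ρ := by
          refine (abs_add_le _ _).trans (add_le_add e2 ?_)
          rw [abs_mul]
          gcongr
      _ = C₀ * N * ρ ^ κ + 4 / (κ - 1) * ((C₂ + C₃) * N) * (ρ ^ (κ - 1) * ρ) := by ring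
      _ = (C₀ + 0 + 4 / (κ - 1) * (C₂ + C₃)) * N * ρ ^ κ := by rw [e5]; ring
      _ ≤ (C₀ + C₁ + 4 / (κ - 1) * (C₂ + C₃)) * N * ρ ^ κ := by gcongr

end basepoint

/-! ### Oscillation of periodic functions -/

theorem IsPeriodic.add_int {u : ℝ × ℝ → ℝ} (hu : IsPeriodic u) (z : ℝ × ℝ) (k l : ℤ) :
    u (z.1 + k, z.2 + l) = u z := by
  have h1 : ∀ c, Function.Periodic (fun r => u (r, c)) 1 := fun c r => by
    simpa using (hu (r, c)).1
  have h2 : ∀ c, Function.Periodic (fun r => u (c, r)) 1 := fun c r => by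
    simpa using (hu (c, r)).2
  have e1 := (h1 (z.2 + l)).int_mul k z.1
  have e2 := (h2 z.1).int_mul l z.2
  simp only [mul_one] at e1 e2
  rw [e1, e2]

/-- A representative of `z` modulo the period lattice in the closed unit cell at `x`. -/
theorem exists_int_shift (x z : ℝ × ℝ) : ∃ k l : ℤ,
    z.1 + k ∈ Set.Icc x.1 (x.1 + 1) ∧ z.2 + l ∈ Set.Icc x.2 (x.2 + 1) := by
  refine ⟨-⌊z.1 - x.1⌋, -⌊z.2 - x.2⌋, ?_, ?_⟩
  · have h1 := Int.floor_le (z.1 - x.1)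
    have h2 := Int.lt_floor_add_one (z.1 - x.1)
    push_cast
    constructor <;> linarith
  · have h1 := Int.floor_le (z.2 - x.2)
    have h2 := Int.lt_floor_add_one (z.2 - x.2)
    push_cast
    constructor <;> linarith

theorem second_deriv_nonpos_of_isLocalMax {f f' : ℝ → ℝ} {x f'' : ℝ}
    (h1 : ∀ r, HasDerivAt f (f' r) r) (h2 : HasDerivAt f' f'' x) (hm : IsLocalMax f x) :
    f'' ≤ 0 := by
  by_contra! hpos
  have e1 : deriv f = f' := funext fun r => (h1 r).deriv
  have hmin := isLocalMin_of_deriv_deriv_pos (f := f) (x₀ := x) (by rwa [e1, h2.deriv])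
    hm.deriv_eq_zero (h1 x).continuousAt
  have hc : f =ᶠ[nhds x] fun _ => f x := by
    filter_upwards [hm, hmin] with r hr1 hr2
    exact le_antisymm hr1 hr2
  have h3 := hc.deriv.deriv_eq
  rw [e1, h2.deriv] at h3
  simp at h3
  linarith

section torus

variable {lam m : ℝ} {u u₁ u₁₁ u₂ : ℝ × ℝ → ℝ} {x₀ : ℝ × ℝ}

/-- Two-point maximum principle in the first variable: at a positive maximum of
`u (y + h e₁) - u y - N h (1 - h)` the values of `(∂₂ - a ∂₁²) u` at the two points, for the *same*
coefficient `a`, would differ by at least `8 a N`. -/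
theorem fst_increment_le (hlam : 0 < lam) (hu : IsPeriodic u) (huc : Continuous u)
    (h1 : ∀ w c, HasDerivAt (fun r => u (r, c)) (u₁ (w, c)) w)
    (h11 : ∀ w c, HasDerivAt (fun r => u₁ (r, c)) (u₁₁ (w, c)) w)
    (h2 : ∀ c w, HasDerivAt (fun r => u (c, r)) (u₂ (c, w)) w)
    (H : ∀ x : ℝ × ℝ, |x.1 - x₀.1| ≤ 1 → |x.2 - x₀.2| ≤ 1 → ∃ a, lam ≤ a ∧ ∀ p q, d p x < 1 →
      d q x < 1 → |(u₂ p - a * u₁₁ p) - (u₂ q - a * u₁₁ q)| ≤ m) {N : ℝ} (hN : 0 < N)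
    (hm : m < 8 * lam * N) (y : ℝ × ℝ) {h : ℝ} (h0 : 0 ≤ h) (hle : h ≤ 1) :
    u (y.1 + h, y.2) - u y ≤ N * h * (1 - h) := by
  set D : (ℝ × ℝ) × ℝ → ℝ := fun p => u (p.1.1 + p.2, p.1.2) - u p.1 - N * p.2 * (1 - p.2) with hD
  have hDc : Continuous D := by fun_prop
  set K : Set ((ℝ × ℝ) × ℝ) :=
    (Set.Icc x₀.1 (x₀.1 + 1) ×ˢ Set.Icc x₀.2 (x₀.2 + 1)) ×ˢ Set.Icc 0 1 with hK
  have hKc : IsCompact K := (isCompact_Icc.prod isCompact_Icc).prod isCompact_Icc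
  have hKn : K.Nonempty := ⟨((x₀.1, x₀.2), 0), ⟨⟨Set.left_mem_Icc.2 (by linarith),
    Set.left_mem_Icc.2 (by linarith)⟩, Set.left_mem_Icc.2 zero_le_one⟩⟩
  obtain ⟨⟨q, k⟩, hqK, hmax⟩ := hKc.exists_isMaxOn hKn hDc.continuousOn
  have hq1 : q.1 ∈ Set.Icc x₀.1 (x₀.1 + 1) := hqK.1.1
  have hq2 : q.2 ∈ Set.Icc x₀.2 (x₀.2 + 1) := hqK.1.2
  have hk : k ∈ Set.Icc (0 : ℝ) 1 := hqK.2
  have hglob : ∀ (z : ℝ × ℝ) (h : ℝ), 0 ≤ h → h ≤ 1 → D (z, h) ≤ D (q, k) := by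
    intro z h h0 h1
    obtain ⟨i, j, hi, hj⟩ := exists_int_shift x₀ z
    have e : D (z, h) = D ((z.1 + i, z.2 + j), h) := by
      simp only [hD]
      rw [hu.add_int z, show z.1 + i + h = z.1 + h + i by ring, hu.add_int (z.1 + h, z.2)]
    rw [e]
    exact hmax ⟨⟨hi, hj⟩, ⟨h0, h1⟩⟩
  suffices hq : D (q, k) ≤ 0 by
    have := (hglob y h h0 hle).trans hq
    simp only [hD] at this
    linarith
  by_contra! hpos
  have hk0 : 0 < k := by
    refine lt_of_le_of_ne hk.1 fun h => ?_
    rw [← h] at hpos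
    simp [hD] at hpos
  have hk1 : k < 1 := by
    refine lt_of_le_of_ne hk.2 fun h => ?_
    rw [h] at hpos
    have := hu.add_int q 1 0
    simp only [Int.cast_one, Int.cast_zero, add_zero] at this
    simp [hD, this] at hpos
  have hd2 : u₂ (q.1 + k, q.2) - u₂ q = 0 := by
    have hder : HasDerivAt (fun r => u (q.1 + k, r) - u (q.1, r) - N * k * (1 - k))
        (u₂ (q.1 + k, q.2) - u₂ q) q.2 := ((h2 (q.1 + k) q.2).sub (h2 q.1 q.2)).sub_const _
    refine IsLocalMax.hasDerivAt_eq_zero ?_ hder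
    exact Filter.Eventually.of_forall fun r => hglob (q.1, r) k hk.1 hk.2
  have hd11 : u₁₁ (q.1 + k, q.2) - u₁₁ q + 8 * N ≤ 0 := by
    have hp : ∀ s : ℝ, HasDerivAt (fun s : ℝ => q.1 + k + s) 1 s := fun s =>
      (hasDerivAt_id s).const_add _
    have hm' : ∀ s : ℝ, HasDerivAt (fun s : ℝ => q.1 - s) (-1) s := fun s =>
      (hasDerivAt_id s).const_sub _
    refine second_deriv_nonpos_of_isLocalMax (x := 0)
      (f := fun s => u (q.1 + k + s, q.2) - u (q.1 - s, q.2) - N * (k + 2 * s) * (1 - (k + 2 * s)))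
      (f' := fun s => u₁ (q.1 + k + s, q.2) + u₁ (q.1 - s, q.2) - 2 * N * (1 - 2 * k - 4 * s))
      (fun s => ?_) ?_ ?_
    · have e1 := (h1 (q.1 + k + s) q.2).comp s (hp s)
      have e2 := (h1 (q.1 - s) q.2).comp s (hm' s)
      have e3 : HasDerivAt (fun s : ℝ => N * (k + 2 * s) * (1 - (k + 2 * s)))
          (2 * N * (1 - 2 * k - 4 * s)) s := by
        have e4 : HasDerivAt (fun s : ℝ => k + 2 * s) 2 s := by
          simpa using ((hasDerivAt_id s).const_mul 2).const_add k
        refine ((e4.const_mul N).mul (e4.const_sub 1)).congr_deriv ?_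
        ring
      refine ((e1.sub e2).sub e3).congr_deriv ?_
      ring
    · have e1 := (h11 (q.1 + k + 0) q.2).comp 0 (hp 0)
      have e2 := (h11 (q.1 - 0) q.2).comp 0 (hm' 0)
      have e3 : HasDerivAt (fun s : ℝ => 2 * N * (1 - 2 * k - 4 * s)) (-8 * N) 0 := by
        have e4 : HasDerivAt (fun s : ℝ => 1 - 2 * k - 4 * s) (-4) 0 := by
          simpa using ((hasDerivAt_id (0 : ℝ)).const_mul 4).const_sub (1 - 2 * k)
        refine (e4.const_mul (2 * N)).congr_deriv ?_
        ring
      refine ((e1.add e2).sub e3).congr_deriv ?_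
      simp only [add_zero, sub_zero, Prod.mk.eta]
      ring
    · have hnear : ∀ᶠ s : ℝ in nhds 0, 0 ≤ k + 2 * s ∧ k + 2 * s ≤ 1 := by
        have hc : Continuous fun s : ℝ => k + 2 * s := by fun_prop
        have := hc.tendsto 0
        simp only [mul_zero, add_zero] at this
        filter_upwards [this.eventually (lt_mem_nhds hk0), this.eventually (gt_mem_nhds hk1)]
          with s hs1 hs2
        exact ⟨hs1.le, hs2.le⟩
      filter_upwards [hnear] with s hs
      have := hglob (q.1 - s, q.2) (k + 2 * s) hs.1 hs.2
      simp only [hD] at this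
      rw [show q.1 - s + (k + 2 * s) = q.1 + k + s by ring] at this
      simpa using this
  obtain ⟨a, ha, hH⟩ := H q (by rw [abs_le]; constructor <;> linarith [hq1.1, hq1.2])
    (by rw [abs_le]; constructor <;> linarith [hq2.1, hq2.2])
  have := hH (q.1 + k, q.2) q (by simpa [d, abs_of_pos hk0] using hk1) (by rw [d_self]; norm_num)
  have h3 := (le_abs_self _).trans this
  nlinarith

/-- A periodic function whose image under `∂₂ - a ∂₁²` is nearly constant on every unit ball, with
a coefficient that may change from ball to ball, has small oscillation. -/
theorem abs_sub_le_of_heat_osc (hlam : 0 < lam) (hu : IsPeriodic u) (huc : Continuous u)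
    (hu1 : IsPeriodic u₁) (h11c : Continuous u₁₁) (h2c : Continuous u₂) {B : ℝ}
    (h2b : ∀ z, |u₂ z| ≤ B)
    (h1 : ∀ w c, HasDerivAt (fun r => u (r, c)) (u₁ (w, c)) w)
    (h11 : ∀ w c, HasDerivAt (fun r => u₁ (r, c)) (u₁₁ (w, c)) w)
    (h2 : ∀ c w, HasDerivAt (fun r => u (c, r)) (u₂ (c, w)) w) (hm : 0 < m)
    (H : ∀ x : ℝ × ℝ, |x.1 - x₀.1| ≤ 1 → |x.2 - x₀.2| ≤ 1 → ∃ a, lam ≤ a ∧ ∀ p q, d p x < 1 →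
      d q x < 1 → |(u₂ p - a * u₁₁ p) - (u₂ q - a * u₁₁ q)| ≤ m) (p q : ℝ × ℝ) :
    |u p - u q| ≤ (2 / lam + 5) * m := by
  set N := m / lam with hNdef
  have hN : 0 < N := by positivity
  have hinc : ∀ (y : ℝ × ℝ) (h : ℝ), 0 ≤ h → h ≤ 1 → u (y.1 + h, y.2) - u y ≤ N := by
    intro y h h0 hle
    refine (fst_increment_le hlam hu huc h1 h11 h2 H hN ?_ y h0 hle).trans ?_
    · have : 8 * lam * N = 8 * m := by rw [hNdef]; field_simp
      linarith
    · rw [mul_assoc]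
      exact mul_le_of_le_one_right hN.le (by nlinarith)
  have hfst : ∀ r r' c : ℝ, u (r, c) - u (r', c) ≤ N := by
    intro r r' c
    have e := hu.add_int (r' + Int.fract (r - r'), c) ⌊r - r'⌋ 0
    have h3 : r' + Int.fract (r - r') + ⌊r - r'⌋ = r := by
      have := Int.fract_add_floor (r - r')
      linarith
    simp only [h3, Int.cast_zero, add_zero] at e
    rw [e]
    exact hinc (r', c) _ (Int.fract_nonneg _) (Int.fract_lt_one _).le
  -- averages over one period in the first variable
  set α := x₀.1 - 1 / 2 with hα
  set β := x₀.1 + 1 / 2 with hβ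
  have hαβ : β - α = 1 := by rw [hα, hβ]; ring
  have hle : α ≤ β := by linarith
  set av : ℝ → ℝ := fun t => ∫ r in α..β, u (r, t) with hav
  set v : ℝ → ℝ := fun t => ∫ r in α..β, u₂ (r, t) with hv
  have havd : ∀ t, HasDerivAt av (v t) t := fun t =>
    (intervalIntegral.hasDerivAt_integral_of_dominated_loc_of_deriv_le (μ := volume)
      (F := fun t r => u (r, t)) (F' := fun t r => u₂ (r, t)) (s := Set.univ) (x₀ := t)
      (bound := fun _ => B) Filter.univ_mem
      (Filter.Eventually.of_forall fun t => Continuous.aestronglyMeasurable (by fun_prop))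
      (Continuous.intervalIntegrable (by fun_prop) _ _)
      (Continuous.aestronglyMeasurable (by fun_prop))
      (Filter.Eventually.of_forall fun r _ t _ => h2b (r, t))
      intervalIntegrable_const
      (Filter.Eventually.of_forall fun r _ t _ => h2 r t)).2
  have hzero : ∀ t, ∫ r in α..β, u₁₁ (r, t) = 0 := by
    intro t
    rw [intervalIntegral.integral_eq_sub_of_hasDerivAt (fun r _ => h11 r t)
      (Continuous.intervalIntegrable (by fun_prop) _ _), sub_eq_zero]
    have := hu1.add_int (α, t) 1 0
    simp only [Int.cast_one, Int.cast_zero, add_zero] at this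
    rw [← this, ← hαβ, add_sub_cancel]
  have hvstep : ∀ t t' : ℝ, |t - x₀.2| ≤ 1 → |t' - t| < 1 / 4 → |v t' - v t| ≤ m := by
    intro t t' ht htt
    obtain ⟨a, -, hH⟩ := H (x₀.1, t) (by simp) ht
    have e : v t' - v t = ∫ r in α..β, ((u₂ (r, t') - a * u₁₁ (r, t'))
        - (u₂ (r, t) - a * u₁₁ (r, t))) := by
      have i2 : ∀ t, IntervalIntegrable (fun r => u₂ (r, t)) volume α β := fun t =>
        Continuous.intervalIntegrable (by fun_prop) _ _
      have i11 : ∀ t, IntervalIntegrable (fun r => a * u₁₁ (r, t)) volume α β := fun t =>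
        Continuous.intervalIntegrable (by fun_prop) _ _
      rw [intervalIntegral.integral_sub ((i2 t').sub (i11 t')) ((i2 t).sub (i11 t)),
        intervalIntegral.integral_sub (i2 t') (i11 t'), intervalIntegral.integral_sub (i2 t) (i11 t),
        intervalIntegral.integral_const_mul, intervalIntegral.integral_const_mul, hzero, hzero]
      ring
    have hroot : ∀ w : ℝ, |w| < 1 / 4 → √|w| < 1 / 2 := fun w hw => by
      rw [Real.sqrt_lt' (by norm_num)]
      norm_num
      exact hw
    rw [e, ← Real.norm_eq_abs]
    refine (intervalIntegral.norm_integral_le_of_norm_le_const (C := m) fun r hr => ?_).trans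
      (by rw [hαβ]; simp)
    rw [Set.uIoc_of_le hle] at hr
    have hr1 : |r - x₀.1| ≤ 1 / 2 := by
      rw [abs_le]
      constructor <;> linarith [hr.1, hr.2]
    refine hH _ _ ?_ ?_
    · have := hroot _ htt
      simp only [d]
      linarith
    · simp only [d, sub_self, abs_zero, Real.sqrt_zero]
      linarith
  obtain ⟨t₀, ht₀, hvt₀⟩ : ∃ t₀ ∈ Set.Ioo x₀.2 (x₀.2 + 1), v t₀ = 0 := by
    refine exists_hasDerivAt_eq_zero (by linarith)
      (fun t _ => (havd t).continuousAt.continuousWithinAt) ?_ fun t _ => havd t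
    refine intervalIntegral.integral_congr fun r _ => ?_
    have := hu.add_int (r, x₀.2) 0 1
    simp only [Int.cast_one, Int.cast_zero, add_zero] at this
    exact this.symm
  have hvle : ∀ t ∈ Set.Icc x₀.2 (x₀.2 + 1), |v t| ≤ 5 * m := by
    intro t ht
    have hstep : ∀ k : ℕ, k ≤ 5 → |v (t₀ + k * ((t - t₀) / 5))| ≤ k * m := by
      intro k
      induction k with
      | zero => intro _; simp [hvt₀]
      | succ k ih =>
        intro hk5
        have hk : (k : ℝ) + 1 ≤ 5 := by exact_mod_cast hk5
        have hk0 : (0 : ℝ) ≤ k := k.cast_nonneg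
        have e1 := ih (by omega)
        have e2 := hvstep (t₀ + k * ((t - t₀) / 5)) (t₀ + (k + 1 : ℕ) * ((t - t₀) / 5)) (by
          have e : t₀ + k * ((t - t₀) / 5) - x₀.2
              = (1 - k / 5) * (t₀ - x₀.2) + k / 5 * (t - x₀.2) := by ring
          rw [e, abs_le]
          constructor <;> nlinarith [ht.1, ht.2, ht₀.1, ht₀.2]) (by
          have e : t₀ + (k + 1 : ℕ) * ((t - t₀) / 5) - (t₀ + k * ((t - t₀) / 5)) = (t - t₀) / 5 := by
            push_cast; ring
          rw [e, abs_lt]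
          constructor <;> linarith [ht.1, ht.2, ht₀.1, ht₀.2])
        have e3 := abs_sub_abs_le_abs_sub (v (t₀ + (k + 1 : ℕ) * ((t - t₀) / 5)))
          (v (t₀ + k * ((t - t₀) / 5)))
        push_cast at e2 e3 ⊢
        linarith
    have := hstep 5 le_rfl
    push_cast at this
    rwa [mul_div_cancel₀ _ (by norm_num : (5 : ℝ) ≠ 0), add_sub_cancel] at this
  have havle : ∀ t ∈ Set.Icc x₀.2 (x₀.2 + 1), ∀ t' ∈ Set.Icc x₀.2 (x₀.2 + 1), t ≤ t' →
      |av t' - av t| ≤ 5 * m := by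
    intro t ht t' ht' htt
    have h := abs_sub_le_of_deriv_le htt (fun r _ => havd r)
      (b := fun r => 5 * m * r) (b' := fun _ => 5 * m)
      (fun r _ => by simpa using (hasDerivAt_id r).const_mul (5 * m))
      (fun r hr => hvle r ⟨ht.1.trans hr.1, hr.2.trans ht'.2⟩)
    refine h.trans ?_
    nlinarith [ht.1, ht'.2]
  have hclose : ∀ r t : ℝ, |u (r, t) - av t| ≤ N := by
    intro r t
    have e : u (r, t) - av t = ∫ r' in α..β, (u (r, t) - u (r', t)) := by
      rw [intervalIntegral.integral_sub intervalIntegrable_const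
        (Continuous.intervalIntegrable (by fun_prop) _ _), intervalIntegral.integral_const, hαβ,
        one_smul]
    rw [e, ← Real.norm_eq_abs]
    refine (intervalIntegral.norm_integral_le_of_norm_le_const (C := N) fun r' _ => ?_).trans
      (by rw [hαβ]; simp)
    rw [Real.norm_eq_abs, abs_sub_le_iff]
    exact ⟨hfst _ _ _, hfst _ _ _⟩
  have hcell : ∀ p q : ℝ × ℝ, p.2 ∈ Set.Icc x₀.2 (x₀.2 + 1) → q.2 ∈ Set.Icc x₀.2 (x₀.2 + 1) →
      |u p - u q| ≤ (2 / lam + 5) * m := by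
    intro p q hp hq
    have e1 := hclose p.1 p.2
    have e2 := hclose q.1 q.2
    have e3 : |av p.2 - av q.2| ≤ 5 * m := by
      rcases le_total p.2 q.2 with h | h
      · rw [abs_sub_comm]
        exact havle _ hp _ hq h
      · exact havle _ hq _ hp h
    have e4 : (2 / lam + 5) * m = 2 * N + 5 * m := by rw [hNdef]; ring
    rw [e4]
    simp only [Prod.mk.eta] at e1 e2
    rw [abs_le] at *
    constructor <;> linarith [e1.1, e1.2, e2.1, e2.2, e3.1, e3.2]
  obtain ⟨i, j, -, hj⟩ := exists_int_shift x₀ p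
  obtain ⟨i', j', -, hj'⟩ := exists_int_shift x₀ q
  rw [← hu.add_int p i j, ← hu.add_int q i' j']
  exact hcell _ _ hj hj'

end torus

/-! ### From three-point continuity to the model bound -/

/-- The hypotheses on `U`, with real constants; local splitting is stated through the oscillation
around the base point, in terms of the length scale `τ = T^{1/4}`. -/
structure ModelData (lam κ : ℝ) (A : Finset ℝ) (U : ℝ × ℝ → ℝ × ℝ → ℝ) (a : ℝ × ℝ → ℝ)
    (γ : ℝ × ℝ → ℝ × ℝ → ℝ) (M₁ M₂ : ℝ) : Prop where
  nonneg₁ : 0 ≤ M₁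
  nonneg₂ : 0 ≤ M₂
  exponents : ∀ β ∈ A, 0 ≤ β ∧ β < κ
  bounded : ∃ B : ℝ, ∀ x y, |U x y| ≤ B
  periodic : ∀ x, IsPeriodic (U x)
  continuous : ∀ x, Continuous (U x)
  elliptic : ∀ x, a x ∈ Set.Icc lam lam⁻¹
  splitting : ∀ (x : ℝ × ℝ) (L τ : ℝ), 0 < L → L ≤ 1 → 0 < τ → τ ≤ 1 → ∀ z, d z x < L →
    τ ^ 2 * |heatMoll (a x) (τ ^ 4) (U x) z - heatMoll (a x) (τ ^ 4) (U x) x|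
      ≤ 2 * (M₁ * ∑ β ∈ A, τ ^ β * L ^ (κ - β))
  threePoint : ∀ x y z : ℝ × ℝ, |U x z - U x y - U y z + U y y - γ x y * (z - y).1|
    ≤ M₂ * ∑ β ∈ A, d y x ^ β * d z y ^ (κ - β)

theorem rpow_le_one_add_sq {r e : ℝ} (hr : 0 ≤ r) (he0 : 0 ≤ e) (he : e ≤ 2) :
    r ^ e ≤ 1 + r ^ 2 := by
  rcases le_total r 1 with h | h
  · have := Real.rpow_le_one hr h he0
    nlinarith [sq_nonneg r]
  · have := Real.rpow_le_rpow_of_exponent_le h he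
    rw [Real.rpow_two] at this
    linarith

theorem rpow_le_four {r e : ℝ} (hr : 0 ≤ r) (hr2 : r ≤ 2) (he0 : 0 ≤ e) (he : e ≤ 2) :
    r ^ e ≤ 4 := by
  refine (Real.rpow_le_rpow hr hr2 he0).trans ?_
  refine (Real.rpow_le_rpow_of_exponent_le (by norm_num : (1 : ℝ) ≤ 2) he).trans ?_
  norm_num

theorem rpow_mul_rpow_sub_le {ρ r κ β : ℝ} (hρ : 0 < ρ) (hr : 0 ≤ r) (hβ : β ≤ κ) (h2 : κ - β ≤ 2) :
    r ^ (κ - β) ≤ ρ ^ (κ - β) * (1 + (r / ρ) ^ 2) := by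
  have h := rpow_le_one_add_sq (div_nonneg hr hρ.le) (sub_nonneg.2 hβ) h2
  rw [Real.div_rpow hr hρ.le, div_le_iff₀ (by positivity)] at h
  linarith

section model

variable {lam κ : ℝ} {A : Finset ℝ}

/-- A model with oscillation at most `S` satisfies the single-point hypotheses at every base point:
local splitting is used at distance at most `1/2`, the trivial bound by `S` further away. -/
theorem exists_localSplitting (hlam : 0 < lam) (hκ : κ < 2) (A : Finset ℝ) :
    ∃ C : ℝ, 0 ≤ C ∧ ∀ U a γ M₁ M₂, ModelData lam κ A U a γ M₁ M₂ → ∀ S,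
      (∀ x z z', |U x z - U x z'| ≤ S) → ∀ x, LocalSplitting κ (a x) (C * (M₁ + S)) x (U x) := by
  obtain ⟨C₁, hC₁, h₁⟩ := exists_abs_moll_le_of_pos (n := 0) (m := 1) (by norm_num) (c₂ := 1) one_pos
  obtain ⟨C₂, hC₂, h₂⟩ := exists_abs_moll_le_of_pos (n := 2) (m := 0) (by norm_num) (c₂ := 1) one_pos
  refine ⟨8 * A.card + 8 * (C₁ + lam⁻¹ * C₂) + 1, by positivity, fun U a γ M₁ M₂ h S hS x => ?_⟩
  have hS0 : 0 ≤ S := (abs_nonneg _).trans (hS 0 0 0)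
  have hM := h.nonneg₁
  have ha := h.elliptic x
  have ha0 : 0 < a x := hlam.trans_le ha.1
  refine ⟨h.continuous x, fun z z' => (hS x z z').trans ?_, fun τ hτ hτ1 z => ?_⟩
  · have : 0 ≤ (8 * (A.card : ℝ) + 8 * (C₁ + lam⁻¹ * C₂)) * (M₁ + S) := by positivity
    nlinarith
  · have hd := d_nonneg z x
    have hτκ : 0 < τ ^ (κ - 2) := by positivity
    have hτ2 : 0 < τ ^ 2 := by positivity
    have hw : 0 < 1 + (d z x / τ) ^ 2 := by positivity
    set X := τ ^ (κ - 2) * (1 + (d z x / τ) ^ 2) with hX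
    have hX0 : 0 < X := by positivity
    rw [mul_assoc, ← hX]
    rcases le_or_gt (d z x) (1 / 2) with hz | hz
    · set L := max (2 * d z x) τ with hL
      have hL0 : 0 < L := hτ.trans_le (le_max_right _ _)
      have hL1 : L ≤ 1 := max_le (by linarith) hτ1
      have hdL : d z x < L := by
        rcases hd.eq_or_lt with h0 | h0
        · rwa [← h0]
        · exact lt_of_lt_of_le (by linarith) (le_max_left _ _)
      have hLτ : 1 ≤ L / τ := (one_le_div hτ).2 (le_max_right _ _)
      have hLsq : (L / τ) ^ 2 ≤ 4 * (1 + (d z x / τ) ^ 2) := by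
        have h0 : 0 ≤ (d z x / τ) ^ 2 := sq_nonneg _
        rcases max_choice (2 * d z x) τ with h' | h'
        · rw [hL, h', mul_div_assoc, mul_pow]
          linarith
        · rw [hL, h', div_self hτ.ne']
          linarith
      have hterm : ∀ β ∈ A, τ ^ β * L ^ (κ - β) ≤ τ ^ κ * (4 * (1 + (d z x / τ) ^ 2)) := by
        intro β hβ
        obtain ⟨hβ0, hβκ⟩ := h.exponents β hβ
        have e : τ ^ β * L ^ (κ - β) = τ ^ κ * (L / τ) ^ (κ - β) := by
          rw [Real.div_rpow hL0.le hτ.le, Real.rpow_sub hτ]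
          field_simp
        rw [e]
        refine mul_le_mul_of_nonneg_left (le_trans ?_ hLsq) (by positivity)
        rw [← Real.rpow_two]
        exact Real.rpow_le_rpow_of_exponent_le hLτ (by linarith)
      have hsum := Finset.sum_le_card_nsmul A _ _ hterm
      rw [nsmul_eq_mul] at hsum
      have hsp := h.splitting x L τ hL0 hL1 hτ hτ1 z hdL
      have e2 : τ ^ κ = τ ^ 2 * τ ^ (κ - 2) := by
        rw [Real.rpow_sub hτ, Real.rpow_two]
        field_simp
      have h3 : τ ^ 2 * |heatMoll (a x) (τ ^ 4) (U x) z - heatMoll (a x) (τ ^ 4) (U x) x|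
          ≤ τ ^ 2 * (8 * A.card * M₁ * X) := by
        refine hsp.trans ?_
        calc 2 * (M₁ * ∑ β ∈ A, τ ^ β * L ^ (κ - β))
            ≤ 2 * (M₁ * (A.card * (τ ^ κ * (4 * (1 + (d z x / τ) ^ 2))))) := by gcongr
          _ = τ ^ 2 * (8 * A.card * M₁ * X) := by rw [e2, hX]; ring
      refine (le_of_mul_le_mul_left h3 hτ2).trans ?_
      have p1 : 0 ≤ (8 * (C₁ + lam⁻¹ * C₂) + 1) * (M₁ + S) * X := by positivity
      have p2 : 0 ≤ 8 * A.card * S * X := by positivity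
      nlinarith
    · have hb : ∀ w, |heatMoll (a x) (τ ^ 4) (U x) w| ≤ (C₁ + lam⁻¹ * C₂) * S * (τ ^ 2)⁻¹ := by
        intro w
        have e1 := h₁ S (U x) (h.continuous x) (hS x) τ (τ ^ 4) (τ ^ 4) hτ (by linarith)
          (by linarith) (by linarith) (by linarith) w
        have e2 := h₂ S (U x) (h.continuous x) (hS x) τ (τ ^ 4) (τ ^ 4) hτ (by linarith)
          (by linarith) (by linarith) (by linarith) w
        rw [heatMoll]
        refine (abs_sub _ _).trans ?_
        rw [abs_mul, abs_of_pos ha0]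
        calc |moll 0 1 (τ ^ 4) (τ ^ 4) (U x) w| + a x * |moll 2 0 (τ ^ 4) (τ ^ 4) (U x) w|
            ≤ C₁ * S * (τ ^ (0 + 2 * 1))⁻¹ + lam⁻¹ * (C₂ * S * (τ ^ (2 + 2 * 0))⁻¹) := by
              have := ha.2
              gcongr
          _ = (C₁ + lam⁻¹ * C₂) * S * (τ ^ 2)⁻¹ := by norm_num only; ring
      have hτX : (τ ^ 2)⁻¹ ≤ 4 * X := by
        have h1 : 1 ≤ τ ^ (κ - 2) :=
          Real.one_le_rpow_of_pos_of_le_one_of_nonpos hτ hτ1 (by linarith)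
        have h2 : (τ ^ 2)⁻¹ ≤ 4 * (d z x / τ) ^ 2 := by
          rw [div_pow, inv_eq_one_div, mul_div_assoc']
          gcongr
          nlinarith
        rw [hX]
        nlinarith [sq_nonneg (d z x / τ)]
      refine (abs_sub _ _).trans ((add_le_add (hb z) (hb x)).trans ?_)
      have p0 : 0 ≤ (C₁ + lam⁻¹ * C₂) * S := by positivity
      have p1 : 0 ≤ (8 * (A.card : ℝ) + 1) * (M₁ + S) * X := by positivity
      have p2 : 0 ≤ 8 * (C₁ + lam⁻¹ * C₂) * M₁ * X := by positivity
      have p3 := mul_le_mul_of_nonneg_left hτX p0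
      nlinarith

theorem integral_fst_mul_kern {s t : ℝ} (y : ℝ × ℝ) :
    ∫ z : ℝ × ℝ, (z - y).1 * kern 0 0 s t (y - z) = 0 := by
  have h1 := integral_sub_left_eq_self (fun w : ℝ × ℝ => -w.1 * kern 0 0 s t w) volume y
  have h2 := integral_neg_eq_self (fun w : ℝ × ℝ => -w.1 * kern 0 0 s t w) volume
  have e : ∀ w : ℝ × ℝ, kern 0 0 s t (-w) = kern 0 0 s t w := fun w => by
    simp only [kern, Prod.fst_neg, Prod.snd_neg, ker_zero_neg]
  simp only [e, Prod.fst_neg, neg_neg, neg_mul, integral_neg] at h2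
  have h3 : ∀ z : ℝ × ℝ, (z - y).1 * kern 0 0 s t (y - z) = -(y - z).1 * kern 0 0 s t (y - z) :=
    fun z => by simp only [Prod.fst_sub]; ring
  simp_rw [h3]
  rw [h1]
  simp only [neg_mul, integral_neg]
  linarith

/-- Three-point continuity transfers the mollification error of `U y` at `y` to `U x` at `y`; the
linear term does not contribute since the kernel is even. -/
theorem exists_mollification_error_le (hκ : κ < 2) (A : Finset ℝ) :
    ∃ C : ℝ, 0 ≤ C ∧ ∀ U a γ M₁ M₂, ModelData lam κ A U a γ M₁ M₂ → ∀ x y ρ, 0 < ρ →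
      |(moll 0 0 (ρ ^ 4) (ρ ^ 4) (U x) y - U x y) - (moll 0 0 (ρ ^ 4) (ρ ^ 4) (U y) y - U y y)|
        ≤ C * (M₂ * ∑ β ∈ A, d y x ^ β * ρ ^ (κ - β)) := by
  obtain ⟨C, hC, hk⟩ := exists_integral_mul_kern_le 0 0 (c₂ := 1) one_pos
  refine ⟨C, hC, fun U a γ M₁ M₂ h x y ρ hρ => ?_⟩
  obtain ⟨B, hB⟩ := h.bounded
  have hM := h.nonneg₂
  have hd := d_nonneg y x
  have hρ4 : 0 < ρ ^ 4 := by positivity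
  have i : ∀ x, Integrable fun z => (U x z - U x y) * kern 0 0 (ρ ^ 4) (ρ ^ 4) (y - z) := by
    intro x
    simp_rw [sub_mul]
    exact (integrable_mul_kern (h.continuous x) (hB x) 0 0 hρ4 hρ4 y).sub
      (((integrable_kern 0 0 hρ4 hρ4).comp_sub_left y).const_mul _)
  have i3 : Integrable fun z : ℝ × ℝ => γ x y * ((z - y).1 * kern 0 0 (ρ ^ 4) (ρ ^ 4) (y - z)) := by
    refine Integrable.const_mul ?_ _
    refine (integrable_kern_weight 0 0 hρ4 hρ4 (ρ := 1) one_pos (x := y) (y := y)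
      (by rw [d_self]; exact zero_le_one)).mono' ?_ (Filter.Eventually.of_forall fun z => ?_)
    · have := continuous_kern 0 0 hρ4 hρ4
      exact Continuous.aestronglyMeasurable (by fun_prop)
    · rw [norm_mul, Real.norm_eq_abs, Real.norm_eq_abs, mul_comm]
      gcongr
      have := abs_fst_le_d z y
      simp only [Prod.fst_sub, div_one]
      nlinarith [sq_nonneg (d z y - 1)]
  have e : (moll 0 0 (ρ ^ 4) (ρ ^ 4) (U x) y - U x y) - (moll 0 0 (ρ ^ 4) (ρ ^ 4) (U y) y - U y y)
      = ∫ z, (U x z - U x y - U y z + U y y - γ x y * (z - y).1)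
        * kern 0 0 (ρ ^ 4) (ρ ^ 4) (y - z) := by
    have e1 := integral_sub ((i x).sub (i y)) i3
    have e2 := integral_sub (i x) (i y)
    rw [integral_const_mul, integral_fst_mul_kern, mul_zero, sub_zero] at e1
    simp only [Pi.sub_apply] at e1
    rw [moll_zero_sub (h.continuous x) (hB x) hρ4 hρ4, moll_zero_sub (h.continuous y) (hB y) hρ4 hρ4,
      ← e2, ← e1]
    congr 1 with z
    ring
  rw [e]
  have hsum0 : 0 ≤ ∑ β ∈ A, d y x ^ β * ρ ^ (κ - β) := Finset.sum_nonneg fun β _ => by positivity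
  have := hk ρ (ρ ^ 4) (ρ ^ 4) hρ (by linarith) (by linarith) (by linarith) (by linarith) y y
    (by rw [d_self]; exact hρ.le) (fun z => U x z - U x y - U y z + U y y - γ x y * (z - y).1)
    (M₂ * ∑ β ∈ A, d y x ^ β * ρ ^ (κ - β)) (by positivity) (fun z => by
      refine (h.threePoint x y z).trans ?_
      rw [mul_assoc, Finset.sum_mul]
      refine mul_le_mul_of_nonneg_left (Finset.sum_le_sum fun β hβ => ?_) hM
      obtain ⟨hβ0, hβκ⟩ := h.exponents β hβ
      rw [mul_assoc]
      exact mul_le_mul_of_nonneg_left (rpow_mul_rpow_sub_le hρ (d_nonneg z y) hβκ.le (by linarith))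
        (by positivity))
  simpa using this

/-- Three-point continuity over one period in the first variable, where the increments of `U`
vanish. -/
theorem ModelData.abs_gamma_le {U : ℝ × ℝ → ℝ × ℝ → ℝ} {a : ℝ × ℝ → ℝ} {γ : ℝ × ℝ → ℝ × ℝ → ℝ}
    {M₁ M₂ : ℝ} (h : ModelData lam κ A U a γ M₁ M₂) (x y : ℝ × ℝ) :
    |γ x y| ≤ M₂ * ∑ β ∈ A, d y x ^ β := by
  have h3 := h.threePoint x y (y + (1, 0))
  rw [(h.periodic x y).1, (h.periodic y y).1] at h3
  simpa [d] using h3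

theorem ModelData.sum_le {U : ℝ × ℝ → ℝ × ℝ → ℝ} {a : ℝ × ℝ → ℝ} {γ : ℝ × ℝ → ℝ × ℝ → ℝ}
    {M₁ M₂ : ℝ} (h : ModelData lam κ A U a γ M₁ M₂) (hκ : κ < 2) {x y : ℝ × ℝ} (hd : d y x ≤ 2)
    {w : ℝ} {g : ℝ → ℝ} (hg0 : ∀ β ∈ A, 0 ≤ g β) (hg : ∀ β ∈ A, g β ≤ w) :
    ∑ β ∈ A, d y x ^ β * g β ≤ 4 * A.card * w := by
  have := Finset.sum_le_card_nsmul A (fun β => d y x ^ β * g β) (4 * w) fun β hβ => by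
    obtain ⟨hβ0, hβκ⟩ := h.exponents β hβ
    exact mul_le_mul (rpow_le_four (d_nonneg y x) hd hβ0 (by linarith)) (hg β hβ) (hg0 β hβ)
      (by norm_num)
  rw [nsmul_eq_mul] at this
  linarith

/-- For base points `x` near `x₀`, the function `(∂₂ - a(x) ∂₁²) (U x₀)_T` is nearly constant on the
unit ball at `x`: local splitting says so for `U x`, and `U x₀ - U x` is under control. -/
theorem exists_heatMoll_osc_le (hlam : 0 < lam) (hκ : κ < 2) (A : Finset ℝ) {τ : ℝ} (hτ : 0 < τ)
    (hτ1 : τ ≤ 1) :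
    ∃ C : ℝ, 0 ≤ C ∧ ∀ U a γ M₁ M₂, ModelData lam κ A U a γ M₁ M₂ → ∀ x₀ x, d x x₀ ≤ 2 →
      ∀ p q, d p x < 1 → d q x < 1 →
      |heatMoll (a x) (τ ^ 4) (U x₀) p - heatMoll (a x) (τ ^ 4) (U x₀) q| ≤ C * (M₁ + M₂) := by
  have hτ4 : 0 < τ ^ 4 := by positivity
  have hτ41 : τ ^ 4 ≤ 1 := pow_le_one₀ hτ.le hτ1
  obtain ⟨C₁, hC₁, h₁⟩ := exists_integral_mul_kern_le 0 1 (c₂ := 1) hτ4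
  obtain ⟨C₂, hC₂, h₂⟩ := exists_integral_mul_kern_le 2 0 (c₂ := 1) hτ4
  set E : ℝ := (C₁ + lam⁻¹ * C₂) * (8 * A.card) with hE
  set F : ℝ := 2 * A.card * (τ ^ 2)⁻¹ with hF
  refine ⟨2 * E + 2 * F, by positivity, fun U a γ M₁ M₂ h x₀ x hx p q hp hq => ?_⟩
  obtain ⟨B, hB⟩ := h.bounded
  have hM₁ := h.nonneg₁
  have hM₂ := h.nonneg₂
  have ha := h.elliptic x
  have ha0 : 0 < a x := hlam.trans_le ha.1
  set K : ℝ := 8 * A.card * M₂ with hK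
  have hK0 : 0 ≤ K := by positivity
  have hV : ∀ z, |(U x₀ z - U x₀ x) - (U x z - U x x)| ≤ K * (1 + (d z x / 1) ^ 2) := by
    intro z
    have t1 := h.threePoint x₀ x z
    have t2 := h.abs_gamma_le x₀ x
    have s1 := h.sum_le hκ hx (w := 1 + d z x ^ 2)
      (g := fun β => d z x ^ (κ - β)) (fun β _ => by have := d_nonneg z x; positivity) fun β hβ => by
        obtain ⟨hβ0, hβκ⟩ := h.exponents β hβ
        exact rpow_le_one_add_sq (d_nonneg z x) (by linarith) (by linarith)
    have s2 := h.sum_le hκ hx (w := 1) (g := fun _ => 1) (fun _ _ => zero_le_one)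
      fun _ _ => le_rfl
    simp only [mul_one] at s2
    have t3 : |γ x₀ x * (z - x).1| ≤ M₂ * (4 * A.card) * (1 + d z x ^ 2) := by
      rw [abs_mul]
      have h1 : |(z - x).1| ≤ 1 + d z x ^ 2 := by
        have := abs_fst_le_d z x
        simp only [Prod.fst_sub]
        nlinarith [sq_nonneg (d z x - 1)]
      have h2 : |γ x₀ x| ≤ M₂ * (4 * A.card) := t2.trans (by gcongr)
      gcongr
    have t4 : |U x₀ z - U x₀ x - U x z + U x x - γ x₀ x * (z - x).1|
        ≤ M₂ * (4 * A.card * (1 + d z x ^ 2)) := t1.trans (by gcongr)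
    have e : (U x₀ z - U x₀ x) - (U x z - U x x)
        = (U x₀ z - U x₀ x - U x z + U x x - γ x₀ x * (z - x).1) + γ x₀ x * (z - x).1 := by ring
    rw [e, div_one, hK]
    refine (abs_add_le _ _).trans ?_
    linarith
  have hmoll : ∀ (n m : ℕ), 0 < n + m → ∀ w, moll n m (τ ^ 4) (τ ^ 4) (U x₀) w
      - moll n m (τ ^ 4) (τ ^ 4) (U x) w
      = ∫ z, ((U x₀ z - U x₀ x) - (U x z - U x x)) * kern n m (τ ^ 4) (τ ^ 4) (w - z) := by
    intro n m hnm w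
    rw [moll_eq_sub (h.continuous x₀) (hB x₀) hnm hτ4 hτ4 (U x₀ x) w,
      moll_eq_sub (h.continuous x) (hB x) hnm hτ4 hτ4 (U x x) w]
    have i : ∀ x y, Integrable fun z => (U x z - U x y) * kern n m (τ ^ 4) (τ ^ 4) (w - z) := by
      intro x y
      simp_rw [sub_mul]
      exact (integrable_mul_kern (h.continuous x) (hB x) n m hτ4 hτ4 w).sub
        (((integrable_kern n m hτ4 hτ4).comp_sub_left w).const_mul _)
    rw [← integral_sub (i x₀ x) (i x x)]
    congr 1 with z
    ring
  have hdiff : ∀ w, d w x < 1 → |heatMoll (a x) (τ ^ 4) (U x₀) w - heatMoll (a x) (τ ^ 4) (U x) w|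
      ≤ E * M₂ := by
    intro w hw
    have e1 := h₁ 1 (τ ^ 4) (τ ^ 4) one_pos (by linarith) (by linarith) (by linarith) (by linarith)
      x w hw.le _ K hK0 hV
    have e2 := h₂ 1 (τ ^ 4) (τ ^ 4) one_pos (by linarith) (by linarith) (by linarith) (by linarith)
      x w hw.le _ K hK0 hV
    rw [← hmoll 0 1 (by norm_num)] at e1
    rw [← hmoll 2 0 (by norm_num)] at e2
    rw [one_pow, inv_one, mul_one] at e1 e2
    have e : heatMoll (a x) (τ ^ 4) (U x₀) w - heatMoll (a x) (τ ^ 4) (U x) w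
        = (moll 0 1 (τ ^ 4) (τ ^ 4) (U x₀) w - moll 0 1 (τ ^ 4) (τ ^ 4) (U x) w)
          - a x * (moll 2 0 (τ ^ 4) (τ ^ 4) (U x₀) w - moll 2 0 (τ ^ 4) (τ ^ 4) (U x) w) := by
      simp only [heatMoll]
      ring
    rw [e]
    refine (abs_sub _ _).trans ?_
    rw [abs_mul, abs_of_pos ha0]
    calc _ ≤ C₁ * K + lam⁻¹ * (C₂ * K) := by
          have := ha.2
          gcongr
      _ = E * M₂ := by rw [hE, hK]; ring
  have hsplit : ∀ w, d w x < 1 → |heatMoll (a x) (τ ^ 4) (U x) w - heatMoll (a x) (τ ^ 4) (U x) x|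
      ≤ F * M₁ := by
    intro w hw
    have e1 := h.splitting x 1 τ one_pos le_rfl hτ hτ1 w hw
    have e2 : ∑ β ∈ A, τ ^ β * (1 : ℝ) ^ (κ - β) ≤ A.card := by
      have := Finset.sum_le_card_nsmul A (fun β => τ ^ β * (1 : ℝ) ^ (κ - β)) 1 fun β hβ => by
        rw [Real.one_rpow, mul_one]
        exact Real.rpow_le_one hτ.le hτ1 (h.exponents β hβ).1
      simpa using this
    have e3 : τ ^ 2 * |heatMoll (a x) (τ ^ 4) (U x) w - heatMoll (a x) (τ ^ 4) (U x) x|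
        ≤ τ ^ 2 * (F * M₁) := by
      refine e1.trans ?_
      calc 2 * (M₁ * ∑ β ∈ A, τ ^ β * (1 : ℝ) ^ (κ - β)) ≤ 2 * (M₁ * A.card) := by gcongr
        _ = τ ^ 2 * (F * M₁) := by rw [hF]; field_simp
    exact le_of_mul_le_mul_left e3 (by positivity)
  have g1 := hdiff p hp
  have g2 := hdiff q hq
  have g3 := hsplit p hp
  have g4 := hsplit q hq
  have hE0 : 0 ≤ E := by positivity
  have hF0 : 0 ≤ F := by positivity
  have m1 : 0 ≤ E * M₁ := by positivity
  have m2 : 0 ≤ F * M₂ := by positivity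
  rw [abs_le] at *
  constructor <;> linarith [g1.1, g1.2, g2.1, g2.2, g3.1, g3.2, g4.1, g4.2]

/-- At a fixed scale the mollifications have oscillation of order `M₁ + M₂`. -/
theorem exists_osc_moll_le (hlam : 0 < lam) (hκ : κ < 2) (A : Finset ℝ) {τ : ℝ} (hτ : 0 < τ)
    (hτ1 : τ ≤ 1) :
    ∃ C : ℝ, 0 ≤ C ∧ ∀ U a γ M₁ M₂, ModelData lam κ A U a γ M₁ M₂ → ∀ x p q,
      |moll 0 0 (τ ^ 4) (τ ^ 4) (U x) p - moll 0 0 (τ ^ 4) (τ ^ 4) (U x) q| ≤ C * (M₁ + M₂) := by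
  obtain ⟨C, hC, h⟩ := exists_heatMoll_osc_le hlam hκ A hτ hτ1
  have hτ4 : 0 < τ ^ 4 := by positivity
  refine ⟨(2 / lam + 5) * C, by positivity, fun U a γ M₁ M₂ hU x₀ p q => ?_⟩
  obtain ⟨B, hB⟩ := hU.bounded
  have hM : 0 ≤ M₁ + M₂ := add_nonneg hU.nonneg₁ hU.nonneg₂
  have hu := hU.continuous x₀
  have hb := hB x₀
  refine le_of_forall_pos_le_add fun ε hε => ?_
  have hc : 0 < 2 / lam + 5 := by positivity
  -- the maximum principle is applied with a strictly positive bound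
  have := abs_sub_le_of_heat_osc (m := C * (M₁ + M₂) + ε / (2 / lam + 5)) (x₀ := x₀) hlam
    (moll_periodic (hU.periodic x₀) 0 0 (τ ^ 4) (τ ^ 4)) (continuous_moll hu hb 0 0 hτ4 hτ4)
    (moll_periodic (hU.periodic x₀) 1 0 (τ ^ 4) (τ ^ 4)) (continuous_moll hu hb 2 0 hτ4 hτ4)
    (continuous_moll hu hb 0 1 hτ4 hτ4) (fun z => abs_moll_le hb 0 1 hτ4 hτ4 z)
    (fun w c => by simpa using hasDerivAt_moll_line hu hb 0 0 hτ4 hτ4 (0, c) (1, 0) w)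
    (fun w c => by simpa using hasDerivAt_moll_line hu hb 1 0 hτ4 hτ4 (0, c) (1, 0) w)
    (fun c w => by simpa using hasDerivAt_moll_line hu hb 0 0 hτ4 hτ4 (c, 0) (0, 1) w)
    (by positivity)
    (fun x h1 h2 => ⟨a x, (hU.elliptic x).1, fun p q hp hq => by
      have hx : d x x₀ ≤ 2 := by
        have : √|x.2 - x₀.2| ≤ 1 := by rwa [Real.sqrt_le_one]
        unfold d
        linarith
      have := h U a γ M₁ M₂ hU x₀ x hx p q hp hq
      exact this.trans (le_add_of_nonneg_right (by positivity))⟩) p q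
  refine this.trans (le_of_eq ?_)
  field_simp

/-- The oscillation of `U x` is of order `M₁ + M₂`, uniformly in `x`. If `S` bounds all oscillations,
then so does `S / 2 + E (M₁ + M₂)`; boundedness of `U` allows to absorb. -/
theorem exists_osc_le (hlam : 0 < lam) (hκ1 : 1 < κ) (hκ : κ < 2) (A : Finset ℝ) :
    ∃ C : ℝ, 0 ≤ C ∧ ∀ U a γ M₁ M₂, ModelData lam κ A U a γ M₁ M₂ → ∀ x p q,
      |U x p - U x q| ≤ C * (M₁ + M₂) := by
  obtain ⟨C₁, hC₁, h₁⟩ := exists_localSplitting (κ := κ) hlam hκ A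
  obtain ⟨C₂, hC₂, h₂⟩ := exists_abs_moll_sub_le (κ := κ) hlam (by linarith) hκ
  obtain ⟨C₃, hC₃, h₃⟩ := exists_mollification_error_le (lam := lam) hκ A
  -- at the scale `τ` the mollification error is at most a quarter of the oscillation
  set τ : ℝ := (4 * (C₂ * C₁) + 1)⁻¹ with hτdef
  have hτ : 0 < τ := by positivity
  have hτ1 : τ ≤ 1 := inv_le_one_of_one_le₀ (by linarith [mul_nonneg hC₂ hC₁])
  have hτκ : τ ^ κ ≤ τ := by
    have := Real.rpow_le_rpow_of_exponent_ge hτ hτ1 hκ1.le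
    rwa [Real.rpow_one] at this
  have hsmall : C₂ * C₁ * τ ^ κ ≤ 1 / 4 := by
    have h0 := mul_nonneg hC₂ hC₁
    refine (mul_le_mul_of_nonneg_left hτκ h0).trans ?_
    rw [hτdef, ← div_eq_mul_inv, div_le_iff₀ (by positivity)]
    linarith
  obtain ⟨C₄, hC₄, h₄⟩ := exists_osc_moll_le hlam hκ A hτ hτ1
  set E : ℝ := C₄ + 1 / 2 + 2 * (C₃ * (4 * A.card)) with hE
  have hE0 : 0 ≤ E := by positivity
  refine ⟨2 * E, by positivity, fun U a γ M₁ M₂ hU => ?_⟩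
  have hM₁ := hU.nonneg₁
  have hM₂ := hU.nonneg₂
  obtain ⟨B, hB⟩ := hU.bounded
  have hstep : ∀ S, (∀ x z z', |U x z - U x z'| ≤ S) → ∀ x p q,
      |U x p - U x q| ≤ S / 2 + E * (M₁ + M₂) := by
    intro S hS x p q
    have hS0 : 0 ≤ S := (abs_nonneg _).trans (hS 0 0 0)
    have herr : ∀ y, d y x ≤ 2 → |moll 0 0 (τ ^ 4) (τ ^ 4) (U x) y - U x y|
        ≤ (M₁ + S) / 4 + C₃ * (4 * A.card) * M₂ := by
      intro y hy
      have e1 := h₂ (a y) _ y (U y) (hU.elliptic y) (h₁ U a γ M₁ M₂ hU S hS y) τ hτ hτ1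
      have e2 := h₃ U a γ M₁ M₂ hU x y τ hτ
      have e3 := hU.sum_le hκ hy (w := 1) (g := fun β => τ ^ (κ - β))
        (fun β _ => by positivity) (fun β hβ => Real.rpow_le_one hτ.le hτ1
          (by linarith [(hU.exponents β hβ).2]))
      have e4 : C₂ * (C₁ * (M₁ + S)) * τ ^ κ ≤ (M₁ + S) / 4 := by
        have : 0 ≤ M₁ + S := by positivity
        nlinarith
      have e5 : C₃ * (M₂ * ∑ β ∈ A, d y x ^ β * τ ^ (κ - β)) ≤ C₃ * (4 * A.card) * M₂ := by
        calc _ ≤ C₃ * (M₂ * (4 * A.card * 1)) := by gcongr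
          _ = _ := by ring
      have e6 := abs_sub_abs_le_abs_sub (moll 0 0 (τ ^ 4) (τ ^ 4) (U x) y - U x y)
        (moll 0 0 (τ ^ 4) (τ ^ 4) (U y) y - U y y)
      linarith
    have hcell : ∀ p q, d p x ≤ 2 → d q x ≤ 2 → |U x p - U x q| ≤ S / 2 + E * (M₁ + M₂) := by
      intro p q hp hq
      have e1 := herr p hp
      have e2 := herr q hq
      have e3 := h₄ U a γ M₁ M₂ hU x p q
      have m1 : 0 ≤ C₃ * (4 * A.card) * M₁ := by positivity
      rw [hE]
      rw [abs_le] at *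
      constructor <;> linarith [e1.1, e1.2, e2.1, e2.2, e3.1, e3.2]
    have hd2 : ∀ w : ℝ × ℝ, w.1 ∈ Set.Icc x.1 (x.1 + 1) → w.2 ∈ Set.Icc x.2 (x.2 + 1) →
        d w x ≤ 2 := by
      intro w hw1 hw2
      have k1 : |w.1 - x.1| ≤ 1 := by rw [abs_le]; constructor <;> linarith [hw1.1, hw1.2]
      have k2 : |w.2 - x.2| ≤ 1 := by rw [abs_le]; constructor <;> linarith [hw2.1, hw2.2]
      have k3 : √|w.2 - x.2| ≤ 1 := by rwa [Real.sqrt_le_one]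
      unfold d
      linarith
    obtain ⟨i, j, hi, hj⟩ := exists_int_shift x p
    obtain ⟨i', j', hi', hj'⟩ := exists_int_shift x q
    rw [← (hU.periodic x).add_int p i j, ← (hU.periodic x).add_int q i' j']
    exact hcell _ _ (hd2 _ hi hj) (hd2 _ hi' hj')
  set Q : Set ℝ := {r | ∃ x p q, r = |U x p - U x q|} with hQ
  have hQne : Q.Nonempty := ⟨_, 0, 0, 0, rfl⟩
  have hQb : BddAbove Q := ⟨2 * B, by
    rintro r ⟨x, p, q, rfl⟩
    refine (abs_sub _ _).trans ?_
    linarith [hB x p, hB x q]⟩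
  have hsup : ∀ x p q, |U x p - U x q| ≤ sSup Q := fun x p q => le_csSup hQb ⟨x, p, q, rfl⟩
  have hfix : sSup Q ≤ sSup Q / 2 + E * (M₁ + M₂) := csSup_le hQne (by
    rintro r ⟨x, p, q, rfl⟩
    exact hstep _ hsup x p q)
  intro x p q
  linarith [hsup x p q]

/-- The expansion of `U x` around `x`. For `d y x ≤ 1` all functions are mollified at scale `d y x`; the
mollification error at `y` is that of `U y`, up to three-point continuity. -/
theorem exists_expansion (hlam : 0 < lam) (hκ1 : 1 < κ) (hκ : κ < 2) (A : Finset ℝ) :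
    ∃ C : ℝ, 0 ≤ C ∧ ∀ U a γ M₁ M₂, ModelData lam κ A U a γ M₁ M₂ → ∃ ν : ℝ × ℝ → ℝ,
      ∀ x y, |U x y - U x x - ν x * (y - x).1| ≤ C * (M₁ + M₂) * d y x ^ κ := by
  obtain ⟨C₀, hC₀, h₀⟩ := exists_osc_le hlam hκ1 hκ A
  obtain ⟨C₁, hC₁, h₁⟩ := exists_localSplitting (κ := κ) hlam hκ A
  obtain ⟨C₂, hC₂, h₂⟩ := exists_abs_moll_sub_le (κ := κ) hlam (by linarith) hκ
  obtain ⟨C₃, hC₃, h₃⟩ := exists_mollification_error_le (lam := lam) hκ A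
  obtain ⟨C₄, hC₄, h₄⟩ := exists_slope hlam hκ1 hκ
  -- the common constant in the single-point estimates
  set E : ℝ := C₁ * (1 + C₀) with hE
  have hE0 : 0 ≤ E := by positivity
  refine ⟨C₀ + 2 * (C₂ * E) + C₃ * A.card + C₄ * E, by positivity, fun U a γ M₁ M₂ hU => ?_⟩
  have hM₁ := hU.nonneg₁
  have hM₂ := hU.nonneg₂
  have hN : C₁ * (M₁ + C₀ * (M₁ + M₂)) ≤ E * (M₁ + M₂) := by
    rw [hE, mul_assoc]
    gcongr
    linarith
  have hls := h₁ U a γ M₁ M₂ hU _ (h₀ U a γ M₁ M₂ hU)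
  choose ν hν hexp using fun x => h₄ (a x) _ x (U x) (hU.elliptic x) (hls x)
  refine ⟨ν, fun x y => ?_⟩
  rcases (d_nonneg y x).eq_or_lt with hd | hd
  · have hxy : y = x := by
      by_contra hne
      exact (d_pos hne).ne hd
    rw [hxy]
    simp only [sub_self, Prod.fst_zero, mul_zero, abs_zero]
    have := d_nonneg x x
    positivity
  set ρ := d y x with hρ
  have hρκ : 0 < ρ ^ κ := by positivity
  rcases le_or_gt ρ 1 with hρ1 | hρ1
  · have e1 := hexp x ρ hd hρ1 y hρ.ge
    have e2 := h₂ (a x) _ x (U x) (hU.elliptic x) (hls x) ρ hd hρ1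
    have e3 := h₂ (a y) _ y (U y) (hU.elliptic y) (hls y) ρ hd hρ1
    have e4 := h₃ U a γ M₁ M₂ hU x y ρ hd
    have e5 : ∑ β ∈ A, d y x ^ β * ρ ^ (κ - β) = A.card * ρ ^ κ := by
      rw [← hρ, ← nsmul_eq_mul, ← Finset.sum_const]
      refine Finset.sum_congr rfl fun β _ => ?_
      rw [← Real.rpow_add hd]
      congr 1
      ring
    rw [e5] at e4
    have k1 : C₄ * (C₁ * (M₁ + C₀ * (M₁ + M₂))) * ρ ^ κ ≤ C₄ * (E * (M₁ + M₂)) * ρ ^ κ := by gcongr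
    have k2 : C₂ * (C₁ * (M₁ + C₀ * (M₁ + M₂))) * ρ ^ κ ≤ C₂ * (E * (M₁ + M₂)) * ρ ^ κ := by gcongr
    have p1 : 0 ≤ C₃ * A.card * M₁ * ρ ^ κ := by positivity
    have p2 : 0 ≤ C₀ * (M₁ + M₂) * ρ ^ κ := by positivity
    have hR : (C₀ + 2 * (C₂ * E) + C₃ * A.card + C₄ * E) * (M₁ + M₂) * ρ ^ κ
        = C₀ * (M₁ + M₂) * ρ ^ κ + 2 * (C₂ * (E * (M₁ + M₂)) * ρ ^ κ)
          + (C₃ * A.card * M₁ * ρ ^ κ + C₃ * (M₂ * (A.card * ρ ^ κ)))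
          + C₄ * (E * (M₁ + M₂)) * ρ ^ κ := by ring
    rw [hR]
    have e6 := e1.trans k1
    have e7 := e2.trans k2
    have e8 := e3.trans k2
    rw [abs_le] at e4 e6 e7 e8 ⊢
    constructor <;> linarith [e4.1, e4.2, e6.1, e6.2, e7.1, e7.2, e8.1, e8.2]
  · have e1 := h₀ U a γ M₁ M₂ hU x y x
    have e2 := (hν x).trans (mul_le_mul_of_nonneg_left hN hC₄)
    have e3 : |(y - x).1| ≤ ρ := abs_fst_le_d y x
    have e4 : ρ ≤ ρ ^ κ := by
      have := Real.rpow_le_rpow_of_exponent_le hρ1.le hκ1.le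
      rwa [Real.rpow_one] at this
    have e5 : 1 ≤ ρ ^ κ := hρ1.le.trans e4
    calc |U x y - U x x - ν x * (y - x).1| ≤ |U x y - U x x| + |ν x| * |(y - x).1| := by
          refine (abs_sub _ _).trans ?_
          rw [abs_mul]
      _ ≤ C₀ * (M₁ + M₂) * ρ ^ κ + C₄ * (E * (M₁ + M₂)) * ρ ^ κ := by
          refine add_le_add (e1.trans (le_mul_of_one_le_right (by positivity) e5)) ?_
          exact mul_le_mul e2 (e3.trans e4) (abs_nonneg _) (by positivity)
      _ ≤ C₀ * (M₁ + M₂) * ρ ^ κ + C₄ * (E * (M₁ + M₂)) * ρ ^ κ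
          + (2 * (C₂ * E) + C₃ * A.card) * (M₁ + M₂) * ρ ^ κ :=
          le_add_of_nonneg_right (by positivity)
      _ = (C₀ + 2 * (C₂ * E) + C₃ * A.card + C₄ * E) * (M₁ + M₂) * ρ ^ κ := by ring

end model

/-! ### The extended suprema -/

/-- The oscillation around a point is at most twice the distance to the constants. -/
theorem ofReal_abs_sub_le_iInf_supNormOn {S : Set (ℝ × ℝ)} (f : ℝ × ℝ → ℝ) {p q : ℝ × ℝ}
    (hp : p ∈ S) (hq : q ∈ S) :
    ENNReal.ofReal (|f p - f q| / 2) ≤ ⨅ c : ℝ, supNormOn S (fun y => f y - c) := by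
  refine le_iInf fun c => ?_
  have h : |f p - f q| ≤ |f p - c| + |f q - c| := by
    have := abs_sub_le (f p) c (f q)
    rwa [abs_sub_comm c] at this
  have hP : ∀ r ∈ S, ENNReal.ofReal |f r - c| ≤ supNormOn S (fun y => f y - c) := fun r hr =>
    le_iSup₂_of_le (f := fun y (_ : y ∈ S) => ENNReal.ofReal |f y - c|) r hr le_rfl
  rcases le_total |f p - c| |f q - c| with h' | h'
  · exact (ENNReal.ofReal_le_ofReal (by linarith)).trans (hP q hq)
  · exact (ENNReal.ofReal_le_ofReal (by linarith)).trans (hP p hp)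

/-- A bound on the distance of `(∂₂ - a ∂₁²) u_T` to the constants on `B_L(x)`, in the form
needed for `ModelData.splitting`, with `τ = T^{1/4}`. -/
theorem abs_heatMoll_sub_le {u : ℝ × ℝ → ℝ} {B : ℝ} (hu : Continuous u) (hb : ∀ z, |u z| ≤ B)
    (a : ℝ) {x z : ℝ × ℝ} {L τ R : ℝ} (hτ : 0 < τ) (hz : d z x < L) (hR : 0 ≤ R)
    (h : ENNReal.ofReal (τ ^ 2) * ⨅ c : ℝ, supNormOn (ball x L)
      (fun y => heatOp a (mollify (τ ^ 4) u) y - c) ≤ ENNReal.ofReal R) :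
    τ ^ 2 * |heatMoll a (τ ^ 4) u z - heatMoll a (τ ^ 4) u x| ≤ 2 * R := by
  rw [heatOp_mollify hu hb a (by positivity : 0 < τ ^ 4)] at h
  have hx : x ∈ ball x L := by
    simpa [ball, d_self] using (d_nonneg z x).trans_lt hz
  have h1 := (mul_le_mul_right (ofReal_abs_sub_le_iInf_supNormOn (heatMoll a (τ ^ 4) u)
    (S := ball x L) hz hx) (ENNReal.ofReal (τ ^ 2))).trans h
  rw [← ENNReal.ofReal_mul (by positivity), ENNReal.ofReal_le_ofReal_iff hR] at h1
  linarith

theorem modelConst_le {κ K : ℝ} {U : ℝ × ℝ → ℝ × ℝ → ℝ} {ν : ℝ × ℝ → ℝ}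
    (h : ∀ x y, |U x y - U x x - ν x * (y - x).1| ≤ K * d y x ^ κ) :
    modelConst κ U ν ≤ ENNReal.ofReal K := by
  refine iSup_le fun x => iSup_le fun y => iSup_le fun hxy => ENNReal.ofReal_le_ofReal ?_
  have hd : 0 < d y x := d_pos hxy.symm
  rw [Real.rpow_neg hd.le, inv_mul_le_iff₀ (by positivity), mul_comm _ K]
  exact h x y

theorem abs_le_of_modelConst {κ : ℝ} {U : ℝ × ℝ → ℝ × ℝ → ℝ} {ν : ℝ × ℝ → ℝ} (hκ : κ ≠ 0)
    (h : modelConst κ U ν ≠ ∞) (x y : ℝ × ℝ) :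
    |U x y - U x x - ν x * (y - x).1| ≤ (modelConst κ U ν).toReal * d y x ^ κ := by
  rcases eq_or_ne x y with rfl | hxy
  · simp [d_self, Real.zero_rpow hκ]
  have hd : 0 < d y x := d_pos hxy.symm
  have h1 : ENNReal.ofReal (d y x ^ (-κ) * |U x y - U x x - ν x * (y - x).1|)
      ≤ modelConst κ U ν :=
    le_iSup_of_le x (le_iSup_of_le y (le_iSup_of_le hxy le_rfl))
  rw [ENNReal.ofReal_le_iff_le_toReal h, Real.rpow_neg hd.le, inv_mul_le_iff₀ (by positivity)] at h1
  linarith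

/-- By periodicity, the increment of `U x` over one period in `y₁` vanishes, so that the model
bound over it is one on the slope alone. -/
theorem supNormOn_le_modelConst {κ : ℝ} {U : ℝ × ℝ → ℝ × ℝ → ℝ} (hU : ∀ x, IsPeriodic (U x))
    (ν : ℝ × ℝ → ℝ) : supNormOn Set.univ ν ≤ modelConst κ U ν := by
  refine iSup₂_le fun x _ => ?_
  refine le_iSup_of_le x (le_iSup_of_le (x + (1, 0)) (le_iSup_of_le (by simp [Prod.ext_iff]) ?_))
  rw [(hU x x).1]
  simp [d]

/-- The slopes are compared by evaluating three-point continuity at `z = y + (d(y,x), 0)` and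
inserting the model bound for the increments from `x` to `z`, `x` to `y` and `y` to `z`. -/
theorem ModelData.abs_slope_sub_le {lam κ : ℝ} {A : Finset ℝ} {U : ℝ × ℝ → ℝ × ℝ → ℝ}
    {a : ℝ × ℝ → ℝ} {γ : ℝ × ℝ → ℝ × ℝ → ℝ} {M₁ M₂ : ℝ} (h : ModelData lam κ A U a γ M₁ M₂)
    (hκ0 : 0 < κ) (hκ : κ < 2) {ν : ℝ × ℝ → ℝ} {K : ℝ}
    (hν : ∀ x y, |U x y - U x x - ν x * (y - x).1| ≤ K * d y x ^ κ) {x y : ℝ × ℝ} (hxy : x ≠ y) :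
    |ν y - ν x + γ x y| ≤ (6 + A.card) * (K + M₂) * d y x ^ (κ - 1) := by
  have hr : 0 < d y x := d_pos hxy.symm
  set r := d y x with hrd
  have hK : 0 ≤ K := by
    have := (abs_nonneg _).trans (hν x y)
    exact nonneg_of_mul_nonneg_left this (by positivity)
  have hM := h.nonneg₂
  set z : ℝ × ℝ := y + (r, 0) with hz
  have hzy : d z y = r := by simp [hz, d, abs_of_pos hr]
  have hzx : d z x ≤ 2 * r := by
    have := d_triangle z y x
    rw [hzy, ← hrd] at this
    linarith
  have t := h.threePoint x y z
  have e1 : (z - y).1 = r := by simp [hz]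
  have e2 : (z - x).1 = r + (y - x).1 := by simp [hz]; ring
  have bx := hν x z
  have by' := hν x y
  have bz := hν y z
  rw [e2] at bx
  rw [e1, hzy] at bz
  rw [e1, hzy, ← hrd] at t
  rw [← hrd] at by'
  have hsum : ∑ β ∈ A, r ^ β * r ^ (κ - β) = A.card * r ^ κ := by
    rw [← nsmul_eq_mul, ← Finset.sum_const]
    exact Finset.sum_congr rfl fun β _ => by rw [← Real.rpow_add hr]; ring_nf
  have hpow : d z x ^ κ ≤ 4 * r ^ κ := by
    refine (Real.rpow_le_rpow (d_nonneg _ _) hzx hκ0.le).trans ?_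
    rw [Real.mul_rpow zero_le_two hr.le]
    gcongr
    exact rpow_le_four zero_le_two le_rfl hκ0.le hκ.le
  rw [hsum] at t
  have hKp := mul_le_mul_of_nonneg_left hpow hK
  have hmain : |ν y - ν x + γ x y| * r ≤ K * (6 * r ^ κ) + M₂ * (A.card * r ^ κ) := by
    rw [← abs_of_pos hr, ← abs_mul, abs_of_pos hr]
    rw [abs_le] at *
    constructor <;> linarith [t.1, t.2, bx.1, bx.2, by'.1, by'.2, bz.1, bz.2]
  have hrκ : r ^ κ = r ^ (κ - 1) * r := by
    rw [Real.rpow_sub_one hr.ne', div_mul_cancel₀ _ hr.ne']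
  refine le_of_mul_le_mul_right (hmain.trans ?_) hr
  rw [mul_assoc _ (r ^ (κ - 1)), ← hrκ]
  have hp : 0 ≤ r ^ κ := by positivity
  have p1 : 0 ≤ A.card * K * r ^ κ := by positivity
  have p2 : 0 ≤ 6 * M₂ * r ^ κ := by positivity
  linarith

theorem nuConst_le {κ K : ℝ} {ν : ℝ × ℝ → ℝ} {γ : ℝ × ℝ → ℝ × ℝ → ℝ}
    (h : ∀ x y, x ≠ y → |ν y - ν x + γ x y| ≤ K * d y x ^ (κ - 1)) :
    nuConst κ ν γ ≤ ENNReal.ofReal K := by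
  refine iSup_le fun x => iSup_le fun y => iSup_le fun hxy => ENNReal.ofReal_le_ofReal ?_
  have hd : 0 < d y x := d_pos hxy.symm
  rw [Real.rpow_neg hd.le, inv_mul_le_iff₀ (by positivity), mul_comm _ K]
  exact h x y hxy

end Parabolic

theorem proposition3p1
    (lam κ : ℝ) (hlam : 0 < lam ∧ lam < 1) (hκ : 1 < κ ∧ κ < 2)
    (A : Finset ℝ) (hA : ∀ β ∈ A, 0 ≤ β ∧ β < κ) :
    ∃ C : ℝ≥0, ∀ (U : ℝ × ℝ → ℝ × ℝ → ℝ) (a : ℝ × ℝ → ℝ) (γ : ℝ × ℝ → ℝ × ℝ → ℝ) (M₁ M₂ : ℝ≥0),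
      -- `U` is bounded, and periodic and continuous in the second variable
      (∃ B : ℝ, ∀ x y, |U x y| ≤ B) →
      (∀ x, Parabolic.IsPeriodic (U x)) →
      (∀ x, Continuous (U x)) →
      -- `a` takes values in the interval of ellipticity
      (∀ x, a x ∈ Set.Icc lam lam⁻¹) →
      -- local splitting
      (∀ (x : ℝ × ℝ) (L T : ℝ), 0 < L → L ≤ 1 → 0 < T → T ^ (1 / 4 : ℝ) ≤ 1 →
        ENNReal.ofReal ((T ^ (1 / 4 : ℝ)) ^ 2) *
            ⨅ c : ℝ, Parabolic.supNormOn (Parabolic.ball x L)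
              (fun y => Parabolic.heatOp (a x) (Parabolic.mollify T (U x)) y - c)
          ≤ ENNReal.ofReal (M₁ * ∑ β ∈ A, (T ^ (1 / 4 : ℝ)) ^ β * L ^ (κ - β))) →
      -- three-point continuity
      Continuous (fun p : (ℝ × ℝ) × (ℝ × ℝ) => γ p.1 p.2) →
      (∀ x y z : ℝ × ℝ,
        |U x z - U x y - U y z + U y y - γ x y * (z - y).1|
          ≤ M₂ * ∑ β ∈ A, Parabolic.d y x ^ β * Parabolic.d z y ^ (κ - β)) →
      ∃ ν : ℝ × ℝ → ℝ,
        Parabolic.modelConst κ U ν ≤ C * (M₁ + M₂) ∧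
        Parabolic.supNormOn Set.univ ν ≤ Parabolic.modelConst κ U ν ∧
        Parabolic.supNormOn Set.univ ν ≤ C * (M₁ + M₂) ∧
        Parabolic.nuConst κ ν γ ≤ C * (Parabolic.modelConst κ U ν + M₂) ∧
        Parabolic.nuConst κ ν γ ≤ C * (M₁ + M₂) := by
  obtain ⟨C₁, hC₁, hexp⟩ := Parabolic.exists_expansion hlam.1 hκ.1 hκ.2 A
  lift C₁ to ℝ≥0 using hC₁
  set C₂ : ℝ≥0 := 6 + A.card with hC₂
  refine ⟨C₁ + C₂ + C₂ * (C₁ + 1), fun U a γ M₁ M₂ hbdd hper hcont ha hsplit _ hthree => ?_⟩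
  have hdata : Parabolic.ModelData lam κ A U a γ M₁ M₂ :=
    { nonneg₁ := M₁.coe_nonneg
      nonneg₂ := M₂.coe_nonneg
      exponents := hA
      bounded := hbdd
      periodic := hper
      continuous := hcont
      elliptic := ha
      splitting := fun x L τ hL hL1 hτ hτ1 z hz => by
        obtain ⟨B, hB⟩ := hbdd
        have hroot : (τ ^ 4) ^ (1 / 4 : ℝ) = τ := by
          simpa using Real.pow_rpow_inv_natCast hτ.le (n := 4) (by norm_num)
        have hs := hsplit x L (τ ^ 4) hL hL1 (by positivity) (by rwa [hroot])
        rw [hroot] at hs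
        exact Parabolic.abs_heatMoll_sub_le (hcont x) (hB x) (a x) hτ hz
          (mul_nonneg M₁.coe_nonneg (Finset.sum_nonneg fun β _ => by positivity)) hs
      threePoint := hthree }
  obtain ⟨ν, hν⟩ := hexp U a γ M₁ M₂ hdata
  have hU : Parabolic.modelConst κ U ν ≤ C₁ * (M₁ + M₂) := by
    refine (Parabolic.modelConst_le hν).trans_eq ?_
    rw [← NNReal.coe_add, ← NNReal.coe_mul, ENNReal.ofReal_coe_nnreal]
    push_cast
    rfl
  have hfin : Parabolic.modelConst κ U ν ≠ ∞ := ne_top_of_le_ne_top (by finiteness) hU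
  have hslope : Parabolic.nuConst κ ν γ ≤ C₂ * (Parabolic.modelConst κ U ν + M₂) := by
    refine (Parabolic.nuConst_le fun x y hxy => hdata.abs_slope_sub_le (by linarith [hκ.1]) hκ.2
      (Parabolic.abs_le_of_modelConst (by linarith [hκ.1] : (0 : ℝ) < κ).ne' hfin) hxy).trans_eq ?_
    have hC₂' : (6 + A.card : ℝ) = C₂ := by rw [hC₂]; push_cast; rfl
    rw [hC₂', ENNReal.ofReal_mul C₂.coe_nonneg,
      ENNReal.ofReal_add ENNReal.toReal_nonneg M₂.coe_nonneg, ENNReal.ofReal_toReal hfin,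
      ENNReal.ofReal_coe_nnreal, ENNReal.ofReal_coe_nnreal]
  have hsup : Parabolic.supNormOn Set.univ ν ≤ Parabolic.modelConst κ U ν :=
    Parabolic.supNormOn_le_modelConst hper ν
  have le₁ : (C₁ : ℝ≥0∞) ≤ (C₁ + C₂ + C₂ * (C₁ + 1) : ℝ≥0) := by
    exact_mod_cast (le_self_add.trans le_self_add : C₁ ≤ C₁ + C₂ + C₂ * (C₁ + 1))
  have le₂ : (C₂ : ℝ≥0∞) ≤ (C₁ + C₂ + C₂ * (C₁ + 1) : ℝ≥0) := by
    exact_mod_cast (le_add_self.trans le_self_add : C₂ ≤ C₁ + C₂ + C₂ * (C₁ + 1))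
  have le₃ : (C₂ : ℝ≥0∞) * (C₁ + 1) ≤ (C₁ + C₂ + C₂ * (C₁ + 1) : ℝ≥0) := by
    exact_mod_cast (le_add_self : C₂ * (C₁ + 1) ≤ C₁ + C₂ + C₂ * (C₁ + 1))
  have hU' : Parabolic.modelConst κ U ν ≤ (C₁ + C₂ + C₂ * (C₁ + 1) : ℝ≥0) * (M₁ + M₂) :=
    hU.trans (by gcongr)
  refine ⟨ν, hU', hsup, hsup.trans hU', hslope.trans (by gcongr), hslope.trans ?_⟩
  calc (C₂ : ℝ≥0∞) * (Parabolic.modelConst κ U ν + M₂)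
      ≤ C₂ * (C₁ * (M₁ + M₂) + (M₁ + M₂)) := by
        gcongr
        exact le_add_self
    _ = C₂ * (C₁ + 1) * (M₁ + M₂) := by ring
    _ ≤ _ := by gcongr
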